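/- Let $0<c_0<\delta\le 1$. There is a constant $c_1>0$, depending only on $c_0$ and $\delta$, such that the following holds for every integer $n\ge 1$ and every real bistochastic $n\times n$ matrix $Q$ (nonnegative entries, all row and column sums equal to $1$). Set $$d=\max_x\bigl|\{y:(Q^{\intercal}Q)_{xy}\neq 0\}\bigr|,\qquad \rho=\max\Bigl\{\Bigl(\tfrac1n\sum_{x,y}Q_{xy}^2\Bigr)^{1/2},\ \min_{\mathcal E\subset[n],\,|\mathcal E|<n^{1-\delta}}\ \max_{x\notin\mathcal E,\,y\in[n]}Q_{yx}\Bigr\},$$ and assume $d\ge 2$. Let $\sigma$ be a uniformly distributed random permutation of $[n]=\{1,\dots,n\}$, let $M$ be its permutation matrix, $M_{xy}=\mathbf 1(\sigma(x)=y)$, and let $P=MQ$. Then for every integer $\ell\ge 1$, $$\mathbb P\Bigl(\bigl\|(P^{\ell})_{|\mathbf 1^{\perp}}\bigr\|\ \ge\ e^{c_1\sqrt{\log n}}\,\rho^{\ell}\Bigr)\ \le\ d^{\,\ell+50\sqrt{\log n}}\,n^{-c_0},$$ where $\|(P^\ell)_{|\mathbf 1^\perp}\|=\max\{\|P^\ell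 v\|_2/\|v\|_2 : v\in\mathbb R^n\setminus\{0\},\ \sum_x v_x=0\}$ is the operator norm of $P^\ell$ on the orthogonal of the constant vector. -/

import Mathlib

noncomputable section

namespace RandomBistochastic

/-- The probability of an event under the uniform measure on the symmetric group:
`|E| / |𝕊ₙ|`. -/
def uniformProb {n : ℕ} (E : Set (Equiv.Perm (Fin n))) : ℝ :=
  (E.ncard : ℝ) / (Nat.card (Equiv.Perm (Fin n)) : ℝ)

/-- The random matrix `P = M Q`, where `M` is the permutation matrix of `σ`,
that is `M x y = 1` if `σ x = y` and `0` otherwise. -/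
def permMul {n : ℕ} (σ : Equiv.Perm (Fin n)) (Q : Matrix (Fin n) (Fin n) ℝ) :
    Matrix (Fin n) (Fin n) ℝ :=
  σ.permMatrix ℝ * Q

/-- The normalized Hilbert-Schmidt norm `√((1/n) tr (A Aᵀ))` of a real matrix. -/
def hsNorm {n : ℕ} (A : Matrix (Fin n) (Fin n) ℝ) : ℝ :=
  √((1 / (n : ℝ)) * (A * A.transpose).trace)

/-- The relaxed `ℓ¹ → ℓ^∞` norm: the infimum, over sets `E` of columns with `|E| < n^(1-δ)`, of the
largest absolute value of an entry outside the columns in `E`. -/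
def relaxedSupNorm {n : ℕ} (δ : ℝ) (A : Matrix (Fin n) (Fin n) ℝ) : ℝ :=
  ⨅ E : {E : Finset (Fin n) // (E.card : ℝ) < (n : ℝ) ^ (1 - δ)},
    ⨆ p : {p : Fin n × Fin n // p.2 ∉ E.1}, |A p.1.1 p.1.2|

/-- The sparsity parameter: the largest number of nonzero entries in a row. -/
def maxRowSupport {n : ℕ} (A : Matrix (Fin n) (Fin n) ℝ) : ℕ :=
  Finset.univ.sup fun x : Fin n => {y : Fin n | A x y ≠ 0}.ncard

/-- `d`, the largest number of nonzero entries in a row of `Qᵀ Q`. -/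
def sparsity {n : ℕ} (Q : Matrix (Fin n) (Fin n) ℝ) : ℕ :=
  maxRowSupport (Q.transpose * Q)

/-- `ρ`, the maximum of the normalized Hilbert-Schmidt norm and of the relaxed sup norm of `Q`. -/
def rho {n : ℕ} (δ : ℝ) (Q : Matrix (Fin n) (Fin n) ℝ) : ℝ :=
  max (hsNorm Q) (relaxedSupNorm δ Q)

/-- The hyperplane of Euclidean space orthogonal to the constant vector `(1, …, 1)`. -/
def onesPerp (n : ℕ) : Submodule ℝ (EuclideanSpace ℝ (Fin n)) :=
  (ℝ ∙ (WithLp.toLp 2 (fun _ => 1) : EuclideanSpace ℝ (Fin n)))ᗮ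

/-- The operator norm of `A` restricted to the orthogonal of the constant vector, that is the
maximum of `‖A v‖₂ / ‖v‖₂` over the nonzero `v` with `⟨v, 𝟙⟩ = 0`. -/
def normOnOnesPerp {n : ℕ} (A : Matrix (Fin n) (Fin n) ℝ) : ℝ :=
  ‖(Matrix.toEuclideanCLM (n := Fin n) (𝕜 := ℝ) A).comp (onesPerp n).subtypeL‖

end RandomBistochastic

end

noncomputable section

namespace RandomBistochastic

open Finset

/-! Write s = √(log n). On the hyperplane the averaging matrix vanishes, so `P ^ ℓ` may be replaced
there by `(cenMat σ * Q) ^ ℓ`, where the permutation matrix has been centred (`cenMat_mul_pow`). Cut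
ℓ into a fixed number K of blocks, each of length l with d ^ l ≤ n ^ ε; it suffices to bound the
norm of one block by e ^ (O(s)) ρ ^ l outside an event of probability n ^ (-c₀).

An entry of a block is a sum over walks: sequences of pairs (x, y), weighted by centred entries at
the pairs and by entries of `Q` at the links from y to the next x. Gluing linked labels turns the
pairs into edges of a multigraph, and `genus` is the cycle rank of the part visited. In expectation
a pair costs 1 / n however often it is used, while a class of linked labels has n choices for one
label; by Euler's relation (`card_pairs_add_one`) a walk of cycle rank g has total weight about n ^
(1 - g). Let `E` be the exceptional set of columns, of size below n ^ (1 - δ). A walk is good if it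
has cycle rank 0 and visits `E` at most J times, or has cycle rank 1 and avoids `E`.

A walk that ceases to be good has cycle rank at least 2 or visits `E` too often, and either defect
costs n ^ (-δ). A first moment bound, with crude factors absorbed in n ^ (O(ε)), settles these walks
(`permAvg_sum_abs_badMat_le`). For the good part a moment of order S, between 4s and 8s, is bounded
by the trace of a product of S walks traversed alternately forwards and backwards
(`permAvg_norm_goodMat_pow_le`). Two facts make this work.

Few shapes: a forward walk of cycle rank at most 1 never repeats an edge except by winding around a
single cycle (`IsMultiWalk.tameSeq`). So S concatenated good walks are described, up to renaming
labels, by O(S (g + 1)) instructions (`card_isReset_le`, `firstIdx_eq_of_stepCode_eq`). With length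
N polynomial in s this is at most n ^ ((g + 1) / 2) shapes for large n, against the weight n ^ (1 -
g). Markov's inequality at order about s then loses only e ^ (O(s)), which is the factor in the
theorem.

Sharp rate: scale `Q` by lam = 1 / ρ outside `E`. The result has entries at most 1, row and column
sums at most lam, and squared Hilbert-Schmidt norm at most n. Each class costs n for one label, or
for two labels if one of its links is used twice; the remaining labels cost lam each
(`sum_prod_lk_le`). A count of labels (`three_mul_card_comps_le`) shows that, up to O(g + S), there
are no more of these than entries isolated in row and column, and each such centred entry gains N /
√n (`mixMoment_bounds`), which beats lam.

Since ρ ≥ d ^ (-1/2) (`one_le_sparsity_mul_rho_sq`), the event is empty when n or ℓ is small; when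
log d is large compared with s, the right-hand side exceeds 1. -/

/-- The average of `f` over the symmetric group. -/
def permAvg {n : ℕ} (f : Equiv.Perm (Fin n) → ℝ) : ℝ := (∑ σ, f σ) / (n.factorial : ℝ)

/-- The `(x, y)` entry of the permutation matrix of `σ`. -/
def hit {n : ℕ} (σ : Equiv.Perm (Fin n)) (p : Fin n × Fin n) : ℝ := if σ p.1 = p.2 then 1 else 0

/-- The centred entry of the permutation matrix. -/
def cen {n : ℕ} (σ : Equiv.Perm (Fin n)) (p : Fin n × Fin n) : ℝ := hit σ p - 1 / n

/-! ### Averages over permutations and Markov's inequality. -/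

section avg
variable {n : ℕ} {ι : Type*}

lemma permAvg_const_mul (c : ℝ) (f : Equiv.Perm (Fin n) → ℝ) :
    permAvg (fun σ => c * f σ) = c * permAvg f := by
  simp [permAvg, ← mul_sum, mul_div_assoc]

lemma permAvg_sum (s : Finset ι) (f : ι → Equiv.Perm (Fin n) → ℝ) :
    permAvg (fun σ => ∑ i ∈ s, f i σ) = ∑ i ∈ s, permAvg (f i) := by
  simp only [permAvg]; rw [sum_comm, sum_div]

lemma permAvg_sub (f g : Equiv.Perm (Fin n) → ℝ) :
    permAvg (fun σ => f σ - g σ) = permAvg f - permAvg g := by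
  simp [permAvg, sum_sub_distrib, sub_div]

lemma permAvg_mono {f g : Equiv.Perm (Fin n) → ℝ} (h : ∀ σ, f σ ≤ g σ) :
    permAvg f ≤ permAvg g := by
  unfold permAvg; gcongr with σ; exact h σ

/-- Markov's inequality for the uniform measure on permutations. -/
lemma uniformProb_le_permAvg {f : Equiv.Perm (Fin n) → ℝ} (hf : ∀ σ, 0 ≤ f σ) {t : ℝ} (ht : 0 < t)
    {E : Set (Equiv.Perm (Fin n))} (hE : ∀ σ ∈ E, t ≤ f σ) :
    uniformProb E ≤ permAvg f / t := by
  classical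
  unfold uniformProb permAvg
  rw [le_div_iff₀ ht, Nat.card_eq_fintype_card, Fintype.card_perm, Fintype.card_fin, div_mul_eq_mul_div]
  gcongr
  rw [Set.ncard_eq_toFinset_card' E, ← nsmul_eq_mul, ← sum_const]
  calc ∑ _i ∈ E.toFinset, t ≤ ∑ i ∈ E.toFinset, f i :=
        sum_le_sum fun i hi => hE i (by simpa using hi)
    _ ≤ _ := sum_le_sum_of_subset_of_nonneg (subset_univ _) fun i _ _ => hf i

lemma uniformProb_mono {E F : Set (Equiv.Perm (Fin n))} (h : E ⊆ F) :
    uniformProb E ≤ uniformProb F := by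
  unfold uniformProb
  gcongr
  exact Set.toFinite F

lemma uniformProb_union_le (E F : Set (Equiv.Perm (Fin n))) :
    uniformProb (E ∪ F) ≤ uniformProb E + uniformProb F := by
  unfold uniformProb
  rw [← add_div]
  gcongr
  exact_mod_cast Set.ncard_union_le E F

lemma uniformProb_le_one (E : Set (Equiv.Perm (Fin n))) : uniformProb E ≤ 1 := by
  unfold uniformProb
  apply div_le_one_of_le₀ _ (by positivity)
  rw [← Set.ncard_univ]; exact_mod_cast Set.ncard_le_ncard (Set.subset_univ E)

end avg

/-! ### Mixed moments of entries of a random permutation matrix. -/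

section moments
variable {n : ℕ}

/-- A partial bijection extends to one permutation τ. Multiplication by τ⁻¹ carries its extensions
to the permutations fixing the first coordinates of `T`, that is, to the permutations of the other
`n - #T` points. -/
lemma card_perm_extending (T : Finset (Fin n × Fin n)) (h1 : Set.InjOn Prod.fst (T : Set (Fin n × Fin n)))
    (h2 : Set.InjOn Prod.snd (T : Set (Fin n × Fin n))) :
    #{σ : Equiv.Perm (Fin n) | ∀ p ∈ T, σ p.1 = p.2} = (n - #T).factorial := by
  classical
  let e1 : {p // p ∈ T} ≃ {x // x ∈ T.image Prod.fst} :=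
    Equiv.ofBijective (fun p => ⟨p.1.1, mem_image_of_mem _ p.2⟩) (by
      constructor
      · intro p q h
        exact Subtype.ext (h1 p.2 q.2 (by simpa using h))
      · rintro ⟨x, hx⟩
        obtain ⟨p, hp, rfl⟩ := mem_image.1 hx
        exact ⟨⟨p, hp⟩, rfl⟩)
  let e2 : {p // p ∈ T} ≃ {x // x ∈ T.image Prod.snd} :=
    Equiv.ofBijective (fun p => ⟨p.1.2, mem_image_of_mem _ p.2⟩) (by
      constructor
      · intro p q h
        exact Subtype.ext (h2 p.2 q.2 (by simpa using h))
      · rintro ⟨x, hx⟩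
        obtain ⟨p, hp, rfl⟩ := mem_image.1 hx
        exact ⟨⟨p, hp⟩, rfl⟩)
  let τ : Equiv.Perm (Fin n) := (e1.symm.trans e2).extendSubtype
  have hτ : ∀ p ∈ T, τ p.1 = p.2 := by
    intro p hp
    have := Equiv.extendSubtype_apply_of_mem (e1.symm.trans e2) p.1 (mem_image_of_mem _ hp)
    rw [show τ p.1 = _ from this]
    have h3 : e1.symm ⟨p.1, mem_image_of_mem _ hp⟩ = ⟨p, hp⟩ := by
      rw [Equiv.symm_apply_eq]; rfl
    simp only [Equiv.trans_apply, h3]; rfl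
  have hc : Fintype.card {f : Equiv.Perm (Fin n) // ∀ a, ¬ (a ∉ T.image Prod.fst) → f a = a}
      = (n - #T).factorial := by
    rw [← Fintype.card_congr (Equiv.Perm.subtypeEquivSubtypePerm (fun a => a ∉ T.image Prod.fst)),
      Fintype.card_perm, Fintype.card_subtype_compl, Fintype.card_coe, Fintype.card_fin,
      card_image_of_injOn h1]
  rw [← hc, Fintype.card_subtype]
  apply card_bij' (fun σ _ => τ⁻¹ * σ) (fun σ _ => τ * σ)
  · intro σ hσ
    simp only [mem_filter, mem_univ, true_and] at hσ ⊢
    intro a ha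
    simp only [not_not, mem_image] at ha
    obtain ⟨p, hp, rfl⟩ := ha
    simp [hσ p hp, ← hτ p hp]
  · intro σ hσ
    simp only [mem_filter, mem_univ, true_and] at hσ ⊢
    intro p hp
    simp [hσ p.1 (by simpa using ⟨p.2, hp⟩), hτ p hp]
  · intro σ _; simp
  · intro σ _; simp

lemma permAvg_prod_hit (T : Finset (Fin n × Fin n)) (h1 : Set.InjOn Prod.fst (T : Set (Fin n × Fin n)))
    (h2 : Set.InjOn Prod.snd (T : Set (Fin n × Fin n))) :
    permAvg (fun σ => ∏ p ∈ T, hit σ p) = ((n - #T).factorial : ℝ) / n.factorial := by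
  unfold permAvg
  congr 1
  rw [← card_perm_extending T h1 h2, card_filter]
  push_cast
  refine sum_congr rfl fun σ _ => ?_
  unfold hit
  rw [prod_ite_zero]
  simp

lemma prod_hit_eq_zero (σ : Equiv.Perm (Fin n)) (T : Finset (Fin n × Fin n))
    (h : ¬ (Set.InjOn Prod.fst (T : Set (Fin n × Fin n)) ∧ Set.InjOn Prod.snd (T : Set (Fin n × Fin n)))) :
    ∏ p ∈ T, hit σ p = 0 := by
  by_contra hne
  rw [← ne_eq, prod_ne_zero_iff] at hne
  have hh : ∀ p ∈ T, σ p.1 = p.2 := by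
    intro p hp
    have := hne p hp
    unfold hit at this
    by_contra hc
    simp [hc] at this
  apply h
  constructor
  · intro p hp q hq hpq
    exact Prod.ext hpq (by rw [← hh p hp, ← hh q hq, hpq])
  · intro p hp q hq hpq
    exact Prod.ext (σ.injective (by rw [hh p hp, hh q hq, hpq])) hpq

/-- The mixed moment of `t` entries and `a` centred entries in general position. -/
def mixMoment (n : ℕ) : ℕ → ℕ → ℝ
  | 0, t => ((n - t).factorial : ℝ) / n.factorial
  | a + 1, t => mixMoment n a (t + 1) - mixMoment n a t / n

/-- Writing one centred factor as `hit - 1 / n` is exactly the recursion of `mixMoment`, so in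
general position only the two cardinalities matter. -/
lemma permAvg_prod_hit_mul_prod_cen (U : Finset (Fin n × Fin n)) :
    ∀ T : Finset (Fin n × Fin n), Disjoint T U →
      Set.InjOn Prod.fst ((T ∪ U : Finset _) : Set (Fin n × Fin n)) →
      Set.InjOn Prod.snd ((T ∪ U : Finset _) : Set (Fin n × Fin n)) →
      permAvg (fun σ => (∏ p ∈ T, hit σ p) * ∏ p ∈ U, cen σ p) = mixMoment n #U #T := by
  classical
  induction U using Finset.induction_on with
  | empty =>
    intro T _ h1 h2
    simp only [union_empty] at h1 h2
    simpa [mixMoment] using permAvg_prod_hit T h1 h2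
  | insert u U hu ih =>
    intro T hd h1 h2
    rw [disjoint_insert_right] at hd
    have key : (fun σ => (∏ p ∈ T, hit σ p) * ∏ p ∈ insert u U, cen σ p) =
        fun σ => (∏ p ∈ insert u T, hit σ p) * ∏ p ∈ U, cen σ p -
          (1 / n) * ((∏ p ∈ T, hit σ p) * ∏ p ∈ U, cen σ p) := by
      funext σ
      rw [prod_insert hu, prod_insert hd.1]
      rw [show cen σ u = hit σ u - 1 / n from rfl]
      ring
    rw [key, permAvg_sub, permAvg_const_mul, ih (insert u T), ih T hd.2, card_insert_of_notMem hu,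
      card_insert_of_notMem hd.1, mixMoment]
    · ring
    · exact h1.mono (by intro p; simp; tauto)
    · exact h2.mono (by intro p; simp; tauto)
    · rw [disjoint_insert_left]; exact ⟨hu, hd.2⟩
    · convert h1 using 2; ext p; simp
    · convert h2 using 2; ext p; simp

/-- The definition subtracts two terms of nearly equal size. Here the cancellation has been carried
out: all coefficients are nonnegative, so sign and size follow by induction. For `a = 0` the last
coefficient vanishes, and the truncated index `a - 1` is harmless. -/
lemma mixMoment_rec (hn : 0 < n) (a : ℕ) : ∀ t : ℕ, a + t + 1 ≤ n → mixMoment n (a + 1) t =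
    ((t + a : ℕ) : ℝ) / n * mixMoment n a (t + 1) + (a : ℝ) / n ^ 2 * mixMoment n (a - 1) (t + 1) := by
  have hn' : (n : ℝ) ≠ 0 := by positivity
  induction a with
  | zero =>
    intro t ht
    simp only [mixMoment, CharP.cast_eq_zero, zero_div, zero_mul, add_zero]
    obtain ⟨r, rfl⟩ : ∃ r, n = t + r + 1 := ⟨n - t - 1, by omega⟩
    rw [show t + r + 1 - t = r + 1 by omega, show t + r + 1 - (t + 1) = r by omega,
      Nat.factorial_succ r]
    have : ((t + r + 1).factorial : ℝ) ≠ 0 := by positivity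
    field_simp
    push_cast
    ring
  | succ a ih =>
    intro t ht
    have e1 := ih (t + 1) (by omega)
    have e2 := ih t (by omega)
    have d1 : mixMoment n (a + 1 + 1) t = mixMoment n (a + 1) (t + 1) - mixMoment n (a + 1) t / n := rfl
    have d2 : mixMoment n (a + 1) (t + 1) = mixMoment n a (t + 1 + 1) - mixMoment n a (t + 1) / n := rfl
    simp only [Nat.add_sub_cancel]
    rcases a with _ | a
    · simp only [zero_add, CharP.cast_eq_zero, zero_div, zero_mul, add_zero] at *
      rw [d1]
      nth_rewrite 1 [e1]
      rw [e2, d2]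
      push_cast
      field_simp
      ring
    · have d3 : mixMoment n (a + 1) (t + 1) = mixMoment n a (t + 1 + 1) - mixMoment n a (t + 1) / n := rfl
      simp only [Nat.add_sub_cancel] at *
      rw [d1]
      nth_rewrite 1 [e1]
      rw [e2, d2]
      have d4 : mixMoment n a (t + 1 + 1) = mixMoment n (a + 1) (t + 1) + mixMoment n a (t + 1) / n := by
        rw [d3]; ring
      rw [d4]
      push_cast
      field_simp
      ring

/-- In `mixMoment_rec` the first term removes one centred factor at a price N / n², the second
removes two at a price N / n³. Both fit a geometric rate K = 2N / n ^ (3/2) per centred factor, a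
gain of 2N / √n over an uncentred one. -/
lemma mixMoment_bounds {N : ℕ} (hN : 0 < N) (hNn : 2 * N ^ 2 ≤ n) (a : ℕ) : ∀ t : ℕ, a + t ≤ N →
    0 ≤ mixMoment n a t ∧
      mixMoment n a t ≤ 2 * (1 / n) ^ t * (2 * N / (n * √n)) ^ a := by
  have hn : 0 < n := by nlinarith
  have hn' : (0 : ℝ) < n := by positivity
  have hNn' : N ≤ n := by nlinarith
  induction a using Nat.strong_induction_on with
  | _ a ih =>
  intro t hat
  rcases a with _ | a
  · simp only [mixMoment, pow_zero, mul_one]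
    refine ⟨by positivity, ?_⟩
    have h1 := Nat.factorial_mul_descFactorial (show t ≤ n by omega)
    have h2 := Nat.pow_sub_le_descFactorial n t
    -- Bernoulli's inequality: the falling factorial is at least (n - N) ^ t ≥ n ^ t (1 - tN / n),
    -- and tN ≤ N² ≤ n / 2.
    have h3 : ((n : ℝ) ^ t) / 2 ≤ (n.descFactorial t : ℝ) := by
      calc ((n : ℝ) ^ t) / 2 ≤ (n : ℝ) ^ t * (1 + t * (-(N : ℝ) / n)) := by
            have : (t : ℝ) * (N / n) ≤ 1 / 2 := by
              rw [← mul_div_assoc, div_le_iff₀ hn']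
              have : t * N ≤ N * N := Nat.mul_le_mul_right _ (by omega)
              have : 2 * (t * N) ≤ n := by nlinarith
              have : (2 : ℝ) * (t * N) ≤ n := by exact_mod_cast this
              linarith
            have h4 : (t : ℝ) * (-(N : ℝ) / n) = -(t * (N / n)) := by ring
            rw [h4, div_eq_mul_one_div]
            gcongr
            linarith
        _ ≤ (n : ℝ) ^ t * (1 + (-(N : ℝ) / n)) ^ t := by
            gcongr
            apply one_add_mul_le_pow
            rw [le_div_iff₀ hn']
            have : (N : ℝ) ≤ n := by exact_mod_cast hNn'
            linarith
        _ = ((n : ℝ) - N) ^ t := by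
            rw [← mul_pow]; congr 1; field_simp; ring
        _ ≤ (((n + 1 - t : ℕ) : ℝ)) ^ t := by
            have : (N : ℝ) ≤ n := by exact_mod_cast hNn'
            have h7 : (n : ℝ) - N ≤ ((n + 1 - t : ℕ) : ℝ) := by
              rw [Nat.cast_sub (by omega)]
              have : (t : ℝ) ≤ N := by exact_mod_cast (by omega)
              push_cast; linarith
            exact pow_le_pow_left₀ (by linarith) h7 t
        _ ≤ _ := by exact_mod_cast h2
    rw [div_le_iff₀ (by positivity), ← h1]
    push_cast
    have h5 : (1 : ℝ) ≤ 2 * (1 / n) ^ t * n.descFactorial t := by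
      calc (1 : ℝ) = 2 * (1 / n) ^ t * (n ^ t / 2) := by
            rw [one_div, inv_pow]; field_simp
        _ ≤ _ := by gcongr
    have h6 : (0 : ℝ) < ((n - t).factorial : ℝ) := by positivity
    nlinarith
  · rw [mixMoment_rec hn a t (by omega)]
    obtain ⟨p1, q1⟩ := ih a (by omega) (t + 1) (by omega)
    obtain ⟨p2, q2⟩ := ih (a - 1) (by omega) (t + 1) (by omega)
    refine ⟨by positivity, ?_⟩
    set K : ℝ := 2 * N / (n * √n) with hK
    have hs : √(n : ℝ) ^ 2 = n := Real.sq_sqrt hn'.le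
    have hs0 : 0 < √(n : ℝ) := by positivity
    have hK0 : 0 < K := by positivity
    have hN1 : (1 : ℝ) ≤ N := by exact_mod_cast hN
    have hNn2 : (N : ℝ) ≤ n := by exact_mod_cast hNn'
    have hKsq : K ^ 2 = 4 * N ^ 2 / n ^ 3 := by
      rw [hK]; rw [div_pow, mul_pow, mul_pow, hs]; field_simp; norm_num
    have hKn : K ≤ 1 / N := by
      rw [hK, div_le_div_iff₀ (by positivity) (by positivity)]
      have h1 : (2 : ℝ) * N ^ 2 ≤ n := by exact_mod_cast hNn
      have h2 : 1 ≤ √(n : ℝ) := by rw [Real.one_le_sqrt]; linarith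
      nlinarith
    have ht1 : ((t + a : ℕ) : ℝ) ≤ N := by exact_mod_cast (by omega)
    have hk0 : 0 < (1 / (n : ℝ)) ^ t := by positivity
    rcases a with _ | a
    · simp only [CharP.cast_eq_zero, zero_div, zero_mul, add_zero, zero_add, pow_one, pow_zero, mul_one] at *
      calc ((t : ℕ) : ℝ) / n * mixMoment n 0 (t + 1) ≤ N / n * (2 * (1 / n) ^ (t + 1)) := by gcongr
        _ = 2 * (1 / n) ^ t * (N / n ^ 2) := by rw [pow_succ]; ring
        _ ≤ 2 * (1 / n) ^ t * K := by
          gcongr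
          rw [hK, div_le_div_iff₀ (by positivity) (by positivity)]
          have : √(n : ℝ) ≤ n := by
            have h2 : 1 ≤ √(n : ℝ) := by rw [Real.one_le_sqrt]; linarith
            nlinarith
          nlinarith [mul_le_mul_of_nonneg_left this (show (0 : ℝ) ≤ N * n by positivity), mul_pos (show (0 : ℝ) < N by linarith) (pow_pos hn' 2)]
    · simp only [Nat.add_sub_cancel] at *
      have ha1 : ((a + 1 : ℕ) : ℝ) ≤ N := by exact_mod_cast (by omega)
      calc ((t + (a + 1) : ℕ) : ℝ) / n * mixMoment n (a + 1) (t + 1)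
            + ((a + 1 : ℕ) : ℝ) / n ^ 2 * mixMoment n a (t + 1)
          ≤ N / n * (2 * (1 / n) ^ (t + 1) * K ^ (a + 1)) + N / n ^ 2 * (2 * (1 / n) ^ (t + 1) * K ^ a) := by
            gcongr
        _ = 2 * (1 / n) ^ t * K ^ a * (N / n ^ 2 * K + N / n ^ 3) := by rw [pow_succ, pow_succ]; field_simp
        _ ≤ 2 * (1 / n) ^ t * K ^ a * K ^ 2 := by
          gcongr
          rw [hKsq]
          calc (N : ℝ) / n ^ 2 * K + N / n ^ 3 ≤ N / n ^ 2 * (2 * N / n) + N / n ^ 3 := by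
                apply add_le_add_left
                apply mul_le_mul_of_nonneg_left _ (by positivity)
                rw [hK]
                have h2 : 1 ≤ √(n : ℝ) := by rw [Real.one_le_sqrt]; linarith
                gcongr
                nlinarith
            _ = (2 * (N : ℝ) ^ 2 + N) / (n : ℝ) ^ 3 := by field_simp
            _ ≤ _ := by gcongr; nlinarith
        _ = _ := by ring

end moments

/-! ### Bounds for monomials in centred entries. -/

section moments
variable {n : ℕ}

/-- The pair `p` shares no coordinate with any other pair of `S`. -/
def IsolatedIn (S : Finset (Fin n × Fin n)) (p : Fin n × Fin n) : Prop :=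
  ∀ q ∈ S, q ≠ p → q.1 ≠ p.1 ∧ q.2 ≠ p.2

lemma hit_eq_zero_or_one (σ : Equiv.Perm (Fin n)) (p : Fin n × Fin n) : hit σ p = 0 ∨ hit σ p = 1 := by
  unfold hit; split_ifs <;> simp

/-- A power of a variable taking two values is affine in `hit`, which linearises monomials with
multiplicities. -/
lemma cen_pow_eq (σ : Equiv.Perm (Fin n)) (p : Fin n × Fin n) (k : ℕ) :
    cen σ p ^ k = hit σ p * ((1 - 1 / (n : ℝ)) ^ k - (-(1 / (n : ℝ))) ^ k) + (-(1 / (n : ℝ))) ^ k := by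
  unfold cen
  rcases hit_eq_zero_or_one σ p with h | h <;> rw [h] <;> ring

lemma abs_cen_pow_coeff_le {u : ℝ} (h0 : 0 ≤ u) (h1 : u ≤ 1) {k : ℕ} (hk : 1 ≤ k) :
    |(1 - u) ^ k - (-u) ^ k| ≤ 1 := by
  have a1 : (1 - u) ^ k ≤ 1 - u := pow_le_of_le_one (by linarith) (by linarith) (by omega)
  have a2 : 0 ≤ (1 - u) ^ k := pow_nonneg (by linarith) k
  have a3 : |(-u) ^ k| ≤ u := by
    rw [abs_pow, abs_neg, abs_of_nonneg h0]
    exact pow_le_of_le_one h0 h1 (by omega)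
  rw [abs_le] at a3 ⊢
  constructor <;> linarith [a3.1, a3.2]

lemma one_add_inv_pow_le_two {N : ℕ} (hN : 0 < N) (hNn : 2 * N ^ 2 ≤ n) {k : ℕ} (hk : k ≤ N) :
    (1 + 1 / (n : ℝ)) ^ k ≤ 2 := by
  have hn : (0 : ℝ) < n := by
    have : 0 < n := by nlinarith
    exact_mod_cast this
  have h2 : 2 * k ≤ n := by nlinarith
  have h2' : (2 : ℝ) * k ≤ n := by exact_mod_cast h2
  calc (1 + 1 / (n : ℝ)) ^ k ≤ Real.exp (1 / n) ^ k := by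
        gcongr; linarith [Real.add_one_le_exp (1 / (n : ℝ))]
    _ = Real.exp (k * (1 / n)) := by rw [← Real.exp_nat_mul]
    _ ≤ Real.exp (1 / 2) := by
        gcongr; rw [mul_one_div, div_le_iff₀ hn]; linarith
    _ ≤ 2 := by
        have h := Real.exp_one_lt_d9
        have h3 : Real.exp (1 / 2) ^ 2 = Real.exp 1 := by rw [← Real.exp_nat_mul]; norm_num
        nlinarith [Real.exp_pos (1 / 2)]

/-- A centred monomial in the entries of a random permutation matrix is small: each variable costs
`1 / n`, and each isolated variable of degree one an additional `N / √n`. -/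
lemma abs_permAvg_prod_cen_pow_le {N : ℕ} (hN : 0 < N) (hNn : 2 * N ^ 2 ≤ n)
    (S U B : Finset (Fin n × Fin n)) (k : Fin n × Fin n → ℕ) (hk : ∀ p ∈ S, 1 ≤ k p) (hS : #S ≤ N)
    (hU : ∀ p ∈ U, p ∈ S ∧ k p = 1 ∧ IsolatedIn S p)
    (hB : ∀ p ∈ S, p ∉ U → k p = 1 → p ∈ B) :
    |permAvg (fun σ => ∏ p ∈ S, cen σ p ^ k p)| ≤
      4 * 2 ^ #B * (1 / n) ^ #S * (2 * N / √n) ^ #U := by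
  classical
  have hnpos : 0 < n := by nlinarith
  have hn : (0 : ℝ) < n := by exact_mod_cast hnpos
  have hu0 : (0 : ℝ) ≤ 1 / n := by positivity
  have hu1 : (1 : ℝ) / n ≤ 1 := by
    rw [div_le_one hn]; exact_mod_cast hnpos
  have hUS : U ⊆ S := fun p hp => (hU p hp).1
  set O := S \ U with hO
  set α : Fin n × Fin n → ℝ := fun p => (1 - 1 / (n : ℝ)) ^ k p - (-(1 / (n : ℝ))) ^ k p with hα
  set β : Fin n × Fin n → ℝ := fun p => (-(1 / (n : ℝ))) ^ k p with hβ
  set K : ℝ := 2 * N / (n * √n) with hK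
  have hs0 : 0 < √(n : ℝ) := by positivity
  have hK0 : 0 ≤ K := by positivity
  have hexp : (fun σ => ∏ p ∈ S, cen σ p ^ k p) = fun σ => ∑ T ∈ O.powerset,
      ((∏ p ∈ T, α p) * ∏ p ∈ O \ T, β p) * ((∏ p ∈ T, hit σ p) * ∏ p ∈ U, cen σ p) := by
    funext σ
    rw [← prod_sdiff hUS, ← hO]
    have h1 : ∏ p ∈ U, cen σ p ^ k p = ∏ p ∈ U, cen σ p :=
      prod_congr rfl fun p hp => by rw [(hU p hp).2.1, pow_one]
    have h2 : ∏ p ∈ O, cen σ p ^ k p = ∏ p ∈ O, (hit σ p * α p + β p) :=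
      prod_congr rfl fun p _ => cen_pow_eq σ p (k p)
    rw [h1, h2, prod_add, sum_mul]
    refine sum_congr rfl fun T _ => ?_
    rw [prod_mul_distrib]; ring
  -- A set `T` with two pairs in one row or column contributes nothing, and any other `T` stays in
  -- general position with `U`, because the pairs of `U` are isolated in `S`.
  have hterm : ∀ T ∈ O.powerset,
      |permAvg (fun σ => (∏ p ∈ T, hit σ p) * ∏ p ∈ U, cen σ p)| ≤ 2 * (1 / n) ^ #T * K ^ #U := by
    intro T hT
    rw [mem_powerset] at hT
    have hdisj : Disjoint T U := disjoint_of_subset_left hT sdiff_disjoint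
    by_cases hc : Set.InjOn Prod.fst (T : Set (Fin n × Fin n)) ∧ Set.InjOn Prod.snd (T : Set (Fin n × Fin n))
    · have hTS : T ⊆ S := hT.trans sdiff_subset
      rw [permAvg_prod_hit_mul_prod_cen U T hdisj]
      · have hcard : #U + #T ≤ N := by
          rw [add_comm, ← card_union_of_disjoint hdisj]
          exact (card_le_card (union_subset hTS hUS)).trans hS
        obtain ⟨h0, h1⟩ := mixMoment_bounds hN hNn #U #T hcard
        rw [abs_of_nonneg h0]; exact h1
      · intro p hp q hq hpq
        simp only [coe_union, Set.mem_union, mem_coe] at hp hq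
        by_contra hne
        rcases hp with hp | hp
        · rcases hq with hq | hq
          · exact hne (hc.1 hp hq hpq)
          · exact ((hU q hq).2.2 p (hTS hp) hne).1 hpq
        · have hq' : q ∈ S := hq.elim (fun h => hTS h) (fun h => hUS h)
          exact ((hU p hp).2.2 q hq' (Ne.symm hne)).1 hpq.symm
      · intro p hp q hq hpq
        simp only [coe_union, Set.mem_union, mem_coe] at hp hq
        by_contra hne
        rcases hp with hp | hp
        · rcases hq with hq | hq
          · exact hne (hc.2 hp hq hpq)
          · exact ((hU q hq).2.2 p (hTS hp) hne).2 hpq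
        · have hq' : q ∈ S := hq.elim (fun h => hTS h) (fun h => hUS h)
          exact ((hU p hp).2.2 q hq' (Ne.symm hne)).2 hpq.symm
    · have : (fun σ => (∏ p ∈ T, hit σ p) * ∏ p ∈ U, cen σ p) = fun _ => 0 := by
        funext σ; rw [prod_hit_eq_zero σ T hc, zero_mul]
      rw [this]
      simp only [permAvg, sum_const_zero, zero_div, abs_zero]
      positivity
  have hαle : ∀ p ∈ O, |α p| ≤ 1 := fun p hp =>
    abs_cen_pow_coeff_le hu0 hu1 (hk p (mem_sdiff.1 hp).1)
  rw [hexp, permAvg_sum]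
  simp_rw [permAvg_const_mul]
  calc |∑ T ∈ O.powerset, ((∏ p ∈ T, α p) * ∏ p ∈ O \ T, β p) *
          permAvg (fun σ => (∏ p ∈ T, hit σ p) * ∏ p ∈ U, cen σ p)|
      ≤ ∑ T ∈ O.powerset, (∏ p ∈ O \ T, |β p|) * (2 * (1 / n) ^ #T * K ^ #U) := by
        refine (abs_sum_le_sum_abs _ _).trans (sum_le_sum fun T hT => ?_)
        rw [abs_mul, abs_mul, abs_prod, abs_prod]
        refine mul_le_mul ?_ (hterm T hT) (abs_nonneg _) (prod_nonneg fun p _ => abs_nonneg _)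
        refine mul_le_of_le_one_left (prod_nonneg fun p _ => abs_nonneg _) ?_
        exact prod_le_one (fun p _ => abs_nonneg _) fun p hp => hαle p (mem_powerset.1 hT hp)
    _ = 2 * K ^ #U * ∏ p ∈ O, (1 / (n : ℝ) + |β p|) := by
        rw [prod_add, mul_sum]
        refine sum_congr rfl fun T _ => ?_
        rw [prod_const]; ring
    -- For degree one `|β p| = 1 / n`, which doubles the factor; such pairs lie in `B`. For higher
    -- degree `|β p| ≤ 1 / n ^ 2`, and the factors 1 + 1 / n multiply to at most 2.
    _ ≤ 2 * K ^ #U * ∏ p ∈ O, (1 / (n : ℝ) * ((1 + 1 / n) * if p ∈ B then 2 else 1)) := by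
        gcongr with p hp
        have hp' := mem_sdiff.1 hp
        rcases (hk p hp'.1).eq_or_lt with h1 | h1
        · rw [if_pos (hB p hp'.1 hp'.2 h1.symm), hβ]
          simp only [← h1, pow_one, abs_neg, abs_of_nonneg hu0]
          nlinarith
        · have : |β p| ≤ (1 / n) ^ 2 := by
            simp only [hβ, abs_pow, abs_neg, abs_of_nonneg hu0]
            exact pow_le_pow_of_le_one hu0 hu1 h1
          split_ifs <;> nlinarith
    _ = 2 * K ^ #U * ((1 / (n : ℝ)) ^ #O * ((1 + 1 / (n : ℝ)) ^ #O * 2 ^ #(O.filter (· ∈ B)))) := by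
        rw [prod_mul_distrib, prod_mul_distrib, prod_const, prod_const, prod_ite, prod_const_one,
          prod_const, mul_one]
    _ ≤ 2 * K ^ #U * ((1 / (n : ℝ)) ^ #O * (2 * 2 ^ #B)) := by
        have h1 : (1 + 1 / (n : ℝ)) ^ #O ≤ 2 :=
          one_add_inv_pow_le_two hN hNn ((card_le_card sdiff_subset).trans hS)
        have h2 : #(O.filter (· ∈ B)) ≤ #B :=
          card_le_card fun p hp => (mem_filter.1 hp).2
        gcongr
        norm_num
    _ = _ := by
        have h3 : #S = #O + #U := by rw [hO, card_sdiff_add_card_eq_card hUS]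
        have h4 : K = 1 / n * (2 * N / √n) := by rw [hK]; field_simp
        rw [h3, h4, mul_pow, pow_add]; ring

/-- The version without cancellation, for first absolute moments: `|cen|` is at most `hit + 1 / n`,
and each of the `2 ^ #S` terms of the expansion has average at most 2 n ^ (-#S). -/
lemma permAvg_prod_hit_add_le {N : ℕ} (hN : 0 < N) (hNn : 2 * N ^ 2 ≤ n)
    (S : Finset (Fin n × Fin n)) (hS : #S ≤ N) :
    permAvg (fun σ => ∏ p ∈ S, (hit σ p + 1 / n)) ≤ 2 * 2 ^ #S * (1 / n) ^ #S := by
  classical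
  simp_rw [prod_add]
  rw [permAvg_sum]
  calc ∑ T ∈ S.powerset, permAvg (fun σ => (∏ p ∈ T, hit σ p) * ∏ p ∈ S \ T, (1 / (n : ℝ)))
      ≤ ∑ T ∈ S.powerset, 2 * (1 / (n : ℝ)) ^ #S := by
        refine sum_le_sum fun T hT => ?_
        have hTS := mem_powerset.1 hT
        simp only [prod_const]
        have : permAvg (fun σ => (∏ p ∈ T, hit σ p)) ≤ 2 * (1 / n) ^ #T := by
          by_cases hc : Set.InjOn Prod.fst (T : Set (Fin n × Fin n)) ∧
              Set.InjOn Prod.snd (T : Set (Fin n × Fin n))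
          · rw [permAvg_prod_hit T hc.1 hc.2]
            have := (mixMoment_bounds hN hNn 0 #T (by simpa using (card_le_card hTS).trans hS)).2
            simpa [mixMoment] using this
          · simp only [prod_hit_eq_zero _ T hc, permAvg, sum_const_zero, zero_div]
            positivity
        simp_rw [mul_comm _ ((1 / (n : ℝ)) ^ #(S \ T))]
        rw [permAvg_const_mul]
        calc _ ≤ (1 / (n : ℝ)) ^ #(S \ T) * (2 * (1 / n) ^ #T) := by gcongr
          _ = _ := by rw [← card_sdiff_add_card_eq_card hTS, pow_add]; ring
    _ = _ := by rw [sum_const, card_powerset, nsmul_eq_mul]; push_cast; ring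

end moments

/-! ### First occurrences: naming values by the time they first appear. -/

section firstIdx
variable {α β : Type*}

/-- The first index at which the sequence `f` takes the value `f t`. -/
def firstIdx (f : ℕ → α) (t : ℕ) : ℕ := sInf {s | f s = f t}

lemma apply_firstIdx (f : ℕ → α) (t : ℕ) : f (firstIdx f t) = f t :=
  Nat.sInf_mem (s := {s | f s = f t}) ⟨t, rfl⟩

lemma firstIdx_le_of_eq {f : ℕ → α} {s t : ℕ} (h : f s = f t) : firstIdx f t ≤ s :=
  Nat.sInf_le h

lemma firstIdx_le (f : ℕ → α) (t : ℕ) : firstIdx f t ≤ t := firstIdx_le_of_eq rfl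

lemma firstIdx_congr {f : ℕ → α} {s t : ℕ} (h : f s = f t) : firstIdx f s = firstIdx f t := by
  unfold firstIdx; rw [h]

lemma firstIdx_eq_iff {f : ℕ → α} {s t : ℕ} : firstIdx f s = firstIdx f t ↔ f s = f t :=
  ⟨fun h => (apply_firstIdx f s).symm.trans ((congrArg f h).trans (apply_firstIdx f t)), firstIdx_congr⟩

lemma firstIdx_firstIdx (f : ℕ → α) (t : ℕ) : firstIdx f (firstIdx f t) = firstIdx f t :=
  firstIdx_congr (apply_firstIdx f t)

lemma card_image_range_eq_firstIdx [DecidableEq α] (f : ℕ → α) (N : ℕ) :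
    #((range N).image f) = #{t ∈ range N | firstIdx f t = t} := by
  symm
  apply card_bij (fun t _ => f t)
  · intro t ht; exact mem_image_of_mem _ (mem_filter.1 ht).1
  · intro s hs t ht h
    rw [← (mem_filter.1 hs).2, ← (mem_filter.1 ht).2]; exact firstIdx_congr h
  · intro a ha
    obtain ⟨t, ht, rfl⟩ := mem_image.1 ha
    refine ⟨firstIdx f t, ?_, apply_firstIdx f t⟩
    rw [mem_filter, mem_range]
    exact ⟨(firstIdx_le f t).trans_lt (mem_range.1 ht), firstIdx_firstIdx f t⟩

end firstIdx

/-! ### Walks in multigraphs, cycle rank, and reconstruction from instructions. -/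

section multiwalk
variable {V ℰ : Type*}

/-- A walk of length `N` in a multigraph: `v` lists the vertices, `E` the edges, and `o` tells in which
of its two directions each edge is traversed. -/
structure IsMultiWalk (N : ℕ) (v : ℕ → V) (E : ℕ → ℰ) (o : ℕ → Bool) : Prop where
  same : ∀ s t, s < N → t < N → E s = E t → o s = o t → v s = v t ∧ v (s + 1) = v (t + 1)
  opp : ∀ s t, s < N → t < N → E s = E t → o s ≠ o t → v s = v (t + 1) ∧ v (s + 1) = v t

/-- Step `t` discovers a new vertex. -/
def IsNew (v : ℕ → V) (t : ℕ) : Prop := firstIdx v (t + 1) = t + 1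

open Classical in
/-- The times at which a new edge leads to an old vertex. -/
def closings (v : ℕ → V) (E : ℕ → ℰ) (N : ℕ) : Finset ℕ :=
  {t ∈ range N | firstIdx E t = t ∧ ¬ IsNew v t}

/-- The cycle rank of the graph visited by a walk. -/
def genus (v : ℕ → V) (E : ℕ → ℰ) (N : ℕ) : ℕ := #(closings v E N)

variable {N : ℕ} {v : ℕ → V} {E : ℕ → ℰ} {o : ℕ → Bool}

/-- Both ends of an edge used before have been visited before. -/
lemma IsMultiWalk.firstIdx_edge_of_isNew (h : IsMultiWalk N v E o) {t : ℕ} (ht : t < N) (hn : IsNew v t) :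
    firstIdx E t = t := by
  by_contra hne
  have hlt : firstIdx E t < t := lt_of_le_of_ne (firstIdx_le E t) hne
  have hE := apply_firstIdx E t
  have hle : firstIdx v (t + 1) ≤ firstIdx E t + 1 := by
    by_cases ho : o (firstIdx E t) = o t
    · exact firstIdx_le_of_eq (h.same _ _ (by omega) ht hE ho).2
    · exact (firstIdx_le_of_eq (h.opp _ _ (by omega) ht hE ho).1).trans (by omega)
  unfold IsNew at hn
  omega

/-- An edge whose first use found a new vertex is a tree edge, and that vertex is named `firstIdx E
t + 1`. This lemma and `IsMultiWalk.up` locate both ends of a tree edge when it is used again. -/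
lemma IsMultiWalk.down (h : IsMultiWalk N v E o) {t : ℕ} (ht : t < N) (hn : IsNew v (firstIdx E t))
    (ho : o t = o (firstIdx E t)) :
    firstIdx v (t + 1) = firstIdx E t + 1 ∧ firstIdx v t = firstIdx v (firstIdx E t) := by
  have hlt := firstIdx_le E t
  obtain ⟨h1, h2⟩ := h.same _ t (by omega) ht (apply_firstIdx E t) ho.symm
  exact ⟨(firstIdx_congr h2.symm).trans hn, firstIdx_congr h1.symm⟩

lemma IsMultiWalk.up (h : IsMultiWalk N v E o) {t : ℕ} (ht : t < N) (hn : IsNew v (firstIdx E t))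
    (ho : o t ≠ o (firstIdx E t)) :
    firstIdx v t = firstIdx E t + 1 ∧ firstIdx v (t + 1) = firstIdx v (firstIdx E t) := by
  have hlt := firstIdx_le E t
  obtain ⟨h1, h2⟩ := h.opp _ t (by omega) ht (apply_firstIdx E t) ho.symm
  exact ⟨(firstIdx_congr h2.symm).trans hn, firstIdx_congr h1.symm⟩

/-- Number of edges plus one is number of vertices plus cycle rank. -/
lemma IsMultiWalk.card_edges_add_one [DecidableEq V] [DecidableEq ℰ] (h : IsMultiWalk N v E o) :
    #((range N).image E) + 1 = #((range (N + 1)).image v) + genus v E N := by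
  classical
  rw [card_image_range_eq_firstIdx, card_image_range_eq_firstIdx, genus, closings]
  -- Every vertex but the first is found by exactly one step, along a new edge; the other new edges
  -- are the closings.
  have h1 : #{t ∈ range (N + 1) | firstIdx v t = t} = #{t ∈ range N | IsNew v t} + 1 := by
    have : {t ∈ range (N + 1) | firstIdx v t = t} =
        insert 0 ({t ∈ range N | IsNew v t}.map ⟨Nat.succ, Nat.succ_injective⟩) := by
      ext t
      rcases t with _ | t
      · simp [Nat.le_zero.1 (firstIdx_le v 0)]
      · have e : IsNew v t ↔ firstIdx v (t + 1) = t + 1 := Iff.rfl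
        simp [e]
    rw [this, card_insert_of_notMem (by simp), card_map]
  have h2 : {t ∈ range N | IsNew v t} = {t ∈ {t ∈ range N | firstIdx E t = t} | IsNew v t} := by
    ext t
    simp only [mem_filter, mem_range]
    constructor
    · rintro ⟨ht, hn⟩; exact ⟨⟨ht, h.firstIdx_edge_of_isNew ht hn⟩, hn⟩
    · rintro ⟨⟨ht, _⟩, hn⟩; exact ⟨ht, hn⟩
  have h3 := card_filter_add_card_filter_not (s := {t ∈ range N | firstIdx E t = t}) (IsNew v)
  rw [filter_filter (fun t => firstIdx E t = t)] at h3
  rw [h1, h2]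
  rw [filter_filter] at h3 ⊢
  omega

/-- A division of time into pieces, each with a window of times and a period. -/
structure PieceData where
  /-- the label of the piece containing a given time -/
  pc : ℕ → ℕ
  /-- the beginning of the window of a piece -/
  lo : ℕ → ℕ
  /-- the end of the window of a piece -/
  hi : ℕ → ℕ
  /-- the period of a piece -/
  per : ℕ → ℕ

/-- The range of times `t < N` is cut in at most `S` consecutive pieces; inside the piece `r` all edges
are traversed in the same direction and are distinct, except that on the window `[lo r, hi r)` the
sequence of edges is periodic with period `per r`. -/
structure TamePieces (N S : ℕ) (E : ℕ → ℰ) (o : ℕ → Bool) (D : PieceData) : Prop where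
  mono : ∀ t, t + 1 < N → D.pc t ≤ D.pc (t + 1)
  lt : ∀ t, t < N → D.pc t < S
  sign : ∀ s t, s < N → t < N → D.pc s = D.pc t → o s = o t
  pos : ∀ r, 1 ≤ D.per r
  window : ∀ r t, D.lo r ≤ t → t < D.hi r → t < N ∧ D.pc t = r
  periodic : ∀ r t, D.lo r ≤ t → t + D.per r < D.hi r → E (t + D.per r) = E t
  inj : ∀ s t, s < t → t < N → D.pc s = D.pc t → E s = E t →
    D.lo (D.pc t) ≤ s ∧ t < D.hi (D.pc t) ∧ D.per (D.pc t) ∣ t - s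

/-- The parent of a vertex in the tree of first visits. -/
def parentIdx (κ : ℕ → ℕ) (u : ℕ) : ℕ := κ (u - 1)

/-- The sequences `κ`, `η` of first indices follow the instructions `c`. -/
def Follows (N : ℕ) (κ η : ℕ → ℕ) (c : ℕ → ℕ × ℕ × ℕ) : Prop := ∀ t < N,
  ((c t).1 = 0 ∧ κ (t + 1) = κ (κ t - 1) ∧ η t = κ t - 1) ∨
  ((c t).1 = 1 ∧ (c t).2.1 ≤ t + 1 ∧ κ (t + 1) = (parentIdx κ)^[(c t).2.2 - (t + 1)] (c t).2.1 ∧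
    η t = κ (t + 1) - 1) ∨
  ((c t).1 = 2 ∧ κ (t + 1) = t + 1 ∧ η t = t) ∨
  ((c t).1 = 3 ∧ κ (t + 1) = (c t).2.1 ∧ η t = (c t).2.2) ∨
  ((c t).1 = 4 ∧ 1 ≤ (c t).2.1 ∧ (c t).2.1 ≤ t ∧ κ (t + 1) = κ (t + 1 - (c t).2.1) ∧
    η t = η (t - (c t).2.1))

/-- The parent of z is read from κ at time z - 1 ≤ t, and further ancestors are read earlier still.
-/
lemma parentIdx_iterate_congr {κ κ' : ℕ → ℕ} {t : ℕ} (hκ : ∀ u, κ u ≤ u) (h : ∀ u ≤ t, κ u = κ' u)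
    (i : ℕ) : ∀ z ≤ t + 1, (parentIdx κ)^[i] z = (parentIdx κ')^[i] z := by
  induction i with
  | zero => intro z _; rfl
  | succ i ih =>
    intro z hz
    rw [Function.iterate_succ_apply, Function.iterate_succ_apply]
    have h1 : parentIdx κ z = parentIdx κ' z := h _ (by omega)
    rw [← h1]
    exact ih _ ((hκ _).trans (by omega))

/-- Vertices and edges are named by their first times, so a vertex u found by a step is joined to
its parent by the edge u - 1. With these names each rule computes the next vertex and edge from the
instruction and the past alone. The rule for moving down names a descendant and its arrival time,
and climbs back from it; the bound `t + 1` on that descendant keeps the computation within the past.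
-/
lemma Follows.unique {κ η κ' η' : ℕ → ℕ} {c c' : ℕ → ℕ × ℕ × ℕ} (hc : ∀ t < N, c t = c' t)
    (hκ : ∀ u, κ u ≤ u) (hκ' : ∀ u, κ' u ≤ u)
    (h : Follows N κ η c) (h' : Follows N κ' η' c') :
    ∀ t ≤ N, (∀ u ≤ t, κ u = κ' u) ∧ ∀ u < t, η u = η' u := by
  intro t
  induction t with
  | zero =>
    intro _
    refine ⟨fun u hu => ?_, fun u hu => by omega⟩
    have := hκ u; have := hκ' u; omega
  | succ t ih =>
    intro ht
    obtain ⟨h1, h2⟩ := ih (by omega)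
    suffices key : κ (t + 1) = κ' (t + 1) ∧ η t = η' t by
      refine ⟨fun u hu => ?_, fun u hu => ?_⟩
      · rcases Nat.lt_or_ge u (t + 1) with hlt | hge
        · exact h1 u (by omega)
        · rw [show u = t + 1 by omega]; exact key.1
      · rcases Nat.lt_or_ge u t with hlt | hge
        · exact h2 u hlt
        · rw [show u = t by omega]; exact key.2
    have e := hc t (by omega)
    have f := h t (by omega)
    have f' := h' t (by omega)
    rw [← e] at f'
    rcases f with f | f | f | f | f <;> rcases f' with f' | f' | f' | f' | f' <;>
      (try (exfalso; have := f.1; have := f'.1; omega))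
    · obtain ⟨-, a, b⟩ := f
      obtain ⟨-, a', b'⟩ := f'
      have := hκ t
      rw [a, b, a', b', ← h1 t le_rfl, h1 (κ t - 1) (by omega)]
      exact ⟨rfl, rfl⟩
    · obtain ⟨-, z, a, b⟩ := f
      obtain ⟨-, z', a', b'⟩ := f'
      have : κ (t + 1) = κ' (t + 1) := by rw [a, a']; exact parentIdx_iterate_congr hκ h1 _ _ z
      exact ⟨this, by rw [b, b', this]⟩
    · exact ⟨by rw [f.2.1, f'.2.1], by rw [f.2.2, f'.2.2]⟩
    · exact ⟨by rw [f.2.1, f'.2.1], by rw [f.2.2, f'.2.2]⟩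
    · obtain ⟨-, z1, z2, a, b⟩ := f
      obtain ⟨-, -, -, a', b'⟩ := f'
      exact ⟨by rw [a, a', h1 _ (by omega)], by rw [b, b', h2 _ (by omega)]⟩

end multiwalk

/-! ### Tame walks are determined by a short table of instructions. -/

section code
variable {V ℰ : Type*} {N S : ℕ} {v : ℕ → V} {E : ℕ → ℰ} {o : ℕ → Bool} {D : PieceData}

/-- The time `t` repeats the time one period earlier. -/
def PieceData.IsRepeat (D : PieceData) (t : ℕ) : Prop :=
  D.lo (D.pc t) + D.per (D.pc t) ≤ t ∧ t < D.hi (D.pc t)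

open Classical in
/-- The kind of a step: `0` up and `1` down the tree of first visits, `2` to a new vertex, `4` periodic
repetition, `3` anything else. -/
def stepType (v : ℕ → V) (E : ℕ → ℰ) (o : ℕ → Bool) (D : PieceData) (t : ℕ) : ℕ :=
  if D.IsRepeat t then 4 else if IsNew v t then 2 else
    if IsNew v (firstIdx E t) then (if o t = o (firstIdx E t) then 1 else 0) else 3

/-- Times at which the monotonicity of step types may fail. -/
def IsReset (v : ℕ → V) (E : ℕ → ℰ) (o : ℕ → Bool) (D : PieceData) (t : ℕ) : Prop :=
  (t = 0 ∨ D.pc t ≠ D.pc (t - 1)) ∨ stepType v E o D t = 3 ∨ (1 ≤ t ∧ stepType v E o D (t - 1) = 3) ∨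
    t = D.lo (D.pc t) + D.per (D.pc t) ∨ t = D.hi (D.pc t)

/-- Times at which the instruction changes. -/
def IsBreak (v : ℕ → V) (E : ℕ → ℰ) (o : ℕ → Bool) (D : PieceData) (t : ℕ) : Prop :=
  IsReset v E o D t ∨ stepType v E o D t ≠ stepType v E o D (t - 1)

lemma stepType_le (t : ℕ) : stepType v E o D t ≤ 4 := by
  unfold stepType; split_ifs <;> omega

lemma stepType_eq_four_iff {t : ℕ} : stepType v E o D t = 4 ↔ D.IsRepeat t := by
  unfold stepType; split_ifs <;> simp_all

lemma stepType_eq_two {t : ℕ} (h : stepType v E o D t = 2) : IsNew v t := by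
  unfold stepType at h
  split_ifs at h <;> simp_all

lemma stepType_eq_one {t : ℕ} (h : stepType v E o D t = 1) :
    ¬ IsNew v t ∧ IsNew v (firstIdx E t) ∧ o t = o (firstIdx E t) := by
  unfold stepType at h
  split_ifs at h <;> simp_all

lemma stepType_eq_zero {t : ℕ} (h : stepType v E o D t = 0) :
    ¬ IsNew v t ∧ IsNew v (firstIdx E t) ∧ o t ≠ o (firstIdx E t) := by
  unfold stepType at h
  split_ifs at h <;> simp_all

lemma stepType_eq_three {t : ℕ} (h : stepType v E o D t = 3) :
    ¬ D.IsRepeat t ∧ ¬ IsNew v t ∧ ¬ IsNew v (firstIdx E t) := by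
  unfold stepType at h
  split_ifs at h <;> simp_all

lemma not_isReset_iff {t : ℕ} (h : ¬ IsReset v E o D t) : 1 ≤ t ∧ D.pc t = D.pc (t - 1) ∧
    stepType v E o D t ≠ 3 ∧ stepType v E o D (t - 1) ≠ 3 ∧ (D.IsRepeat t ↔ D.IsRepeat (t - 1)) := by
  unfold IsReset at h
  push Not at h
  obtain ⟨⟨h1, h2⟩, h3, h4, h5, h6⟩ := h
  have h7 : 1 ≤ t := by omega
  refine ⟨h7, h2, h3, h4 h7, ?_⟩
  unfold PieceData.IsRepeat
  rw [← h2]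
  omega

/-- Within a piece all steps have the same direction, so the walk cannot turn back along the edge it
has just used. Away from resets it therefore goes up the tree, then down, then to new vertices,
never in another order. -/
lemma stepType_trans (hw : IsMultiWalk N v E o) (hD : TamePieces N S E o D) {t : ℕ} (ht : t < N)
    (hr : ¬ IsReset v E o D t) (hne : stepType v E o D t ≠ stepType v E o D (t - 1)) :
    stepType v E o D (t - 1) < stepType v E o D t ∧ stepType v E o D t ≤ 2 := by
  obtain ⟨h1, hpc, h3, h4, hrep⟩ := not_isReset_iff hr
  have l1 := stepType_le (v := v) (E := E) (o := o) (D := D) t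
  have l2 := stepType_le (v := v) (E := E) (o := o) (D := D) (t - 1)
  have r1 := stepType_eq_four_iff (v := v) (E := E) (o := o) (D := D) (t := t)
  have r2 := stepType_eq_four_iff (v := v) (E := E) (o := o) (D := D) (t := t - 1)
  have r3 : stepType v E o D t = 4 ↔ stepType v E o D (t - 1) = 4 := by rw [r1, r2, hrep]
  have ho : o t = o (t - 1) := hD.sign t (t - 1) ht (by omega) hpc
  have e1 : t - 1 + 1 = t := by omega
  have hlt := firstIdx_le E t
  -- Going up from a vertex just found would traverse the edge `t - 1` backwards.
  have n20 : ¬ (stepType v E o D (t - 1) = 2 ∧ stepType v E o D t = 0) := by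
    rintro ⟨a, b⟩
    obtain ⟨-, b1, b2⟩ := stepType_eq_zero b
    have a1 : firstIdx v (t - 1 + 1) = t - 1 + 1 := stepType_eq_two a
    rw [e1] at a1
    obtain ⟨u, -⟩ := hw.up ht b1 b2
    apply b2
    rw [ho]; congr 1; omega
  -- A vertex found at time t has no earlier outgoing tree edge, so an edge down from it would
  -- itself be new.
  have n21 : ¬ (stepType v E o D (t - 1) = 2 ∧ stepType v E o D t = 1) := by
    rintro ⟨a, b⟩
    obtain ⟨b0, b1, b2⟩ := stepType_eq_one b
    have a1 : firstIdx v (t - 1 + 1) = t - 1 + 1 := stepType_eq_two a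
    rw [e1] at a1
    obtain ⟨-, u⟩ := hw.down ht b1 b2
    have := firstIdx_le v (firstIdx E t)
    have : firstIdx E t = t := by omega
    rw [this] at b1
    exact b0 b1
  have n10 : ¬ (stepType v E o D (t - 1) = 1 ∧ stepType v E o D t = 0) := by
    rintro ⟨a, b⟩
    obtain ⟨-, b1, b2⟩ := stepType_eq_zero b
    obtain ⟨-, a1, a2⟩ := stepType_eq_one a
    obtain ⟨u, -⟩ := hw.up ht b1 b2
    obtain ⟨u', -⟩ := hw.down (show t - 1 < N by omega) a1 a2
    rw [e1] at u'
    apply b2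
    rw [ho, a2]; congr 1; omega
  omega

-- Between resets the type climbs through 0, 1, 2, so a reset pays for itself and at most two later
-- changes; `2 - min 2 (stepType …)` is the credit still available.
open Classical in
lemma card_isBreak_le (hw : IsMultiWalk N v E o) (hD : TamePieces N S E o D) :
    #{t ∈ range N | IsBreak v E o D t} ≤ 3 * #{t ∈ range N | IsReset v E o D t} := by
  have key : ∀ T, T + 1 ≤ N → #{t ∈ range (T + 1) | IsBreak v E o D t}
      + (2 - min 2 (stepType v E o D T)) ≤ 3 * #{t ∈ range (T + 1) | IsReset v E o D t} := by
    intro T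
    induction T with
    | zero =>
      intro _
      have h0 : IsReset v E o D 0 := Or.inl (Or.inl rfl)
      have h1 : IsBreak v E o D 0 := Or.inl h0
      have e1 : {t ∈ range (0 + 1) | IsBreak v E o D t} = {0} := by
        ext t; simp; rintro rfl; exact h1
      have e2 : {t ∈ range (0 + 1) | IsReset v E o D t} = {0} := by
        ext t; simp; rintro rfl; exact h0
      rw [e1, e2]; simp; omega
    | succ T ih =>
      intro hT
      have ih := ih (by omega)
      rw [range_add_one (n := T + 1), filter_insert, filter_insert]
      have a1 := card_insert_le (T + 1) {t ∈ range (T + 1) | IsBreak v E o D t}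
      by_cases hr : IsReset v E o D (T + 1)
      · have hb : IsBreak v E o D (T + 1) := Or.inl hr
        rw [if_pos hr, if_pos hb, card_insert_of_notMem (s := {t ∈ range (T + 1) | IsReset v E o D t})
          (by simp)]
        omega
      · rw [if_neg hr]
        by_cases hne : stepType v E o D (T + 1) ≠ stepType v E o D (T + 1 - 1)
        · have hb : IsBreak v E o D (T + 1) := Or.inr hne
          rw [if_pos hb]
          obtain ⟨b1, b2⟩ := stepType_trans hw hD (by omega) hr hne
          rw [Nat.add_sub_cancel] at b1
          omega
        · have hb : ¬ IsBreak v E o D (T + 1) := by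
            rintro (h | h)
            · exact hr h
            · exact hne h
          rw [if_neg hb]
          push Not at hne
          rw [Nat.add_sub_cancel] at hne
          rw [hne]; exact ih
  rcases N with _ | N
  · simp
  · exact (Nat.le_add_right _ _).trans (key N le_rfl)

lemma TamePieces.pc_mono (hD : TamePieces N S E o D) {s t : ℕ} (hst : s ≤ t) (ht : t < N) :
    D.pc s ≤ D.pc t := by
  induction t, hst using Nat.le_induction with
  | base => exact le_rfl
  | succ t _ ih => exact (ih (by omega)).trans (hD.mono t ht)

-- The first use of the edge of such a step is a closing. Within one piece an edge recurs only as a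
-- periodic repetition, which has type 4, so the step is determined by its piece and the closing.
open Classical in
lemma card_stepType_three_le (hD : TamePieces N S E o D) :
    #{t ∈ range N | stepType v E o D t = 3} ≤ S * genus v E N := by
  rw [genus, ← card_range S, ← card_product]
  apply card_le_card_of_injOn (fun t => (D.pc t, firstIdx E t))
  · intro t ht
    simp only [coe_filter, mem_range, Set.mem_ofPred_eq] at ht
    obtain ⟨-, -, h3⟩ := stepType_eq_three ht.2
    simp only [coe_product, Set.mem_prod, mem_coe, mem_range, closings, mem_filter]
    exact ⟨hD.lt t ht.1, (firstIdx_le E t).trans_lt ht.1, firstIdx_firstIdx E t, h3⟩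
  · have main : ∀ s t, s < t → t < N → stepType v E o D t = 3 → D.pc s = D.pc t →
        firstIdx E s = firstIdx E t → False := by
      intro s t hst ht h3 hp hE
      obtain ⟨a, b, c⟩ := hD.inj s t hst ht hp (firstIdx_eq_iff.1 hE)
      have := Nat.le_of_dvd (by omega) c
      exact (stepType_eq_three h3).1 ⟨by omega, b⟩
    intro s hs t ht h
    simp only [coe_filter, mem_range, Set.mem_ofPred_eq, Prod.mk.injEq] at hs ht h
    rcases lt_trichotomy s t with hlt | heq | hgt
    · exact (main s t hlt ht.1 ht.2 h.1 h.2).elim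
    · exact heq
    · exact (main t s hgt hs.1 hs.2 h.1.symm h.2.symm).elim

-- Piece starts, first repetitions and window ends occur at most once per piece; steps of type 3 and
-- their successors account for `S * genus` each.
open Classical in
lemma card_isReset_le (hD : TamePieces N S E o D) :
    #{t ∈ range N | IsReset v E o D t} ≤ S * (2 * genus v E N + 3) := by
  have pcinj : ∀ (p : ℕ → Prop) [DecidablePred p], (∀ s t, s < N → t < N → p s → p t → D.pc s = D.pc t → s = t) →
      #{t ∈ range N | p t} ≤ S := by
    intro p _ hp
    calc _ ≤ #(range S) := by
          apply card_le_card_of_injOn D.pc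
          · intro t ht
            simp only [coe_filter, mem_range, Set.mem_ofPred_eq] at ht
            simpa using hD.lt t ht.1
          · intro s hs t ht h
            simp only [coe_filter, mem_range, Set.mem_ofPred_eq] at hs ht
            exact hp s t hs.1 ht.1 hs.2 ht.2 h
      _ = S := card_range S
  have c1 := pcinj (fun t => t = 0 ∨ D.pc t ≠ D.pc (t - 1)) (by
    have main : ∀ s t, s < t → t < N → (t = 0 ∨ D.pc t ≠ D.pc (t - 1)) → D.pc s = D.pc t → False := by
      intro s t hst ht h hp
      have h1 := hD.pc_mono (show s ≤ t - 1 by omega) (by omega)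
      have h2 := hD.pc_mono (show t - 1 ≤ t by omega) ht
      omega
    intro s t hs ht ps pt h
    rcases lt_trichotomy s t with hlt | heq | hgt
    · exact (main s t hlt ht pt h).elim
    · exact heq
    · exact (main t s hgt hs ps h.symm).elim)
  have c2 := pcinj (fun t => t = D.lo (D.pc t) + D.per (D.pc t)) (by
    intro s t _ _ ps pt h; rw [ps, pt, h])
  have c3 := pcinj (fun t => t = D.hi (D.pc t)) (by
    intro s t _ _ ps pt h; rw [ps, pt, h])
  have c4 := card_stepType_three_le (v := v) hD
  have c5 : #{t ∈ range N | 1 ≤ t ∧ stepType v E o D (t - 1) = 3} ≤ S * genus v E N := by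
    refine le_trans ?_ c4
    apply card_le_card_of_injOn (fun t => t - 1)
    · intro t ht
      simp only [coe_filter, mem_range, Set.mem_ofPred_eq] at ht ⊢
      exact ⟨by omega, ht.2.2⟩
    · intro s hs t ht h
      simp only [coe_filter, mem_range, Set.mem_ofPred_eq] at hs ht h
      omega
  have hsub : {t ∈ range N | IsReset v E o D t} ⊆
      {t ∈ range N | t = 0 ∨ D.pc t ≠ D.pc (t - 1)} ∪ ({t ∈ range N | stepType v E o D t = 3} ∪
        ({t ∈ range N | 1 ≤ t ∧ stepType v E o D (t - 1) = 3} ∪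
          ({t ∈ range N | t = D.lo (D.pc t) + D.per (D.pc t)} ∪ {t ∈ range N | t = D.hi (D.pc t)}))) := by
    intro t ht
    rw [mem_filter] at ht
    obtain ⟨h0, h⟩ := ht
    unfold IsReset at h
    simp only [mem_filter, mem_union]
    tauto
  refine (card_le_card hsub).trans ((card_union_le _ _).trans ?_)
  have := add_le_add c1 ((card_union_le _ _).trans (add_le_add c4 ((card_union_le _ _).trans
    (add_le_add c5 ((card_union_le _ _).trans (add_le_add c2 c3))))))
  have e : S * (2 * genus v E N + 3) = S * genus v E N + S * genus v E N + 3 * S := by ring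
  omega

/-- The end of the run of downward steps containing `t`. -/
def runEnd (N : ℕ) (v : ℕ → V) (E : ℕ → ℰ) (o : ℕ → Bool) (D : PieceData) (t : ℕ) : ℕ :=
  sInf {u | t < u ∧ (N ≤ u ∨ IsReset v E o D u ∨ stepType v E o D u ≠ 1)}

/-- The instruction at time `t`. -/
def instr (N : ℕ) (v : ℕ → V) (E : ℕ → ℰ) (o : ℕ → Bool) (D : PieceData) (t : ℕ) : ℕ × ℕ × ℕ :=
  if stepType v E o D t = 1 then (1, firstIdx v (runEnd N v E o D t), runEnd N v E o D t)
  else if stepType v E o D t = 3 then (3, firstIdx v (t + 1), firstIdx E t)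
  else if stepType v E o D t = 4 then (4, D.per (D.pc t), 0)
  else (stepType v E o D t, 0, 0)

lemma runEnd_spec {t : ℕ} (ht : t < N) : t < runEnd N v E o D t ∧ runEnd N v E o D t ≤ N ∧
    ∀ u, t < u → u < runEnd N v E o D t → stepType v E o D u = 1 := by
  have hmem := Nat.sInf_mem (s := {u | t < u ∧ (N ≤ u ∨ IsReset v E o D u ∨ stepType v E o D u ≠ 1)})
    ⟨N, ht, Or.inl le_rfl⟩
  refine ⟨hmem.1, Nat.sInf_le ⟨ht, Or.inl le_rfl⟩, fun u h1 h2 => ?_⟩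
  have := Nat.notMem_of_lt_sInf h2
  simp only [Set.mem_ofPred_eq, not_and_or, not_or, not_not] at this
  rcases this with h | h
  · exact absurd h1 h
  · exact h.2.2

/-- A downward run is described by where and when it ends, which is common to all its steps; hence
the table need record breaks only. -/
lemma instr_eq_of_not_isBreak {t : ℕ} (ht : t < N) (hb : ¬ IsBreak v E o D t) :
    1 ≤ t ∧ instr N v E o D t = instr N v E o D (t - 1) := by
  unfold IsBreak at hb
  push Not at hb
  obtain ⟨hr, hs⟩ := hb
  obtain ⟨h1, hpc, h3, h4, -⟩ := not_isReset_iff hr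
  refine ⟨h1, ?_⟩
  unfold instr
  rw [← hs, if_neg h3, if_neg h3, ← hpc]
  split_ifs with h
  · have : runEnd N v E o D (t - 1) = runEnd N v E o D t := by
      unfold runEnd
      congr 1
      ext u
      simp only [Set.mem_ofPred_eq]
      constructor
      · rintro ⟨a, b⟩
        refine ⟨?_, b⟩
        rcases Nat.lt_or_ge t u with c | c
        · exact c
        · have : u = t := by omega
          subst this
          rcases b with b | b | b
          · omega
          · exact absurd b hr
          · exact absurd h b
      · rintro ⟨a, b⟩; exact ⟨by omega, b⟩
    rw [this]
  all_goals rfl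

lemma follows_instr (hw : IsMultiWalk N v E o) (hD : TamePieces N S E o D) :
    Follows N (firstIdx v) (firstIdx E) (instr N v E o D) := by
  intro t ht
  have hle := stepType_le (v := v) (E := E) (o := o) (D := D) t
  obtain h | h | h | h | h : stepType v E o D t = 0 ∨ stepType v E o D t = 1 ∨ stepType v E o D t = 2 ∨
    stepType v E o D t = 3 ∨ stepType v E o D t = 4 := by omega
  · left
    obtain ⟨-, b1, b2⟩ := stepType_eq_zero h
    obtain ⟨u1, u2⟩ := hw.up ht b1 b2
    simp only [instr, h]
    refine ⟨by simp, ?_, by omega⟩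
    rw [u2, u1, Nat.add_sub_cancel]
  · right; left
    obtain ⟨-, b1, b2⟩ := stepType_eq_one h
    obtain ⟨u1, u2⟩ := hw.down ht b1 b2
    obtain ⟨r1, r2, r3⟩ := runEnd_spec (v := v) (E := E) (o := o) (D := D) ht
    simp only [instr, h, if_true]
    set T := runEnd N v E o D t
    have hdown : ∀ u, t ≤ u → u < T → stepType v E o D u = 1 := by
      intro u hu1 hu2
      rcases hu1.eq_or_lt with rfl | hlt
      · exact h
      · exact r3 u hlt hu2
    have hpar : ∀ i, i ≤ T - (t + 1) → firstIdx v (T - i) = (parentIdx (firstIdx v))^[i] (firstIdx v T) := by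
      intro i
      induction i with
      | zero => intro _; rfl
      | succ i ih =>
        intro hi
        rw [Function.iterate_succ_apply', ← ih (by omega)]
        obtain ⟨-, c1, c2⟩ := stepType_eq_one (hdown (T - (i + 1)) (by omega) (by omega))
        obtain ⟨d1, d2⟩ := hw.down (by omega) c1 c2
        rw [show T - (i + 1) + 1 = T - i by omega] at d1
        rw [parentIdx, d1, d2, Nat.add_sub_cancel]
    refine ⟨trivial, ?_, ?_, by omega⟩
    · obtain ⟨c0, c1, c2⟩ := stepType_eq_one (hdown (T - 1) (by omega) (by omega))
      obtain ⟨d1, d2⟩ := hw.down (by omega) c1 c2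
      rw [show T - 1 + 1 = T by omega] at d1
      -- Otherwise the vertex reached at `T` would have been found after time t, during a run of
      -- downward steps, which find nothing new.
      by_contra hcon
      have e1 := firstIdx_le E (T - 1)
      exact (stepType_eq_one (hdown (firstIdx E (T - 1)) (by omega) (by omega))).1 c1
    · rw [← hpar _ le_rfl]; congr 1; omega
  · right; right; left
    have hn := stepType_eq_two h
    exact ⟨by simp [instr, h], hn, hw.firstIdx_edge_of_isNew ht hn⟩
  · right; right; right; left
    simp [instr, h]
  · right; right; right; right
    have hr := stepType_eq_four_iff.1 h
    obtain ⟨r1, r2⟩ := hr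
    set r := D.pc t with hrdef
    have hL := hD.pos r
    simp only [instr, h]
    simp only [← hrdef]
    have hE := hD.periodic r (t - D.per r) (by omega) (by omega)
    rw [Nat.sub_add_cancel (by omega)] at hE
    obtain ⟨w1, w2⟩ := hD.window r (t - D.per r) (by omega) (by omega)
    obtain ⟨s1, s2⟩ := hw.same t (t - D.per r) ht w1 hE (hD.sign _ _ ht w1 (by rw [w2]))
    refine ⟨by simp, hL, ?_, ?_, ?_⟩
    · simp; omega
    · simp only [OfNat.ofNat_ne_one, if_false, if_true]
      simp only [show (4 : ℕ) ≠ 3 by norm_num, if_false]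
      rw [show t + 1 - D.per r = t - D.per r + 1 by omega]
      exact firstIdx_congr s2
    · simp only [OfNat.ofNat_ne_one, if_false, if_true]
      simp only [show (4 : ℕ) ≠ 3 by norm_num, if_false]
      exact firstIdx_congr hE

open Classical in
/-- The table of instructions at break times. -/
def stepCode (N : ℕ) (v : ℕ → V) (E : ℕ → ℰ) (o : ℕ → Bool) (D : PieceData) :
    Finset (ℕ × ℕ × ℕ × ℕ) :=
  ({t ∈ range N | IsBreak v E o D t}).image fun t => (t, instr N v E o D t)

lemma card_stepCode_le (hw : IsMultiWalk N v E o) (hD : TamePieces N S E o D) :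
    #(stepCode N v E o D) ≤ 3 * (S * (2 * genus v E N + 3)) := by
  classical
  exact card_image_le.trans ((card_isBreak_le hw hD).trans
    (Nat.mul_le_mul_left 3 (card_isReset_le hD)))

lemma stepCode_subset : stepCode N v E o D ⊆
      range N ×ˢ range 5 ×ˢ range (N + 1) ×ˢ range (N + 1) := by
  classical
  intro x hx
  obtain ⟨t, ht, rfl⟩ := mem_image.1 hx
  have htN : t < N := mem_range.1 (mem_filter.1 ht).1
  simp only [mem_product, mem_range]
  have hle := stepType_le (v := v) (E := E) (o := o) (D := D) t
  refine ⟨htN, ?_⟩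
  unfold instr
  have k1 := firstIdx_le v (runEnd N v E o D t)
  obtain ⟨r1, r2, -⟩ := runEnd_spec (v := v) (E := E) (o := o) (D := D) htN
  have k2 := firstIdx_le v (t + 1)
  have k3 := firstIdx_le E t
  split_ifs with h1 h2 h3
  · dsimp only; omega
  · dsimp only; omega
  · have := (stepType_eq_four_iff.1 h3).1
    dsimp only; omega
  · dsimp only; omega

/-- The table contains the break times, so both walks break together, and between breaks both
instructions are constant. -/
lemma instr_eq_of_stepCode_eq {V' : Type*} {v' : ℕ → V'} {E' : ℕ → ℰ} {D' : PieceData}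
    (h : stepCode N v E o D = stepCode N v' E' o D') :
    ∀ t < N, instr N v E o D t = instr N v' E' o D' t := by
  classical
  have main : ∀ t < N, IsBreak v E o D t → IsBreak v' E' o D' t ∧
      instr N v E o D t = instr N v' E' o D' t := by
    intro t ht hb
    have hm : (t, instr N v E o D t) ∈ stepCode N v E o D :=
      mem_image.2 ⟨t, mem_filter.2 ⟨mem_range.2 ht, hb⟩, rfl⟩
    rw [h] at hm
    obtain ⟨t', ht', he⟩ := mem_image.1 hm
    simp only [Prod.mk.injEq] at he
    obtain ⟨rfl, he⟩ := he
    exact ⟨(mem_filter.1 ht').2, he.symm⟩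
  have main' : ∀ t < N, IsBreak v' E' o D' t → IsBreak v E o D t := by
    intro t ht hb
    have hm : (t, instr N v' E' o D' t) ∈ stepCode N v' E' o D' :=
      mem_image.2 ⟨t, mem_filter.2 ⟨mem_range.2 ht, hb⟩, rfl⟩
    rw [← h] at hm
    obtain ⟨t', ht', he⟩ := mem_image.1 hm
    simp only [Prod.mk.injEq] at he
    obtain ⟨rfl, -⟩ := he
    exact (mem_filter.1 ht').2
  intro t
  induction t with
  | zero => intro ht; exact (main 0 ht (Or.inl (Or.inl (Or.inl rfl)))).2
  | succ t ih =>
    intro ht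
    by_cases hb : IsBreak v E o D (t + 1)
    · exact (main _ ht hb).2
    · have hb' : ¬ IsBreak v' E' o D' (t + 1) := fun hc => hb (main' _ ht hc)
      rw [(instr_eq_of_not_isBreak ht hb).2, (instr_eq_of_not_isBreak ht hb').2]
      exact ih (by omega)

/-- Two tame walks with the same table of instructions are isomorphic. -/
lemma firstIdx_eq_of_stepCode_eq {V' : Type*} {v' : ℕ → V'} {E' : ℕ → ℰ} {D' : PieceData} {S' : ℕ}
    (hw : IsMultiWalk N v E o) (hD : TamePieces N S E o D)
    (hw' : IsMultiWalk N v' E' o) (hD' : TamePieces N S' E' o D')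
    (h : stepCode N v E o D = stepCode N v' E' o D') :
    ∀ t < N, firstIdx E t = firstIdx E' t :=
  ((follows_instr hw hD).unique (instr_eq_of_stepCode_eq h) (firstIdx_le v) (firstIdx_le v')
    (follows_instr hw' hD') N le_rfl).2

end code

/-! ### Walks of pairs as walks in a multigraph of label classes. -/

section walk
variable {n : ℕ}

/-- The label from which step `t` starts: `inl x` or `inr y` if the pair `(x, y)` is traversed forwards
or backwards. -/
def tl (o : ℕ → Bool) (w : ℕ → Fin n × Fin n) (t : ℕ) : Fin n ⊕ Fin n :=
  if o t then Sum.inl (w t).1 else Sum.inr (w t).2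

/-- The label at which step `t` ends. -/
def hd (o : ℕ → Bool) (w : ℕ → Fin n × Fin n) (t : ℕ) : Fin n ⊕ Fin n :=
  if o t then Sum.inr (w t).2 else Sum.inl (w t).1

/-- Consecutive steps are linked. -/
def linkRel (o : ℕ → Bool) (w : ℕ → Fin n × Fin n) (N : ℕ) (a b : Fin n ⊕ Fin n) : Prop :=
  ∃ t, t + 1 < N ∧ hd o w t = a ∧ tl o w (t + 1) = b

/-- The connected component of a label in the graph of links. -/
def comp (o : ℕ → Bool) (w : ℕ → Fin n × Fin n) (N : ℕ) (a : Fin n ⊕ Fin n) : Quot (linkRel o w N) :=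
  Quot.mk _ a

/-- The sequence of components visited by a walk. -/
def vtx (o : ℕ → Bool) (w : ℕ → Fin n × Fin n) (N : ℕ) : ℕ → Quot (linkRel o w N)
  | 0 => comp o w N (tl o w 0)
  | t + 1 => comp o w N (hd o w t)

variable {o : ℕ → Bool} {w : ℕ → Fin n × Fin n} {N S : ℕ} {D : PieceData}

lemma vtx_succ (t : ℕ) : vtx o w N (t + 1) = comp o w N (hd o w t) := rfl

lemma vtx_eq_comp_tl {t : ℕ} (ht : t < N) : vtx o w N t = comp o w N (tl o w t) := by
  rcases t with _ | t
  · rfl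
  · exact Quot.sound ⟨t, ht, rfl, rfl⟩

/-- With linked labels glued together, the pair (x, y) is an edge from the class of `inl x` to that
of `inr y`, and consecutive pairs share a vertex. -/
lemma isMultiWalk_vtx : IsMultiWalk N (vtx o w N) w o where
  same s t hs ht hE ho := by
    rw [vtx_eq_comp_tl hs, vtx_eq_comp_tl ht, vtx_succ, vtx_succ]
    simp [tl, hd, hE, ho]
  opp s t hs ht hE ho := by
    rw [vtx_eq_comp_tl hs, vtx_eq_comp_tl ht, vtx_succ, vtx_succ]
    simp only [tl, hd, hE]
    rcases h1 : o s <;> rcases h2 : o t <;> simp_all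

/-- The labels visited by a walk. -/
def labels (o : ℕ → Bool) (w : ℕ → Fin n × Fin n) (N : ℕ) : Finset (Fin n ⊕ Fin n) :=
  (range N).image (tl o w) ∪ (range N).image (hd o w)

open Classical in
/-- The components visited by a walk. -/
def comps (o : ℕ → Bool) (w : ℕ → Fin n × Fin n) (N : ℕ) : Finset (Quot (linkRel o w N)) :=
  (range (N + 1)).image (vtx o w N)

/-- The pairs visited by a walk. -/
def pairs (w : ℕ → Fin n × Fin n) (N : ℕ) : Finset (Fin n × Fin n) := (range N).image w

lemma tl_mem_labels {t : ℕ} (ht : t < N) : tl o w t ∈ labels o w N :=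
  mem_union_left _ (mem_image_of_mem _ (mem_range.2 ht))

lemma hd_mem_labels {t : ℕ} (ht : t < N) : hd o w t ∈ labels o w N :=
  mem_union_right _ (mem_image_of_mem _ (mem_range.2 ht))

lemma comp_mem_comps {z : Fin n ⊕ Fin n} (hz : z ∈ labels o w N) : comp o w N z ∈ comps o w N := by
  classical
  rcases mem_union.1 hz with h | h
  · obtain ⟨t, ht, rfl⟩ := mem_image.1 h
    rw [mem_range] at ht
    rw [← vtx_eq_comp_tl ht]
    exact mem_image_of_mem _ (mem_range.2 (by omega))
  · obtain ⟨t, ht, rfl⟩ := mem_image.1 h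
    rw [mem_range] at ht
    exact mem_image.2 ⟨t + 1, mem_range.2 (by omega), rfl⟩

lemma labels_eq_disjSum : labels o w N = ((pairs w N).image Prod.fst).disjSum ((pairs w N).image Prod.snd) := by
  ext z
  simp only [labels, pairs, mem_union, mem_image, mem_range, mem_disjSum]
  constructor
  · rintro (⟨t, ht, rfl⟩ | ⟨t, ht, rfl⟩)
    · by_cases h : o t
      · left; exact ⟨(w t).1, ⟨w t, ⟨t, ht, rfl⟩, rfl⟩, by simp [tl, h]⟩
      · right; exact ⟨(w t).2, ⟨w t, ⟨t, ht, rfl⟩, rfl⟩, by simp [tl, h]⟩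
    · by_cases h : o t
      · right; exact ⟨(w t).2, ⟨w t, ⟨t, ht, rfl⟩, rfl⟩, by simp [hd, h]⟩
      · left; exact ⟨(w t).1, ⟨w t, ⟨t, ht, rfl⟩, rfl⟩, by simp [hd, h]⟩
  · rintro (⟨x, ⟨p, ⟨t, ht, rfl⟩, rfl⟩, rfl⟩ | ⟨x, ⟨p, ⟨t, ht, rfl⟩, rfl⟩, rfl⟩)
    · by_cases h : o t
      · left; exact ⟨t, ht, by simp [tl, h]⟩
      · right; exact ⟨t, ht, by simp [hd, h]⟩
    · by_cases h : o t
      · right; exact ⟨t, ht, by simp [hd, h]⟩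
      · left; exact ⟨t, ht, by simp [tl, h]⟩

lemma card_labels : #(labels o w N) = #((pairs w N).image Prod.fst) + #((pairs w N).image Prod.snd) := by
  rw [labels_eq_disjSum, card_disjSum]

lemma card_pairs_add_one : #(pairs w N) + 1 = #(comps o w N) + genus (vtx o w N) w N := by
  classical
  exact (isMultiWalk_vtx (o := o) (w := w) (N := N)).card_edges_add_one

/-- Times at which a walk starts, ends, or passes from one piece to the next. -/
def IsSpecial (D : PieceData) (N t : ℕ) : Prop := t = N ∨ t = 0 ∨ D.pc t ≠ D.pc (t - 1)

/-- The component `K` contains a special time. -/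
def SpecialComp (o : ℕ → Bool) (w : ℕ → Fin n × Fin n) (N : ℕ) (D : PieceData)
    (K : Quot (linkRel o w N)) : Prop := ∃ t ≤ N, IsSpecial D N t ∧ vtx o w N t = K

/-- Some link inside the component `K` is used twice. -/
def DoubledComp (o : ℕ → Bool) (w : ℕ → Fin n × Fin n) (N : ℕ) (K : Quot (linkRel o w N)) : Prop :=
  ∃ s t, s < t ∧ t + 1 < N ∧ o s = o (s + 1) ∧ o t = o (t + 1) ∧ comp o w N (hd o w s) = K ∧
    ((hd o w s = hd o w t ∧ tl o w (s + 1) = tl o w (t + 1)) ∨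
      (hd o w s = tl o w (t + 1) ∧ tl o w (s + 1) = hd o w t))

/-- The pairs visited exactly once. -/
def singles (w : ℕ → Fin n × Fin n) (N : ℕ) : Finset (Fin n × Fin n) :=
  {p ∈ pairs w N | #{t ∈ range N | w t = p} = 1}

lemma hd_ne_tl_succ {t : ℕ} (h : o t = o (t + 1)) : hd o w t ≠ tl o w (t + 1) := by
  unfold hd tl; rw [← h]; split_ifs <;> simp

open Classical in
lemma card_special_comps_le (hD : TamePieces N S w o D) :
    #{K ∈ comps o w N | SpecialComp o w N D K} ≤ S + 1 := by
  have hsub : {K ∈ comps o w N | SpecialComp o w N D K} ⊆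
      (insert N {t ∈ range N | t = 0 ∨ D.pc t ≠ D.pc (t - 1)}).image (vtx o w N) := by
    intro K hK
    obtain ⟨t, ht, hs, rfl⟩ := (mem_filter.1 hK).2
    refine mem_image_of_mem _ ?_
    rw [mem_insert, mem_filter, mem_range]
    rcases hs with hs | hs
    · exact Or.inl hs
    · rcases ht.eq_or_lt with h | h
      · exact Or.inl h
      · exact Or.inr ⟨h, hs⟩
  refine (card_le_card hsub).trans (card_image_le.trans ((card_insert_le _ _).trans ?_))
  gcongr
  calc _ ≤ #(range S) := by
        apply card_le_card_of_injOn D.pc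
        · intro t ht
          simp only [coe_filter, mem_range, Set.mem_ofPred_eq] at ht
          simpa using hD.lt t ht.1
        · have main : ∀ s t, s < t → t < N → (t = 0 ∨ D.pc t ≠ D.pc (t - 1)) → D.pc s = D.pc t → False := by
            intro s t hst ht h hp
            have h1 := hD.pc_mono (show s ≤ t - 1 by omega) (by omega)
            have h2 := hD.pc_mono (show t - 1 ≤ t by omega) ht
            omega
          intro s hs t ht h
          simp only [coe_filter, mem_range, Set.mem_ofPred_eq] at hs ht
          rcases lt_trichotomy s t with hlt | heq | hgt
          · exact (main s t hlt ht.1 ht.2 h).elim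
          · exact heq
          · exact (main t s hgt hs.1 hs.2 h.symm).elim
    _ = S := card_range S

lemma not_isSpecial {t : ℕ} (hD : TamePieces N S w o D) (ht : t ≤ N) (h : ¬ IsSpecial D N t) :
    ∃ s, t = s + 1 ∧ s + 1 < N ∧ o s = o (s + 1) := by
  unfold IsSpecial at h
  push Not at h
  obtain ⟨h1, h2, h3⟩ := h
  obtain ⟨s, rfl⟩ : ∃ s, t = s + 1 := ⟨t - 1, by omega⟩
  refine ⟨s, rfl, by omega, ?_⟩
  exact (hD.sign _ _ (by omega) (by omega) h3).symm

open Classical in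
/-- The number of labels in a component. -/
def cnt (o : ℕ → Bool) (w : ℕ → Fin n × Fin n) (N : ℕ) (K : Quot (linkRel o w N)) : ℕ :=
  #{z ∈ labels o w N | comp o w N z = K}

lemma sum_cnt : ∑ K ∈ comps o w N, cnt o w N K = #(labels o w N) := by
  classical
  exact (card_eq_sum_card_fiberwise fun z hz => comp_mem_comps hz).symm

lemma pair_subset_of_link {s : ℕ} (hs : s + 1 < N) {K : Quot (linkRel o w N)}
    (hK : vtx o w N (s + 1) = K) :
    (hd o w s ∈ labels o w N ∧ comp o w N (hd o w s) = K) ∧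
      (tl o w (s + 1) ∈ labels o w N ∧ comp o w N (tl o w (s + 1)) = K) :=
  ⟨⟨hd_mem_labels (by omega), hK⟩, tl_mem_labels hs, (vtx_eq_comp_tl hs) ▸ hK⟩

-- Steps of equal direction link an `inl` label with an `inr` label, so the two are distinct.
open Classical in
lemma two_le_cnt_of_link {s : ℕ} (hs : s + 1 < N) (ho : o s = o (s + 1))
    {K : Quot (linkRel o w N)} (hK : vtx o w N (s + 1) = K) :
    {hd o w s, tl o w (s + 1)} ⊆ ({z ∈ labels o w N | comp o w N z = K} : Finset _) ∧
      2 ≤ cnt o w N K := by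
  obtain ⟨h1, h2⟩ := pair_subset_of_link hs hK
  have hsub : {hd o w s, tl o w (s + 1)} ⊆ ({z ∈ labels o w N | comp o w N z = K} : Finset _) := by
    intro z hz
    rw [mem_insert, mem_singleton] at hz
    rcases hz with rfl | rfl
    · exact mem_filter.2 h1
    · exact mem_filter.2 h2
  refine ⟨hsub, ?_⟩
  rw [← card_pair (hd_ne_tl_succ (w := w) ho)]
  exact card_le_card hsub

lemma one_le_cnt {K : Quot (linkRel o w N)} (hN : 0 < N) (hK : K ∈ comps o w N) : 1 ≤ cnt o w N K := by
  classical
  obtain ⟨t, ht, rfl⟩ := mem_image.1 hK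
  rw [mem_range] at ht
  apply card_pos.2
  rcases t with _ | t
  · exact ⟨tl o w 0, mem_filter.2 ⟨tl_mem_labels hN, rfl⟩⟩
  · exact ⟨hd o w t, mem_filter.2 ⟨hd_mem_labels (by omega), rfl⟩⟩

lemma two_le_cnt_of_not_special (hD : TamePieces N S w o D) {K : Quot (linkRel o w N)}
    (hK : K ∈ comps o w N) (hsp : ¬ SpecialComp o w N D K) : 2 ≤ cnt o w N K := by
  classical
  obtain ⟨t, ht, hv⟩ := mem_image.1 hK
  rw [mem_range] at ht
  have hns : ¬ IsSpecial D N t := fun h => hsp ⟨t, by omega, h, hv⟩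
  obtain ⟨s, rfl, hs, ho⟩ := not_isSpecial hD (by omega) hns
  exact (two_le_cnt_of_link hs ho hv).2

lemma two_mul_card_comps_le (hD : TamePieces N S w o D) (hN : 0 < N) :
    2 * #(comps o w N) ≤ #(labels o w N) + (S + 1) := by
  classical
  have h1 := card_special_comps_le hD
  rw [card_filter] at h1
  refine le_trans ?_ (Nat.add_le_add_left h1 _)
  rw [← sum_cnt, ← sum_add_distrib, mul_comm, ← smul_eq_mul, ← sum_const]
  refine sum_le_sum fun K hK => ?_
  split_ifs with hsp
  · have := one_le_cnt hN hK; omega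
  · have := two_le_cnt_of_not_special hD hK hsp; omega

/-- All passages through a class of two labels use the same link, up to orientation. If this link is
not repeated there is a single passage, and the pair leaving the class is used at that time only. -/
lemma exists_single_of_cnt_eq_two (hD : TamePieces N S w o D) {K : Quot (linkRel o w N)}
    (hK : K ∈ comps o w N) (hsp : ¬ SpecialComp o w N D K) (hdb : ¬ DoubledComp o w N K)
    (h2 : cnt o w N K = 2) : ∃ t < N, vtx o w N t = K ∧ w t ∈ singles w N := by
  classical
  obtain ⟨t, ht, hv⟩ := mem_image.1 hK
  rw [mem_range] at ht
  have hns : ∀ u ≤ N, vtx o w N u = K → ¬ IsSpecial D N u := fun u hu hvu h => hsp ⟨u, hu, h, hvu⟩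
  obtain ⟨s, rfl, hs, ho⟩ := not_isSpecial hD (by omega) (hns t (by omega) hv)
  have hfull : ∀ u, u + 1 < N → o u = o (u + 1) → vtx o w N (u + 1) = K →
      ({hd o w u, tl o w (u + 1)} : Finset _) = {z ∈ labels o w N | comp o w N z = K} := by
    intro u hu hou hvu
    obtain ⟨a, -⟩ := two_le_cnt_of_link hu hou hvu
    apply eq_of_subset_of_card_le a
    rw [card_pair (hd_ne_tl_succ hou)]
    exact h2.le
  have huniq : ∀ u ≤ N, vtx o w N u = K → u = s + 1 := by
    intro u hu hvu
    obtain ⟨r, rfl, hr, hor⟩ := not_isSpecial hD hu (hns u hu hvu)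
    by_contra hne
    have e := (hfull r hr hor hvu).trans (hfull s hs ho hv).symm
    have hcase : (hd o w r = hd o w s ∧ tl o w (r + 1) = tl o w (s + 1)) ∨
        (hd o w r = tl o w (s + 1) ∧ tl o w (r + 1) = hd o w s) := by
      have m1 : hd o w r ∈ ({hd o w s, tl o w (s + 1)} : Finset _) := by rw [← e]; simp
      have m2 : tl o w (r + 1) ∈ ({hd o w s, tl o w (s + 1)} : Finset _) := by rw [← e]; simp
      have d1 := hd_ne_tl_succ (w := w) hor
      simp only [mem_insert, mem_singleton] at m1 m2
      rcases m1 with m1 | m1 <;> rcases m2 with m2 | m2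
      · exact absurd (m1.trans m2.symm) d1
      · exact Or.inl ⟨m1, m2⟩
      · exact Or.inr ⟨m1, m2⟩
      · exact absurd (m1.trans m2.symm) d1
    apply hdb
    rcases lt_or_gt_of_ne (show r ≠ s by omega) with hlt | hgt
    · exact ⟨r, s, hlt, hs, hor, ho, hvu, hcase⟩
    · refine ⟨s, r, hgt, hr, ho, hor, hv, ?_⟩
      rcases hcase with ⟨a, b⟩ | ⟨a, b⟩
      · exact Or.inl ⟨a.symm, b.symm⟩
      · exact Or.inr ⟨b.symm, a.symm⟩
  refine ⟨s + 1, hs, hv, ?_⟩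
  rw [singles, mem_filter]
  refine ⟨mem_image_of_mem _ (mem_range.2 hs), ?_⟩
  rw [card_eq_one]
  refine ⟨s + 1, ?_⟩
  ext u
  rw [mem_filter, mem_range, mem_singleton]
  constructor
  · rintro ⟨hu, hwu⟩
    by_cases hou : o u = o (s + 1)
    · exact huniq u hu.le ((isMultiWalk_vtx.same u (s + 1) hu hs hwu hou).1.trans hv)
    · have := huniq (u + 1) hu ((isMultiWalk_vtx.opp u (s + 1) hu hs hwu hou).2.trans hv)
      have : u = s := by omega
      subst this
      exact absurd ho hou
  · rintro rfl; exact ⟨hs, rfl⟩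

-- A class with fewer than three labels is special, doubled, or yields a pair used once, by
-- `exists_single_of_cnt_eq_two`. Together with `card_singles_le` and Euler's relation, this
-- controls how many labels must be paid for by row sums.
open Classical in
lemma three_mul_card_comps_le (hD : TamePieces N S w o D) (hN : 0 < N) :
    3 * #(comps o w N) ≤ #(labels o w N) + #{K ∈ comps o w N | DoubledComp o w N K}
      + 2 * (S + 1) + #(singles w N) := by
  set Q : Quot (linkRel o w N) → Prop := fun K =>
    ¬ SpecialComp o w N D K ∧ ¬ DoubledComp o w N K ∧ cnt o w N K = 2
  have h1 := card_special_comps_le hD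
  have h2 : #{K ∈ comps o w N | Q K} ≤ #(singles w N) := by
    have hex : ∀ K ∈ {K ∈ comps o w N | Q K}, ∃ t < N, vtx o w N t = K ∧ w t ∈ singles w N := by
      intro K hK
      obtain ⟨hK, a, b, c⟩ := mem_filter.1 hK
      exact exists_single_of_cnt_eq_two hD hK a b c
    choose! f hf using hex
    apply card_le_card_of_injOn (fun K => w (f K))
    · intro K hK; exact (hf K hK).2.2
    · intro K hK K' hK' h
      obtain ⟨a, b, c⟩ := hf K hK
      obtain ⟨a', b', -⟩ := hf K' hK'
      obtain ⟨z, hz⟩ := card_eq_one.1 (mem_filter.1 c).2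
      have m1 : f K ∈ ({z} : Finset ℕ) := by rw [← hz]; simp [a]
      have m2 : f K' ∈ ({z} : Finset ℕ) := by rw [← hz]; simpa [a'] using h.symm
      rw [mem_singleton] at m1 m2
      rw [← b, ← b', m1, m2]
  rw [card_filter] at h1 h2
  rw [card_filter]
  have key : 3 * #(comps o w N) ≤ ∑ K ∈ comps o w N, (cnt o w N K + (if DoubledComp o w N K then 1 else 0)
      + 2 * (if SpecialComp o w N D K then 1 else 0) + if Q K then 1 else 0) := by
    rw [mul_comm, ← smul_eq_mul, ← sum_const]
    refine sum_le_sum fun K hK => ?_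
    have h1 := one_le_cnt hN hK
    by_cases hsp : SpecialComp o w N D K
    · simp only [hsp, if_true]; omega
    · have h2 := two_le_cnt_of_not_special hD hK hsp
      by_cases hdb : DoubledComp o w N K
      · simp only [hdb, if_true]; omega
      · by_cases h3 : cnt o w N K = 2
        · have : Q K := ⟨hsp, hdb, h3⟩
          simp only [this, if_true]; omega
        · omega
  rw [sum_add_distrib, sum_add_distrib, sum_add_distrib, ← mul_sum, sum_cnt] at key
  omega

end walk

/-! ### Two elementary counting bounds. -/

section counting

lemma card_powerset_card_le {α : Type*} [DecidableEq α] (B : Finset α) (h : ℕ) :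
    #{A ∈ B.powerset | #A ≤ h} ≤ (#B + 1) ^ h := by
  induction h with
  | zero =>
    have : {A ∈ B.powerset | #A ≤ 0} ⊆ {∅} := by
      intro A hA
      have := (mem_filter.1 hA).2
      simpa using this
    simpa using card_le_card this
  | succ h ih =>
    have hsub : {A ∈ B.powerset | #A ≤ h + 1} ⊆ {A ∈ B.powerset | #A ≤ h} ∪
        (B ×ˢ {A ∈ B.powerset | #A ≤ h}).image (fun p => insert p.1 p.2) := by
      intro A hA
      obtain ⟨hA1, hA2⟩ := mem_filter.1 hA
      rw [mem_powerset] at hA1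
      rcases A.eq_empty_or_nonempty with rfl | ⟨a, ha⟩
      · exact mem_union_left _ (mem_filter.2 ⟨by simp, by simp⟩)
      · refine mem_union_right _ (mem_image.2 ⟨(a, A.erase a), ?_, insert_erase ha⟩)
        rw [mem_product, mem_filter, mem_powerset]
        exact ⟨hA1 ha, (erase_subset _ _).trans hA1, by rw [card_erase_of_mem ha]; omega⟩
    calc _ ≤ _ := card_le_card hsub
      _ ≤ (#B + 1) ^ h + #B * (#B + 1) ^ h := by
        refine (card_union_le _ _).trans (add_le_add ih (card_image_le.trans ?_))
        rw [card_product]; gcongr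
      _ = _ := by ring

/-- Elements of `T` which `f` does not separate from another one are few if `f` is nearly injective. -/
lemma card_not_separated_le {α β : Type*} [DecidableEq α] [DecidableEq β] (T : Finset α) (f : α → β) :
    #{p ∈ T | ∃ q ∈ T, q ≠ p ∧ f q = f p} + 2 * #(T.image f) ≤ 2 * #T := by
  set G := {p ∈ T | ∃ q ∈ T, q ≠ p ∧ f q = f p} with hG
  have hGT : G ⊆ T := filter_subset _ _
  have h1 : 2 * #(G.image f) ≤ #G := by
    apply mul_card_image_le_card
    intro b hb
    obtain ⟨p, hp, rfl⟩ := mem_image.1 hb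
    obtain ⟨hpT, q, hq, hne, he⟩ := mem_filter.1 hp
    have : ({q, p} : Finset α) ⊆ {x ∈ G | f x = f p} := by
      intro x hx
      rw [mem_insert, mem_singleton] at hx
      rcases hx with rfl | rfl
      · exact mem_filter.2 ⟨mem_filter.2 ⟨hq, p, hpT, hne.symm, he.symm⟩, he⟩
      · exact mem_filter.2 ⟨hp, rfl⟩
    rw [← card_pair hne]
    exact card_le_card this
  have h2 : T.image f ⊆ (T \ G).image f ∪ G.image f := by
    rw [← image_union, sdiff_union_of_subset hGT]
  have h3 := (card_le_card h2).trans (card_union_le _ _)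
  have h4 : #((T \ G).image f) ≤ #(T \ G) := card_image_le
  have h5 := card_sdiff_add_card_eq_card hGT
  omega

end counting

/-! ### Codes of walks and summation over coincidence patterns. -/

section walk
variable {n : ℕ} {o : ℕ → Bool} {w w' : ℕ → Fin n × Fin n} {N S : ℕ} {D D' : PieceData}

/-- Times at which a new pair has an old label, together with the first occurrence of that label. -/
def repeatCode {α β : Type*} (f : α → β) (w : ℕ → α) (N : ℕ) : Finset (ℕ × ℕ) :=
  ({t ∈ range N | firstIdx w t = t ∧ firstIdx (f ∘ w) t ≠ t}).image fun t => (t, firstIdx (f ∘ w) t)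

lemma card_repeatCode {α β : Type*} [DecidableEq α] [DecidableEq β] (f : α → β) (w : ℕ → α) (N : ℕ) :
    #(repeatCode f w N) + #(((range N).image w).image f) ≤ #((range N).image w) := by
  rw [image_image, card_image_range_eq_firstIdx (f ∘ w), card_image_range_eq_firstIdx w]
  have h0 : {t ∈ range N | firstIdx (f ∘ w) t = t} =
      {t ∈ {t ∈ range N | firstIdx w t = t} | firstIdx (f ∘ w) t = t} := by
    ext t
    simp only [mem_filter]
    constructor
    · rintro ⟨a, b⟩
      refine ⟨⟨a, le_antisymm (firstIdx_le _ _) ?_⟩, b⟩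
      conv_lhs => rw [← b]
      exact firstIdx_le_of_eq (congrArg f (apply_firstIdx w t))
    · rintro ⟨⟨a, _⟩, b⟩; exact ⟨a, b⟩
  rw [h0, ← card_filter_add_card_filter_not (s := {t ∈ range N | firstIdx w t = t})
    (fun t => firstIdx (f ∘ w) t = t), add_comm]
  gcongr
  refine card_image_le.trans ?_
  rw [filter_filter]

lemma repeatCode_subset {α β : Type*} (f : α → β) (w : ℕ → α) (N : ℕ) :
    repeatCode f w N ⊆ range N ×ˢ range N := by
  intro x hx
  obtain ⟨t, ht, rfl⟩ := mem_image.1 hx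
  have h := mem_range.1 (mem_filter.1 ht).1
  rw [mem_product, mem_range, mem_range]
  exact ⟨h, (firstIdx_le _ _).trans_lt h⟩

/-- The label of an old pair is copied from the first use of the pair; for a new pair the table says
whether its label is old, and since when. -/
lemma firstIdx_comp_eq_of_repeatCode_eq {α β : Type*} {f : α → β} {w w' : ℕ → α}
    (hη : ∀ t < N, firstIdx w t = firstIdx w' t) (h : repeatCode f w N = repeatCode f w' N) :
    ∀ t < N, firstIdx (f ∘ w) t = firstIdx (f ∘ w') t := by
  intro t
  induction t using Nat.strong_induction_on with
  | _ t ih =>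
  intro ht
  by_cases h1 : firstIdx w t = t
  · have h1' : firstIdx w' t = t := by rw [← hη t ht, h1]
    by_cases h2 : firstIdx (f ∘ w) t = t
    · by_cases h3 : firstIdx (f ∘ w') t = t
      · rw [h2, h3]
      · have hm : (t, firstIdx (f ∘ w') t) ∈ repeatCode f w' N :=
          mem_image.2 ⟨t, mem_filter.2 ⟨mem_range.2 ht, h1', h3⟩, rfl⟩
        rw [← h] at hm
        obtain ⟨s, hs, he⟩ := mem_image.1 hm
        simp only [Prod.mk.injEq] at he
        obtain ⟨rfl, he⟩ := he
        exact he
    · have hm : (t, firstIdx (f ∘ w) t) ∈ repeatCode f w N :=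
        mem_image.2 ⟨t, mem_filter.2 ⟨mem_range.2 ht, h1, h2⟩, rfl⟩
      rw [h] at hm
      obtain ⟨s, hs, he⟩ := mem_image.1 hm
      simp only [Prod.mk.injEq] at he
      obtain ⟨rfl, he⟩ := he
      exact he.symm
  · have hlt := lt_of_le_of_ne (firstIdx_le w t) h1
    have e1 : firstIdx (f ∘ w) t = firstIdx (f ∘ w) (firstIdx w t) :=
      firstIdx_congr (congrArg f (apply_firstIdx w t)).symm
    have e2 : firstIdx (f ∘ w') t = firstIdx (f ∘ w') (firstIdx w' t) :=
      firstIdx_congr (congrArg f (apply_firstIdx w' t)).symm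
    rw [e1, e2, ← hη t ht]
    exact ih _ hlt (by omega)

/-- The walks `w` and `w'` have the same coincidences among their labels. -/
def SameKernel (N : ℕ) (w w' : ℕ → Fin n × Fin n) : Prop := ∀ s < N, ∀ t < N,
  ((w s).1 = (w t).1 ↔ (w' s).1 = (w' t).1) ∧ ((w s).2 = (w t).2 ↔ (w' s).2 = (w' t).2)

/-- A code which determines the coincidences among the labels of a tame walk. -/
def walkCode (o : ℕ → Bool) (D : PieceData) (N : ℕ) (w : ℕ → Fin n × Fin n) :
    Finset (ℕ × ℕ × ℕ × ℕ) × Finset (ℕ × ℕ) × Finset (ℕ × ℕ) :=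
  (stepCode N (vtx o w N) w o D, repeatCode Prod.fst w N, repeatCode Prod.snd w N)

lemma sameKernel_of_walkCode_eq {S' : ℕ} (hD : TamePieces N S w o D) (hD' : TamePieces N S' w' o D')
    (h : walkCode o D N w = walkCode o D' N w') : SameKernel N w w' := by
  simp only [walkCode, Prod.mk.injEq] at h
  obtain ⟨h1, h2, h3⟩ := h
  have hη := firstIdx_eq_of_stepCode_eq isMultiWalk_vtx hD isMultiWalk_vtx hD' h1
  have hx := firstIdx_comp_eq_of_repeatCode_eq hη h2
  have hy := firstIdx_comp_eq_of_repeatCode_eq hη h3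
  intro s hs t ht
  constructor
  · have := firstIdx_eq_iff (f := Prod.fst ∘ w) (s := s) (t := t)
    rw [hx s hs, hx t ht, firstIdx_eq_iff] at this
    exact this.symm
  · have := firstIdx_eq_iff (f := Prod.snd ∘ w) (s := s) (t := t)
    rw [hy s hs, hy t ht, firstIdx_eq_iff] at this
    exact this.symm

/-- Euler's relation, with two labels in every class that is not special. It leaves at most `2 *
genus + S` coincidences among labels of distinct pairs. -/
lemma two_mul_card_pairs_le (hD : TamePieces N S w o D) (hN : 0 < N) :
    2 * #(pairs w N) ≤ #(labels o w N) + (2 * genus (vtx o w N) w N + S) := by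
  have h1 := two_mul_card_comps_le hD hN
  have h2 := card_pairs_add_one (o := o) (w := w) (N := N)
  omega

/-- The set of possible codes of tame walks of given cycle rank. -/
def codeSet (N S g : ℕ) : Finset (Finset (ℕ × ℕ × ℕ × ℕ) × Finset (ℕ × ℕ) × Finset (ℕ × ℕ)) :=
  {A ∈ (range N ×ˢ range 5 ×ˢ range (N + 1) ×ˢ range (N + 1)).powerset | #A ≤ 3 * (S * (2 * g + 3))} ×ˢ
  {A ∈ (range N ×ˢ range N).powerset | #A ≤ 2 * g + S} ×ˢ
  {A ∈ (range N ×ˢ range N).powerset | #A ≤ 2 * g + S}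

lemma walkCode_mem_codeSet (hD : TamePieces N S w o D) (hN : 0 < N) :
    walkCode o D N w ∈ codeSet N S (genus (vtx o w N) w N) := by
  have h1 := two_mul_card_pairs_le hD hN
  rw [card_labels] at h1
  have h2 := card_repeatCode Prod.fst w N
  have h3 := card_repeatCode Prod.snd w N
  have e1 : #((pairs w N).image Prod.fst) ≤ #(pairs w N) := card_image_le
  have e2 : #((pairs w N).image Prod.snd) ≤ #(pairs w N) := card_image_le
  unfold pairs at h1 e1 e2
  simp only [walkCode, codeSet, mem_product, mem_filter, mem_powerset]
  exact ⟨⟨stepCode_subset, card_stepCode_le isMultiWalk_vtx hD⟩,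
    ⟨repeatCode_subset _ _ _, by omega⟩, ⟨repeatCode_subset _ _ _, by omega⟩⟩

/-- The three tables have at most 3S(2g + 3) + 2(2g + S) entries in all, which is at most 15S(g +
1). -/
lemma card_codeSet_le (hS : 1 ≤ S) (g : ℕ) :
    #(codeSet N S g) ≤ (5 * (N + 1) ^ 3) ^ (15 * S * (g + 1)) := by
  have b1 : #(range N ×ˢ range 5 ×ˢ range (N + 1) ×ˢ range (N + 1)) + 1 ≤ 5 * (N + 1) ^ 3 := by
    simp only [card_product, card_range]; nlinarith
  have b2 : #(range N ×ˢ range N) + 1 ≤ 5 * (N + 1) ^ 3 := by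
    simp only [card_product, card_range]; nlinarith
  unfold codeSet
  rw [card_product, card_product]
  calc _ ≤ (5 * (N + 1) ^ 3) ^ (3 * (S * (2 * g + 3))) *
        ((5 * (N + 1) ^ 3) ^ (2 * g + S) * (5 * (N + 1) ^ 3) ^ (2 * g + S)) := by
        refine Nat.mul_le_mul ?_ (Nat.mul_le_mul ?_ ?_)
        · exact (card_powerset_card_le _ _).trans (Nat.pow_le_pow_left b1 _)
        · exact (card_powerset_card_le _ _).trans (Nat.pow_le_pow_left b2 _)
        · exact (card_powerset_card_le _ _).trans (Nat.pow_le_pow_left b2 _)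
    _ ≤ _ := by
        rw [← pow_add, ← pow_add]
        apply Nat.pow_le_pow_right (by positivity)
        nlinarith [Nat.mul_le_mul_right g hS]

/-- To bound a sum over tame walks it suffices to bound the sums over walks with given coincidences. -/
lemma sum_le_sum_genus {ι : Type*} (Ω : Finset ι) (wk : ι → ℕ → Fin n × Fin n) (f : ι → ℝ) (F : ℕ → ℝ)
    (hN : 0 < N) (hS : 1 ≤ S) (hF : ∀ g, 0 ≤ F g)
    (hD : ∀ ω ∈ Ω, ∃ D, TamePieces N S (wk ω) o D)
    (hfib : ∀ ω₀ ∈ Ω, ∀ Ω' ⊆ Ω, (∀ ω ∈ Ω', SameKernel N (wk ω) (wk ω₀)) →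
      ∑ ω ∈ Ω', f ω ≤ F (genus (vtx o (wk ω₀) N) (wk ω₀) N)) :
    ∑ ω ∈ Ω, f ω ≤ ∑ g ∈ range (N + 1), ((5 * (N + 1) ^ 3) ^ (15 * S * (g + 1)) : ℝ) * F g := by
  classical
  have : Nonempty PieceData := ⟨⟨fun _ => 0, fun _ => 0, fun _ => 0, fun _ => 0⟩⟩
  choose! D hD using hD
  have hg : ∀ ω ∈ Ω, genus (vtx o (wk ω) N) (wk ω) N ∈ range (N + 1) := by
    intro ω _
    rw [mem_range, Nat.lt_succ_iff, genus]
    exact (card_filter_le _ _).trans (card_range N).le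
  rw [← sum_fiberwise_of_maps_to hg]
  refine sum_le_sum fun g _ => ?_
  have hc : ∀ ω ∈ {ω ∈ Ω | genus (vtx o (wk ω) N) (wk ω) N = g},
      walkCode o (D ω) N (wk ω) ∈ codeSet N S g := by
    intro ω hω
    obtain ⟨h1, rfl⟩ := mem_filter.1 hω
    exact walkCode_mem_codeSet (hD ω h1) hN
  rw [← sum_fiberwise_of_maps_to hc]
  calc _ ≤ ∑ _c ∈ codeSet N S g, F g := by
        refine sum_le_sum fun c _ => ?_
        set A := {ω ∈ {ω ∈ Ω | genus (vtx o (wk ω) N) (wk ω) N = g} | walkCode o (D ω) N (wk ω) = c} with hA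
        rcases A.eq_empty_or_nonempty with he | ⟨ω₀, h₀⟩
        · rw [he, sum_empty]; exact hF g
        · have hAΩ : A ⊆ Ω := (filter_subset _ _).trans (filter_subset _ _)
          have hgen := (mem_filter.1 (mem_filter.1 h₀).1).2
          rw [← hgen]
          refine hfib ω₀ (hAΩ h₀) A hAΩ fun ω hω => ?_
          exact sameKernel_of_walkCode_eq (hD ω (hAΩ hω)) (hD ω₀ (hAΩ h₀))
            ((mem_filter.1 hω).2.trans (mem_filter.1 h₀).2.symm)
    _ ≤ _ := by
        rw [sum_const, nsmul_eq_mul]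
        have := card_codeSet_le (N := N) hS g
        have : (#(codeSet N S g) : ℝ) ≤ ((5 * (N + 1) ^ 3) ^ (15 * S * (g + 1)) : ℕ) := by exact_mod_cast this
        push_cast at this
        exact mul_le_mul_of_nonneg_right this (hF g)

end walk

/-! ### Sums over values of labels, estimated one label at a time. -/

section labelSum
variable {α X τ κ : Type*} [Fintype α] [DecidableEq α]

/-- Assignments of values to labels: the labels in `Z` take values in `R`, the others are mapped to `pt`. -/
def assignments (R : α → Finset X) (pt : X) (Z : Finset α) : Finset (α → X) :=
  Fintype.piFinset fun z => if z ∈ Z then R z else {pt}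

/-- The links of `T` with both ends in `Z`. -/
def inner (T : Finset τ) (a b : τ → α) (Z : Finset α) : Finset τ := {t ∈ T | a t ∈ Z ∧ b t ∈ Z}

/-- The sum over assignments of the product of the weights of the links inside `Z`. -/
def labelSum (R : α → Finset X) (pt : X) (T : Finset τ) (a b : τ → α) (H : τ → X → X → ℝ)
    (Z : Finset α) : ℝ :=
  ∑ φ ∈ assignments R pt Z, ∏ t ∈ inner T a b Z, H t (φ (a t)) (φ (b t))

variable {R : α → Finset X} {pt : X} {T : Finset τ} {a b : τ → α} {H : τ → X → X → ℝ}
  {Z : Finset α}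

lemma sum_assignments_insert {z : α} (hz : z ∉ Z) (G : (α → X) → ℝ) :
    ∑ φ ∈ assignments R pt (insert z Z), G φ =
      ∑ φ ∈ assignments R pt Z, ∑ i ∈ R z, G (Function.update φ z i) := by
  classical
  rw [← sum_product']
  symm
  refine sum_bij' (fun p _ => Function.update p.1 z p.2) (fun φ _ => (Function.update φ z pt, φ z))
    ?_ ?_ ?_ ?_ ?_
  · rintro ⟨φ, i⟩ h
    rw [mem_product] at h
    have h1 := Fintype.mem_piFinset.1 h.1
    refine Fintype.mem_piFinset.2 fun u => ?_
    by_cases hu : u = z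
    · subst hu; simpa using h.2
    · simpa [hu] using h1 u
  · intro φ h
    have h1 := Fintype.mem_piFinset.1 h
    rw [mem_product]
    refine ⟨Fintype.mem_piFinset.2 fun u => ?_, by simpa using h1 z⟩
    by_cases hu : u = z
    · subst hu; simp [hz]
    · simpa [hu] using h1 u
  · rintro ⟨φ, i⟩ h
    rw [mem_product] at h
    have h1 := Fintype.mem_piFinset.1 h.1 z
    simp only [hz, if_false, mem_singleton] at h1
    simp [← h1]
  · intro φ h; simp
  · intro p h; rfl

section bounds
variable (h0 : ∀ t i j, 0 ≤ H t i j) (h1 : ∀ t i j, H t i j ≤ 1)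
include h0 h1

omit [Fintype α] in
lemma prod_inner_le {Z' : Finset α} (hZ : Z ⊆ Z') (A : Finset τ) (hA : A ⊆ inner T a b Z')
    (hd : ∀ t ∈ A, ¬ (a t ∈ Z ∧ b t ∈ Z)) (φ : α → X) :
    ∏ t ∈ inner T a b Z', H t (φ (a t)) (φ (b t)) ≤
      (∏ t ∈ inner T a b Z, H t (φ (a t)) (φ (b t))) * ∏ t ∈ A, H t (φ (a t)) (φ (b t)) := by
  classical
  have hdis : Disjoint (inner T a b Z) A := by
    rw [disjoint_left]; intro t ht hA; exact hd t hA (mem_filter.1 ht).2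
  rw [← prod_union hdis]
  have hsub : inner T a b Z ∪ A ⊆ inner T a b Z' := by
    refine union_subset (fun t ht => ?_) hA
    obtain ⟨x, y, z⟩ := mem_filter.1 ht
    exact mem_filter.2 ⟨x, hZ y, hZ z⟩
  rw [← prod_sdiff hsub]
  exact mul_le_of_le_one_left (prod_nonneg fun _ _ => h0 _ _ _)
    (prod_le_one (fun _ _ => h0 _ _ _) fun _ _ => h1 _ _ _)

omit [Fintype α] h0 h1 in
lemma prod_inner_update {z : α} (hz : z ∉ Z) (φ : α → X) (i : X) :
    ∏ t ∈ inner T a b Z, H t (Function.update φ z i (a t)) (Function.update φ z i (b t)) =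
      ∏ t ∈ inner T a b Z, H t (φ (a t)) (φ (b t)) := by
  refine prod_congr rfl fun t ht => ?_
  obtain ⟨_, x, y⟩ := mem_filter.1 ht
  rw [Function.update_of_ne (fun h => hz (by rwa [h] at x)),
    Function.update_of_ne (fun h => hz (by rwa [h] at y))]

omit h1 in
lemma labelSum_nonneg : 0 ≤ labelSum R pt T a b H Z :=
  sum_nonneg fun _ _ => prod_nonneg fun _ _ => h0 _ _ _

omit h0 h1 in
lemma labelSum_empty : labelSum R pt T a b H ∅ = 1 := by
  have : assignments R pt (∅ : Finset α) = {fun _ => pt} := by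
    ext φ
    simp [assignments, funext_iff]
  simp [labelSum, this, inner]

/-- All links at the new label are dropped, as weights do not exceed 1: the price of the first label
of a class. -/
lemma labelSum_insert_le_card_mul {z : α} (hz : z ∉ Z) :
    labelSum R pt T a b H (insert z Z) ≤ #(R z) * labelSum R pt T a b H Z := by
  unfold labelSum
  rw [sum_assignments_insert hz, mul_sum]
  refine sum_le_sum fun φ _ => ?_
  rw [← nsmul_eq_mul, ← sum_const]
  refine sum_le_sum fun i _ => ?_
  refine (prod_inner_le h0 h1 (subset_insert z Z) ∅ (by simp) (by simp) _).trans ?_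
  rw [prod_empty, mul_one, prod_inner_update hz]

/-- One link to a label already present is kept, and the sum over the new label is a row or column
sum. -/
lemma labelSum_insert_le_mul [Fintype X] {lam : ℝ} (hr : ∀ t i, ∑ j, H t i j ≤ lam)
    (hc : ∀ t j, ∑ i, H t i j ≤ lam) {z u : α} (hz : z ∉ Z) (hu : u ∈ Z) {t : τ} (ht : t ∈ T)
    (hab : (a t = z ∧ b t = u) ∨ (a t = u ∧ b t = z)) :
    labelSum R pt T a b H (insert z Z) ≤ lam * labelSum R pt T a b H Z := by
  have huz : u ≠ z := fun h => hz (h ▸ hu)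
  unfold labelSum
  rw [sum_assignments_insert hz, mul_sum]
  refine sum_le_sum fun φ _ => ?_
  have key : ∀ i ∈ R z, ∏ t ∈ inner T a b (insert z Z),
      H t (Function.update φ z i (a t)) (Function.update φ z i (b t)) ≤
      (∏ t ∈ inner T a b Z, H t (φ (a t)) (φ (b t))) *
        H t (Function.update φ z i (a t)) (Function.update φ z i (b t)) := by
    intro i _
    refine (prod_inner_le h0 h1 (subset_insert z Z) {t} ?_ ?_ _).trans ?_
    · rw [singleton_subset_iff]
      refine mem_filter.2 ⟨ht, ?_⟩
      rcases hab with ⟨h, h'⟩ | ⟨h, h'⟩ <;> rw [h, h'] <;> simp [hu]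
    · intro s hs
      rw [mem_singleton] at hs
      subst hs
      rcases hab with ⟨h, h'⟩ | ⟨h, h'⟩ <;> rw [h, h'] <;> simp [hz]
    · rw [prod_singleton, prod_inner_update hz]
  refine (sum_le_sum key).trans ?_
  rw [← mul_sum, mul_comm]
  refine mul_le_mul_of_nonneg_right ?_ (prod_nonneg fun _ _ => h0 _ _ _)
  refine (sum_le_sum_of_subset_of_nonneg (subset_univ _) fun _ _ _ => h0 _ _ _).trans ?_
  rcases hab with ⟨h, h'⟩ | ⟨h, h'⟩
  · simpa [h, h', huz] using hc t (φ u)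
  · simpa [h, h', huz] using hr t (φ u)

/-- Two links join the same two labels. By 2ab ≤ a² + b² the sum over both is a Hilbert-Schmidt sum,
so two labels cost as little as one free label. -/
lemma labelSum_insert_insert_le_mul [Fintype X] {B : ℝ} (hB : ∀ t, ∑ i, ∑ j, H t i j ^ 2 ≤ B) {z z' : α}
    (hz' : z' ∉ Z) (hz : z ∉ insert z' Z) {s t : τ} (hst : s ≠ t) (hs : s ∈ T) (ht : t ∈ T)
    (has : a s = z ∧ b s = z') (hat : (a t = z ∧ b t = z') ∨ (a t = z' ∧ b t = z)) :
    labelSum R pt T a b H (insert z (insert z' Z)) ≤ B * labelSum R pt T a b H Z := by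
  classical
  have hzz : z' ≠ z := fun h => hz (by simp [h])
  have hzZ : z ∉ Z := fun h => hz (by simp [h])
  unfold labelSum
  rw [sum_assignments_insert hz, sum_assignments_insert hz', mul_sum]
  refine sum_le_sum fun φ _ => ?_
  have key : ∀ j ∈ R z', ∀ i ∈ R z, ∏ t ∈ inner T a b (insert z (insert z' Z)),
      H t (Function.update (Function.update φ z' j) z i (a t)) (Function.update (Function.update φ z' j) z i (b t)) ≤
      (∏ t ∈ inner T a b Z, H t (φ (a t)) (φ (b t))) *
        (H s i j * (if a t = z then H t i j else H t j i)) := by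
    intro j _ i _
    refine (prod_inner_le h0 h1 ((subset_insert z' Z).trans (subset_insert z _)) {s, t} ?_ ?_ _).trans ?_
    · intro r hr
      rw [mem_insert, mem_singleton] at hr
      rcases hr with rfl | rfl
      · exact mem_filter.2 ⟨hs, by rw [has.1, has.2]; simp⟩
      · refine mem_filter.2 ⟨ht, ?_⟩
        rcases hat with ⟨h, h'⟩ | ⟨h, h'⟩ <;> rw [h, h'] <;> simp
    · intro r hr
      rw [mem_insert, mem_singleton] at hr
      rcases hr with rfl | rfl
      · rw [has.1]; simp [hzZ]
      · rcases hat with ⟨h, h'⟩ | ⟨h, h'⟩ <;> rw [h, h'] <;> simp [hzZ]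
    · rw [prod_pair hst, prod_inner_update hzZ, prod_inner_update hz', has.1, has.2]
      apply le_of_eq
      congr 1
      rcases hat with ⟨h, h'⟩ | ⟨h, h'⟩ <;> simp [h, h', hzz]
  refine (sum_le_sum fun j hj => sum_le_sum (key j hj)).trans ?_
  simp_rw [← mul_sum]
  rw [mul_comm]
  refine mul_le_mul_of_nonneg_right ?_ (prod_nonneg fun _ _ => h0 _ _ _)
  have hnn : ∀ i j, 0 ≤ H s i j * (if a t = z then H t i j else H t j i) := by
    intro i j
    refine mul_nonneg (h0 _ _ _) ?_
    split_ifs <;> exact h0 _ _ _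
  calc _ ≤ ∑ j, ∑ i, H s i j * (if a t = z then H t i j else H t j i) := by
        refine (sum_le_sum_of_subset_of_nonneg (subset_univ _) fun _ _ _ => sum_nonneg fun _ _ => hnn _ _).trans ?_
        exact sum_le_sum fun j _ => sum_le_sum_of_subset_of_nonneg (subset_univ _) fun _ _ _ => hnn _ _
    _ ≤ ∑ j, ∑ i, (H s i j ^ 2 / 2 + (if a t = z then H t i j else H t j i) ^ 2 / 2) := by
        refine sum_le_sum fun j _ => sum_le_sum fun i _ => ?_
        nlinarith [sq_nonneg (H s i j - (if a t = z then H t i j else H t j i))]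
    _ ≤ B / 2 + B / 2 := by
        simp_rw [sum_add_distrib, ← sum_div]
        refine add_le_add ?_ ?_
        · rw [sum_comm]; linarith [hB s]
        · split_ifs
          · rw [sum_comm]; linarith [hB t]
          · linarith [hB t]
    _ = B := by ring

/-- Labels are added one by one, each linked to a label already present, starting from the seeds
`Z0`. -/
lemma labelSum_le_of_cross [Fintype X] {lam : ℝ} (hlam : 0 ≤ lam) (hr : ∀ t i, ∑ j, H t i j ≤ lam)
    (hc : ∀ t j, ∑ i, H t i j ≤ lam) (Zf Z0 : Finset α) (hZ : Z0 ⊆ Zf)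
    (hcross : ∀ Z, Z0 ⊆ Z → Z ⊂ Zf → ∃ t ∈ T, ∃ u ∈ Z, ∃ z ∈ Zf, z ∉ Z ∧
      ((a t = z ∧ b t = u) ∨ (a t = u ∧ b t = z))) :
    labelSum R pt T a b H Zf ≤ lam ^ (#Zf - #Z0) * labelSum R pt T a b H Z0 := by
  have main : ∀ m, m ≤ #Zf - #Z0 → ∃ Z, Z0 ⊆ Z ∧ Z ⊆ Zf ∧ #Z = #Z0 + m ∧
      labelSum R pt T a b H Z ≤ lam ^ m * labelSum R pt T a b H Z0 := by
    intro m
    induction m with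
    | zero => intro _; exact ⟨Z0, Subset.rfl, hZ, rfl, by simp⟩
    | succ m ih =>
      intro hm
      obtain ⟨Z, e1, e2, e3, e4⟩ := ih (by omega)
      have hss : Z ⊂ Zf := by
        refine e2.ssubset_of_ne fun h => ?_
        rw [h] at e3; omega
      obtain ⟨t, ht, u, hu, z, hzf, hz, hab⟩ := hcross Z e1 hss
      refine ⟨insert z Z, e1.trans (subset_insert _ _), insert_subset hzf e2, ?_, ?_⟩
      · rw [card_insert_of_notMem hz]; omega
      · refine (labelSum_insert_le_mul h0 h1 hr hc hz hu ht hab).trans ?_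
        rw [pow_succ', mul_assoc]
        exact mul_le_mul_of_nonneg_left e4 hlam
  have hcard := card_le_card hZ
  obtain ⟨Z, _, e2, e3, e4⟩ := main _ le_rfl
  rwa [eq_of_subset_of_card_le e2 (by omega)] at e4

omit h0 h1 in
lemma labelSum_biUnion_le [DecidableEq κ] (𝒦 : Finset κ) (seed : κ → Finset α) (m : κ → ℝ)
    (hm : ∀ K ∈ 𝒦, 0 ≤ m K)
    (hdis : ∀ K ∈ 𝒦, ∀ K' ∈ 𝒦, K ≠ K' → Disjoint (seed K) (seed K'))
    (hs : ∀ K ∈ 𝒦, ∀ Z, Disjoint (seed K) Z →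
      labelSum R pt T a b H (seed K ∪ Z) ≤ m K * labelSum R pt T a b H Z) :
    labelSum R pt T a b H (𝒦.biUnion seed) ≤ ∏ K ∈ 𝒦, m K := by
  induction 𝒦 using Finset.induction_on with
  | empty => simp [labelSum_empty]
  | insert K 𝒦 hK ih =>
    rw [biUnion_insert, prod_insert hK]
    refine (hs K (by simp) _ ?_).trans (mul_le_mul_of_nonneg_left ?_ (hm K (by simp)))
    · rw [disjoint_biUnion_right]
      intro K' hK'
      exact hdis K (by simp) K' (by simp [hK']) fun h => hK (h ▸ hK')
    · exact ih (fun K' h => hm K' (by simp [h])) (fun K' h K'' h' => hdis K' (by simp [h]) K'' (by simp [h']))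
        (fun K' h => hs K' (by simp [h]))

end bounds
end labelSum

/-! ### From sums over walks to sums over labels. -/

section walk
variable {n : ℕ}

/-- The weight of the link between the steps `t` and `t+1` of a walk. -/
def lk (K : Matrix (Fin n) (Fin n) ℝ) (o : ℕ → Bool) (w : ℕ → Fin n × Fin n) (t : ℕ) : ℝ :=
  if o t = o (t + 1) then (if o t then K (w t).2 (w (t + 1)).1 else K (w (t + 1)).2 (w t).1) else 1

/-- The kernel `K` or its transpose, according to the direction of a step. -/
def lkKer (K : Matrix (Fin n) (Fin n) ℝ) (o : ℕ → Bool) (t : ℕ) (i j : Fin n) : ℝ :=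
  if o t then K i j else K j i

/-- The links between consecutive steps of the same direction. -/
def sameLinks (o : ℕ → Bool) (N : ℕ) : Finset ℕ := {t ∈ range (N - 1) | o t = o (t + 1)}

open Classical in
/-- The values at the labels of `w₀` of a walk `w` with the same coincidences. -/
def valuation (N : ℕ) (pt : Fin n) (w₀ w : ℕ → Fin n × Fin n) : Fin n ⊕ Fin n → Fin n :=
  Sum.elim (fun x => if h : ∃ t < N, (w₀ t).1 = x then (w h.choose).1 else pt)
    (fun y => if h : ∃ t < N, (w₀ t).2 = y then (w h.choose).2 else pt)

variable {o : ℕ → Bool} {w w₀ : ℕ → Fin n × Fin n} {N : ℕ} {K : Matrix (Fin n) (Fin n) ℝ} {pt : Fin n}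

lemma valuation_inl (h : SameKernel N w w₀) {t : ℕ} (ht : t < N) :
    valuation N pt w₀ w (Sum.inl (w₀ t).1) = (w t).1 := by
  have hex : ∃ s < N, (w₀ s).1 = (w₀ t).1 := ⟨t, ht, rfl⟩
  simp only [valuation, Sum.elim_inl, dif_pos hex]
  exact (h _ hex.choose_spec.1 t ht).1.2 hex.choose_spec.2

lemma valuation_inr (h : SameKernel N w w₀) {t : ℕ} (ht : t < N) :
    valuation N pt w₀ w (Sum.inr (w₀ t).2) = (w t).2 := by
  have hex : ∃ s < N, (w₀ s).2 = (w₀ t).2 := ⟨t, ht, rfl⟩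
  simp only [valuation, Sum.elim_inr, dif_pos hex]
  exact (h _ hex.choose_spec.1 t ht).2.2 hex.choose_spec.2

lemma valuation_of_notMem {z : Fin n ⊕ Fin n} (hz : z ∉ labels o w₀ N) :
    valuation N pt w₀ w z = pt := by
  rw [labels_eq_disjSum] at hz
  rcases z with x | y
  · rw [inl_mem_disjSum] at hz
    have : ¬ ∃ t < N, (w₀ t).1 = x := fun ⟨t, ht, he⟩ =>
      hz (mem_image.2 ⟨w₀ t, mem_image_of_mem _ (mem_range.2 ht), he⟩)
    simp only [valuation, Sum.elim_inl, dif_neg this]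
  · rw [inr_mem_disjSum] at hz
    have : ¬ ∃ t < N, (w₀ t).2 = y := fun ⟨t, ht, he⟩ =>
      hz (mem_image.2 ⟨w₀ t, mem_image_of_mem _ (mem_range.2 ht), he⟩)
    simp only [valuation, Sum.elim_inr, dif_neg this]

lemma lk_eq_lkKer (h : SameKernel N w w₀) {t : ℕ} (ht : t ∈ sameLinks o N) :
    lk K o w t = lkKer K o t (valuation N pt w₀ w (hd o w₀ t)) (valuation N pt w₀ w (tl o w₀ (t + 1))) := by
  obtain ⟨h1, h2⟩ := mem_filter.1 ht
  rw [mem_range] at h1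
  have a1 : t < N := by omega
  have a2 : t + 1 < N := by omega
  unfold lk lkKer hd tl
  rw [if_pos h2, ← h2]
  split_ifs
  · rw [valuation_inl h a2, valuation_inr h a1]
  · rw [valuation_inl h a1, valuation_inr h a2]

lemma prod_lk_eq (h : SameKernel N w w₀) :
    ∏ t ∈ range (N - 1), lk K o w t = ∏ t ∈ inner (sameLinks o N) (hd o w₀) (fun t => tl o w₀ (t + 1)) (labels o w₀ N),
      lkKer K o t (valuation N pt w₀ w (hd o w₀ t)) (valuation N pt w₀ w (tl o w₀ (t + 1))) := by
  have h1 : inner (sameLinks o N) (hd o w₀) (fun t => tl o w₀ (t + 1)) (labels o w₀ N) = sameLinks o N := by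
    apply filter_true_of_mem
    intro t ht
    have := mem_range.1 (mem_filter.1 ht).1
    exact ⟨hd_mem_labels (by omega), tl_mem_labels (by omega)⟩
  rw [h1, sameLinks, prod_filter]
  refine prod_congr rfl fun t ht => ?_
  split_ifs with ho
  · exact lk_eq_lkKer h (mem_filter.2 ⟨ht, ho⟩)
  · rw [lk, if_neg ho]

/-- A sum over walks with given coincidences is at most a sum over assignments of labels. -/
lemma sum_prod_lk_le_labelSum {ι : Type*} (hK : ∀ i j, 0 ≤ K i j) (Ω : Finset ι)
    (wk : ι → ℕ → Fin n × Fin n) (hinj : ∀ ω ∈ Ω, ∀ ω' ∈ Ω, (∀ t < N, wk ω t = wk ω' t) → ω = ω')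
    (hsame : ∀ ω ∈ Ω, SameKernel N (wk ω) w₀) (R : Fin n ⊕ Fin n → Finset (Fin n))
    (hR : ∀ ω ∈ Ω, ∀ z ∈ labels o w₀ N, valuation N pt w₀ (wk ω) z ∈ R z) :
    ∑ ω ∈ Ω, ∏ t ∈ range (N - 1), lk K o (wk ω) t ≤
      labelSum R pt (sameLinks o N) (hd o w₀) (fun t => tl o w₀ (t + 1)) (lkKer K o) (labels o w₀ N) := by
  classical
  unfold labelSum
  have hi : Set.InjOn (fun ω => valuation N pt w₀ (wk ω)) Ω := by
    intro ω hω ω' hω' he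
    refine hinj ω hω ω' hω' fun t ht => ?_
    have e1 := congrFun he (Sum.inl (w₀ t).1)
    have e2 := congrFun he (Sum.inr (w₀ t).2)
    simp only [valuation_inl (hsame ω hω) ht, valuation_inl (hsame ω' hω') ht] at e1
    simp only [valuation_inr (hsame ω hω) ht, valuation_inr (hsame ω' hω') ht] at e2
    exact Prod.ext e1 e2
  rw [sum_congr rfl fun ω hω => prod_lk_eq (K := K) (pt := pt) (o := o) (hsame ω hω)]
  rw [← sum_image (f := fun φ => ∏ t ∈ inner (sameLinks o N) (hd o w₀) (fun t => tl o w₀ (t + 1)) (labels o w₀ N),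
      lkKer K o t (φ (hd o w₀ t)) (φ (tl o w₀ (t + 1)))) hi]
  refine sum_le_sum_of_subset_of_nonneg ?_ fun _ _ _ => prod_nonneg fun t _ => ?_
  · intro φ hφ
    obtain ⟨ω, hω, rfl⟩ := mem_image.1 hφ
    refine Fintype.mem_piFinset.2 fun z => ?_
    split_ifs with hz
    · exact hR ω hω z hz
    · rw [mem_singleton]; exact valuation_of_notMem hz
  · unfold lkKer; split_ifs <;> exact hK _ _

/-- If no link crossed the boundary of `Z`, membership in `Z` would be constant on classes of
labels, yet every class meets `Z0`. Links at changes of direction join a label to itself, so they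
never cross. -/
lemma exists_cross (hchg : ∀ t, t + 1 < N → o t ≠ o (t + 1) → hd o w t = tl o w (t + 1))
    {Z0 : Finset (Fin n ⊕ Fin n)}
    (hmeet : ∀ z ∈ labels o w N, ∃ u ∈ Z0, comp o w N u = comp o w N z)
    (Z : Finset (Fin n ⊕ Fin n)) (h0 : Z0 ⊆ Z) (h1 : Z ⊂ labels o w N) :
    ∃ t ∈ sameLinks o N, ∃ u ∈ Z, ∃ z ∈ labels o w N, z ∉ Z ∧
      ((hd o w t = z ∧ tl o w (t + 1) = u) ∨ (hd o w t = u ∧ tl o w (t + 1) = z)) := by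
  by_contra hno
  push Not at hno
  have hrel : ∀ a b, linkRel o w N a b → (a ∈ Z) = (b ∈ Z) := by
    rintro _ _ ⟨t, ht, rfl, rfl⟩
    by_cases ho : o t = o (t + 1)
    · have hmem : t ∈ sameLinks o N := mem_filter.2 ⟨mem_range.2 (by omega), ho⟩
      refine propext ⟨fun h => ?_, fun h => ?_⟩
      · by_contra h'
        exact (hno t hmem _ h _ (tl_mem_labels ht) h').2 rfl rfl
      · by_contra h'
        exact (hno t hmem _ h _ (hd_mem_labels (by omega)) h').1 rfl rfl
    · rw [hchg t ht ho]
  obtain ⟨z, hz, hzZ⟩ := exists_of_ssubset h1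
  obtain ⟨u, hu, he⟩ := hmeet z hz
  have := congrArg (Quot.lift (· ∈ Z) hrel) he
  exact hzZ (this.mp (h0 hu))

end walk

/-! ### Walks with prescribed coincidences: second and first moment bounds. -/

section fiber
variable {n : ℕ} {o : ℕ → Bool} {w w₀ : ℕ → Fin n × Fin n} {N S : ℕ} {K : Matrix (Fin n) (Fin n) ℝ}

lemma lkKer_bounds (hK : ∀ i j, 0 ≤ K i j) (hK1 : ∀ i j, K i j ≤ 1) (t : ℕ) (i j : Fin n) :
    0 ≤ lkKer K o t i j ∧ lkKer K o t i j ≤ 1 := by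
  unfold lkKer; split_ifs
  · exact ⟨hK _ _, hK1 _ _⟩
  · exact ⟨hK _ _, hK1 _ _⟩

lemma sum_lkKer_le {lam : ℝ} (hr : ∀ i, ∑ j, K i j ≤ lam) (hc : ∀ j, ∑ i, K i j ≤ lam) :
    (∀ t i, ∑ j, lkKer K o t i j ≤ lam) ∧ (∀ t j, ∑ i, lkKer K o t i j ≤ lam) := by
  constructor <;> intro t i <;> unfold lkKer <;> split_ifs
  · exact hr i
  · exact hc i
  · exact hc i
  · exact hr i

lemma disjoint_of_comp {seed : Quot (linkRel o w N) → Finset (Fin n ⊕ Fin n)}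
    {𝒦 : Finset (Quot (linkRel o w N))}
    (h : ∀ C ∈ 𝒦, ∀ z ∈ seed C, comp o w N z = C) :
    ∀ C ∈ 𝒦, ∀ C' ∈ 𝒦, C ≠ C' → Disjoint (seed C) (seed C') := by
  intro C hC C' hC' hne
  rw [disjoint_left]
  intro z hz hz'
  exact hne ((h C hC z hz).symm.trans (h C' hC' z hz'))

open Classical in
/-- The sum over walks with given coincidences, for a kernel bounded in Hilbert-Schmidt norm. -/
lemma sum_prod_lk_le {ι : Type*} {lam : ℝ} (hlam : 0 ≤ lam) (hK : ∀ i j, 0 ≤ K i j) (hK1 : ∀ i j, K i j ≤ 1)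
    (hr : ∀ i, ∑ j, K i j ≤ lam) (hc : ∀ j, ∑ i, K i j ≤ lam) (hHS : ∑ i, ∑ j, K i j ^ 2 ≤ n)
    (hN : 0 < N) (hchg : ∀ t, t + 1 < N → o t ≠ o (t + 1) → hd o w₀ t = tl o w₀ (t + 1))
    (Ω : Finset ι) (wk : ι → ℕ → Fin n × Fin n)
    (hinj : ∀ ω ∈ Ω, ∀ ω' ∈ Ω, (∀ t < N, wk ω t = wk ω' t) → ω = ω')
    (hsame : ∀ ω ∈ Ω, SameKernel N (wk ω) w₀) :
    ∑ ω ∈ Ω, ∏ t ∈ range (N - 1), lk K o (wk ω) t ≤ (n : ℝ) ^ #(comps o w₀ N) *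
      lam ^ (#(labels o w₀ N) - (#(comps o w₀ N) + #{C ∈ comps o w₀ N | DoubledComp o w₀ N C})) := by
  set pt := (w₀ 0).1
  refine (sum_prod_lk_le_labelSum (pt := pt) hK Ω wk hinj hsame (fun _ => univ)
    (fun _ _ _ _ => mem_univ _)).trans ?_
  set T := sameLinks o N
  set LS := labelSum (fun _ => univ) pt T (hd o w₀) (fun t => tl o w₀ (t + 1)) (lkKer K o)
  have hb := lkKer_bounds (o := o) hK hK1
  obtain ⟨hr', hc'⟩ := sum_lkKer_le (o := o) hr hc
  have hHS' : ∀ t, ∑ i, ∑ j, lkKer K o t i j ^ 2 ≤ n := by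
    intro t; unfold lkKer; split_ifs
    · exact hHS
    · rw [sum_comm]; exact hHS
  have hseed : ∀ C ∈ comps o w₀ N, ∃ s : Finset (Fin n ⊕ Fin n), s ⊆ labels o w₀ N ∧
      (∀ z ∈ s, comp o w₀ N z = C) ∧ #s = 1 + (if DoubledComp o w₀ N C then 1 else 0) ∧
      ∀ Z, Disjoint s Z → LS (s ∪ Z) ≤ n * LS Z := by
    intro C hC
    -- A doubled class is seeded with both ends of its doubled link, at the price n of a
    -- Hilbert-Schmidt sum; any other class with a single free label.
    by_cases hdb : DoubledComp o w₀ N C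
    · obtain ⟨s, t, hst, ht, hos, hot, hCs, hcase⟩ := hdb
      refine ⟨{hd o w₀ s, tl o w₀ (s + 1)}, ?_, ?_, ?_, ?_⟩
      · intro z hz
        rw [mem_insert, mem_singleton] at hz
        rcases hz with rfl | rfl
        · exact hd_mem_labels (by omega)
        · exact tl_mem_labels (by omega)
      · intro z hz
        rw [mem_insert, mem_singleton] at hz
        rcases hz with rfl | rfl
        · exact hCs
        · rw [← vtx_eq_comp_tl (by omega)]; exact hCs
      · rw [card_pair (hd_ne_tl_succ hos), if_pos ⟨s, t, hst, ht, hos, hot, hCs, hcase⟩]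
      · intro Z hZ
        rw [disjoint_insert_left, disjoint_singleton_left] at hZ
        rw [insert_union, singleton_union]
        refine labelSum_insert_insert_le_mul (fun t i j => (hb t i j).1) (fun t i j => (hb t i j).2) hHS'
          hZ.2 ?_ hst.ne (mem_filter.2 ⟨mem_range.2 (by omega), hos⟩)
          (mem_filter.2 ⟨mem_range.2 (by omega), hot⟩) ⟨rfl, rfl⟩ ?_
        · rw [mem_insert]; push Not; exact ⟨hd_ne_tl_succ hos, hZ.1⟩
        · rcases hcase with ⟨x, y⟩ | ⟨x, y⟩
          · exact Or.inl ⟨x.symm, y.symm⟩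
          · exact Or.inr ⟨y.symm, x.symm⟩
    · obtain ⟨z, hz⟩ := card_pos.1 (one_le_cnt hN hC)
      obtain ⟨hz1, hz2⟩ := mem_filter.1 hz
      refine ⟨{z}, by simpa using hz1, by simpa using hz2, by simp [hdb], ?_⟩
      intro Z hZ
      rw [disjoint_singleton_left] at hZ
      rw [singleton_union]
      simpa using labelSum_insert_le_card_mul (R := fun _ => univ) (pt := pt) (T := T) (a := hd o w₀)
        (b := fun t => tl o w₀ (t + 1)) (fun t i j => (hb t i j).1) (fun t i j => (hb t i j).2) hZ
  choose! seed h1 h2 h3 h4 using hseed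
  have hdis := disjoint_of_comp h2
  have hsub : (comps o w₀ N).biUnion seed ⊆ labels o w₀ N := biUnion_subset.2 h1
  have hcard : #((comps o w₀ N).biUnion seed) =
      #(comps o w₀ N) + #{C ∈ comps o w₀ N | DoubledComp o w₀ N C} := by
    rw [card_biUnion hdis, sum_congr rfl h3, sum_add_distrib, card_filter]
    simp
  have hmeet : ∀ z ∈ labels o w₀ N, ∃ u ∈ (comps o w₀ N).biUnion seed, comp o w₀ N u = comp o w₀ N z := by
    intro z hz
    have hC := comp_mem_comps hz
    obtain ⟨u, hu⟩ : (seed (comp o w₀ N z)).Nonempty := by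
      rw [← card_pos, h3 _ hC]; omega
    exact ⟨u, mem_biUnion.2 ⟨_, hC, hu⟩, h2 _ hC u hu⟩
  have g1 := labelSum_le_of_cross (R := fun _ => univ) (pt := pt) (fun t i j => (hb t i j).1)
    (fun t i j => (hb t i j).2) hlam hr' hc' _ _ hsub (exists_cross hchg hmeet)
  have g2 := labelSum_biUnion_le (R := fun _ => univ) (pt := pt) (T := T) (a := hd o w₀)
    (b := fun t => tl o w₀ (t + 1)) (H := lkKer K o) (comps o w₀ N) seed (fun _ => (n : ℝ))
    (fun _ _ => by positivity) hdis h4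
  rw [prod_const] at g2
  refine g1.trans ?_
  rw [hcard, mul_comm]
  exact mul_le_mul_of_nonneg_right g2 (by positivity)

open Classical in
/-- The sum over walks with given coincidences which visit a set `E` at marked times. -/
lemma sum_prod_lk_le_of_marks {ι : Type*} (hK : ∀ i j, 0 ≤ K i j) (hK1 : ∀ i j, K i j ≤ 1)
    (hr : ∀ i, ∑ j, K i j ≤ 1) (hc : ∀ j, ∑ i, K i j ≤ 1)
    (hN : 0 < N) (hchg : ∀ t, t + 1 < N → o t ≠ o (t + 1) → hd o w₀ t = tl o w₀ (t + 1))
    (Ω : Finset ι) (wk : ι → ℕ → Fin n × Fin n)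
    (hinj : ∀ ω ∈ Ω, ∀ ω' ∈ Ω, (∀ t < N, wk ω t = wk ω' t) → ω = ω')
    (hsame : ∀ ω ∈ Ω, SameKernel N (wk ω) w₀) (E : Finset (Fin n)) (T₀ : Finset ℕ) (hT₀ : ∀ t ∈ T₀, t < N)
    (hT₀inj : Set.InjOn (fun t => comp o w₀ N (Sum.inl (w₀ t).1)) T₀)
    (hE : ∀ ω ∈ Ω, ∀ t ∈ T₀, (wk ω t).1 ∈ E) :
    ∑ ω ∈ Ω, ∏ t ∈ range (N - 1), lk K o (wk ω) t ≤
      (n : ℝ) ^ (#(comps o w₀ N) - #T₀) * #E ^ #T₀ := by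
  set pt := (w₀ 0).1
  set R : Fin n ⊕ Fin n → Finset (Fin n) := fun z => if ∃ t ∈ T₀, Sum.inl (w₀ t).1 = z then E else univ
    with hR
  refine (sum_prod_lk_le_labelSum (pt := pt) hK Ω wk hinj hsame R ?_).trans ?_
  · intro ω hω z _
    simp only [hR]
    split_ifs with h
    · obtain ⟨t, ht, rfl⟩ := h
      rw [valuation_inl (hsame ω hω) (hT₀ t ht)]
      exact hE ω hω t ht
    · exact mem_univ _
  set T := sameLinks o N
  set LS := labelSum R pt T (hd o w₀) (fun t => tl o w₀ (t + 1)) (lkKer K o)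
  have hb := lkKer_bounds (o := o) hK hK1
  obtain ⟨hr', hc'⟩ := sum_lkKer_le (o := o) hr hc
  set mk := T₀.image (fun t => comp o w₀ N (Sum.inl (w₀ t).1)) with hmk
  have hlab : ∀ t < N, Sum.inl (w₀ t).1 ∈ labels o w₀ N := by
    intro t ht
    rw [labels_eq_disjSum, inl_mem_disjSum]
    exact mem_image_of_mem _ (mem_image_of_mem _ (mem_range.2 ht))
  -- A marked class is seeded with its marked label, which has only `#E` possible values.
  have hseed : ∀ C ∈ comps o w₀ N, ∃ z ∈ labels o w₀ N, comp o w₀ N z = C ∧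
      (#(R z) : ℝ) ≤ if C ∈ mk then (#E : ℝ) else n := by
    intro C hC
    by_cases hCm : C ∈ mk
    · obtain ⟨t, ht, rfl⟩ := mem_image.1 hCm
      refine ⟨_, hlab t (hT₀ t ht), rfl, ?_⟩
      rw [if_pos hCm]
      simp only [hR]
      rw [if_pos ⟨t, ht, rfl⟩]
    · obtain ⟨z, hz⟩ := card_pos.1 (one_le_cnt hN hC)
      obtain ⟨hz1, hz2⟩ := mem_filter.1 hz
      refine ⟨z, hz1, hz2, ?_⟩
      rw [if_neg hCm]
      exact_mod_cast (card_le_univ _).trans (Fintype.card_fin n).le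
  have : Nonempty (Fin n ⊕ Fin n) := ⟨Sum.inl pt⟩
  choose! sd h1 h2 h3 using hseed
  have h2' : ∀ C ∈ comps o w₀ N, ∀ z ∈ ({sd C} : Finset _), comp o w₀ N z = C := by
    intro C hC z hz
    rw [mem_singleton.1 hz]; exact h2 C hC
  have hdis := disjoint_of_comp h2'
  have hsub : (comps o w₀ N).biUnion (fun C => {sd C}) ⊆ labels o w₀ N :=
    biUnion_subset.2 fun C hC => singleton_subset_iff.2 (h1 C hC)
  have hmeet : ∀ z ∈ labels o w₀ N, ∃ u ∈ (comps o w₀ N).biUnion (fun C => {sd C}),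
      comp o w₀ N u = comp o w₀ N z := by
    intro z hz
    have hC := comp_mem_comps hz
    exact ⟨sd (comp o w₀ N z), mem_biUnion.2 ⟨_, hC, by simp⟩, h2 _ hC⟩
  have g1 := labelSum_le_of_cross (R := R) (pt := pt) (fun t i j => (hb t i j).1)
    (fun t i j => (hb t i j).2) zero_le_one hr' hc' _ _ hsub (exists_cross hchg hmeet)
  have g2 := labelSum_biUnion_le (R := R) (pt := pt) (T := T) (a := hd o w₀)
    (b := fun t => tl o w₀ (t + 1)) (H := lkKer K o) (comps o w₀ N) (fun C => {sd C})
    (fun C => if C ∈ mk then (#E : ℝ) else n) (fun _ _ => by split_ifs <;> positivity) hdis (by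
      intro C hC Z hZ
      rw [disjoint_singleton_left] at hZ
      rw [singleton_union]
      refine (labelSum_insert_le_card_mul (R := R) (pt := pt) (T := T) (a := hd o w₀)
        (b := fun t => tl o w₀ (t + 1)) (fun t i j => (hb t i j).1) (fun t i j => (hb t i j).2) hZ).trans ?_
      exact mul_le_mul_of_nonneg_right (h3 C hC) (labelSum_nonneg fun t i j => (hb t i j).1))
  rw [one_pow, one_mul] at g1
  refine (g1.trans g2).trans (le_of_eq ?_)
  have hmkc : #mk = #T₀ := card_image_of_injOn hT₀inj
  have hmks : mk ⊆ comps o w₀ N := by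
    intro C hC
    obtain ⟨t, ht, rfl⟩ := mem_image.1 hC
    exact comp_mem_comps (hlab t (hT₀ t ht))
  have e1 : {C ∈ comps o w₀ N | C ∈ mk} = mk := by
    ext C; rw [mem_filter]; exact ⟨fun h => h.2, fun h => ⟨hmks h, h⟩⟩
  have e2 : #{C ∈ comps o w₀ N | ¬ C ∈ mk} = #(comps o w₀ N) - #T₀ := by
    have := card_filter_add_card_filter_not (s := comps o w₀ N) (fun C => C ∈ mk)
    rw [e1, hmkc] at this
    omega
  rw [prod_ite, prod_const, prod_const, e1, hmkc, e2, mul_comm]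

/-- The times at which a walk uses labels never used at other times. -/
def isoTimes (w : ℕ → Fin n × Fin n) (N : ℕ) : Finset ℕ :=
  {t ∈ range N | ∀ s ∈ range N, s ≠ t → (w s).1 ≠ (w t).1 ∧ (w s).2 ≠ (w t).2}

lemma injOn_isoTimes : Set.InjOn w (isoTimes w N) := by
  intro s hs t ht h
  by_contra hne
  have h1 := (mem_filter.1 (mem_coe.1 hs)).1
  exact ((mem_filter.1 (mem_coe.1 ht)).2 s h1 hne).1 (by rw [h])

lemma card_image_le_of_iff {α β : Type*} [DecidableEq α] [DecidableEq β] {f : ℕ → α} {g : ℕ → β}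
    (h : ∀ s < N, ∀ t < N, f s = f t ↔ g s = g t) : #((range N).image g) ≤ #((range N).image f) := by
  apply card_le_card_of_surjOn (fun x => g (sInf {t | t < N ∧ f t = x}))
  intro y hy
  obtain ⟨t, ht, rfl⟩ := mem_image.1 (mem_coe.1 hy)
  rw [mem_range] at ht
  refine ⟨f t, mem_coe.2 (mem_image_of_mem _ (mem_range.2 ht)), ?_⟩
  have := Nat.sInf_mem (s := {s | s < N ∧ f s = f t}) ⟨t, ht, rfl⟩
  exact (h _ this.1 t ht).1 this.2

lemma card_image_eq_of_iff {α β : Type*} [DecidableEq α] [DecidableEq β] {f : ℕ → α} {g : ℕ → β}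
    (h : ∀ s < N, ∀ t < N, f s = f t ↔ g s = g t) : #((range N).image f) = #((range N).image g) :=
  le_antisymm (card_image_le_of_iff fun s hs t ht => (h s hs t ht).symm) (card_image_le_of_iff h)

lemma SameKernel.card_pairs_eq (h : SameKernel N w w₀) : #(pairs w N) = #(pairs w₀ N) := by
  refine card_image_eq_of_iff fun s hs t ht => ?_
  rw [Prod.ext_iff, Prod.ext_iff, (h s hs t ht).1, (h s hs t ht).2]

lemma SameKernel.card_labels_eq (h : SameKernel N w w₀) : #(labels o w N) = #(labels o w₀ N) := by
  rw [card_labels, card_labels]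
  unfold pairs
  rw [image_image, image_image, image_image, image_image]
  exact congrArg₂ _ (card_image_eq_of_iff fun s hs t ht => (h s hs t ht).1)
    (card_image_eq_of_iff fun s hs t ht => (h s hs t ht).2)

lemma SameKernel.isoTimes_eq (h : SameKernel N w w₀) : isoTimes w N = isoTimes w₀ N := by
  unfold isoTimes
  refine filter_congr fun t ht => forall₂_congr fun s hs => ?_
  rw [mem_range] at ht hs
  rw [ne_eq, ne_eq, ne_eq, ne_eq, (h s hs t ht).1, (h s hs t ht).2]

/-- A pair used once at a time that is not isolated shares a coordinate with another pair;
`card_not_separated_le` is applied to each coordinate. -/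
lemma card_singles_sdiff_le :
    #(singles w N \ (isoTimes w N).image w) + 2 * #(labels o w N) ≤ 4 * #(pairs w N) := by
  have h1 := card_not_separated_le (pairs w N) Prod.fst
  have h2 := card_not_separated_le (pairs w N) Prod.snd
  have hsub : singles w N \ (isoTimes w N).image w ⊆
      {p ∈ pairs w N | ∃ q ∈ pairs w N, q ≠ p ∧ q.1 = p.1} ∪
      {p ∈ pairs w N | ∃ q ∈ pairs w N, q ≠ p ∧ q.2 = p.2} := by
    intro p hp
    obtain ⟨hp1, hp2⟩ := mem_sdiff.1 hp
    obtain ⟨hpp, hc⟩ := mem_filter.1 hp1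
    rw [mem_union, mem_filter, mem_filter]
    by_contra hno
    push Not at hno
    obtain ⟨t, ht⟩ := card_eq_one.1 hc
    have htm : t ∈ {t ∈ range N | w t = p} := by rw [ht]; simp
    obtain ⟨htN, rfl⟩ := mem_filter.1 htm
    refine hp2 (mem_image_of_mem _ (mem_filter.2 ⟨htN, fun s hs hst => ?_⟩))
    have hne : w s ≠ w t := by
      intro he
      have : s ∈ {u ∈ range N | w u = w t} := mem_filter.2 ⟨hs, he⟩
      rw [ht, mem_singleton] at this
      exact hst this
    exact ⟨hno.1 hpp _ (mem_image_of_mem _ hs) hne, hno.2 hpp _ (mem_image_of_mem _ hs) hne⟩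
  have h3 := (card_le_card hsub).trans (card_union_le _ _)
  have h4 := card_labels (o := o) (w := w) (N := N)
  omega

lemma card_singles_le : #(singles w N) + 2 * #(labels o w N) ≤ #(isoTimes w N) + 4 * #(pairs w N) := by
  have h1 := card_singles_sdiff_le (o := o) (w := w) (N := N)
  have h2 := card_le_card_sdiff_add_card (s := singles w N) (t := (isoTimes w N).image w)
  have h3 : #((isoTimes w N).image w) ≤ #(isoTimes w N) := card_image_le
  omega

/-- Equal factors are collected; the isolated times give the set `U` of
`abs_permAvg_prod_cen_pow_le`, and the remaining pairs used once give `B`. -/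
lemma abs_permAvg_prod_cen_le (hN : 0 < N) (hNn : 2 * N ^ 2 ≤ n) :
    |permAvg (fun σ => ∏ t ∈ range N, cen σ (w t))| ≤
      4 * 2 ^ (#(singles w N \ (isoTimes w N).image w)) * (1 / n) ^ #(pairs w N) *
        (2 * N / √n) ^ #(isoTimes w N) := by
  have e : ∀ σ : Equiv.Perm (Fin n), ∏ t ∈ range N, cen σ (w t) =
      ∏ p ∈ pairs w N, cen σ p ^ #{t ∈ range N | w t = p} := fun σ => prod_comp (cen σ) w
  simp_rw [e]
  rw [← card_image_of_injOn (injOn_isoTimes (w := w) (N := N))]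
  refine abs_permAvg_prod_cen_pow_le hN hNn (pairs w N) _ _ _ ?_ ?_ ?_ ?_
  · intro p hp
    obtain ⟨t, ht, rfl⟩ := mem_image.1 hp
    exact card_pos.2 ⟨t, mem_filter.2 ⟨ht, rfl⟩⟩
  · exact card_image_le.trans (card_range N).le
  · intro p hp
    obtain ⟨t, ht, rfl⟩ := mem_image.1 hp
    obtain ⟨htN, hiso⟩ := mem_filter.1 ht
    refine ⟨mem_image_of_mem _ htN, ?_, ?_⟩
    · rw [card_eq_one]
      refine ⟨t, ?_⟩
      ext s
      rw [mem_filter, mem_singleton]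
      constructor
      · rintro ⟨hs, he⟩
        by_contra hne
        exact (hiso s hs hne).1 (by rw [he])
      · rintro rfl; exact ⟨htN, rfl⟩
    · intro q hq hne
      obtain ⟨s, hs, rfl⟩ := mem_image.1 hq
      exact hiso s hs fun h => hne (by rw [h])
  · intro p hp hpU hk
    exact mem_sdiff.2 ⟨mem_filter.2 ⟨hp, hk⟩, hpU⟩

/-- The contribution to the trace of the tame walks with given coincidences. -/
lemma sum_abs_permAvg_mul_prod_lk_le {ι : Type*} {D : PieceData} {lam : ℝ} (hlam : 1 ≤ lam)
    (hK : ∀ i j, 0 ≤ K i j) (hK1 : ∀ i j, K i j ≤ 1)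
    (hr : ∀ i, ∑ j, K i j ≤ lam) (hc : ∀ j, ∑ i, K i j ≤ lam) (hHS : ∑ i, ∑ j, K i j ^ 2 ≤ n)
    (hN : 0 < N) (hchg : ∀ t, t + 1 < N → o t ≠ o (t + 1) → hd o w₀ t = tl o w₀ (t + 1))
    (hD : TamePieces N S w₀ o D) (hNl : 2 * N * lam ≤ √n)
    (Ω : Finset ι) (wk : ι → ℕ → Fin n × Fin n)
    (hinj : ∀ ω ∈ Ω, ∀ ω' ∈ Ω, (∀ t < N, wk ω t = wk ω' t) → ω = ω')
    (hsame : ∀ ω ∈ Ω, SameKernel N (wk ω) w₀) :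
    ∑ ω ∈ Ω, |permAvg (fun σ => ∏ t ∈ range N, cen σ (wk ω t))| * ∏ t ∈ range (N - 1), lk K o (wk ω) t ≤
      4 * n * (2 * lam) ^ (4 * genus (vtx o w₀ N) w₀ N + 2 * S) * (1 / n) ^ genus (vtx o w₀ N) w₀ N := by
  classical
  set g := genus (vtx o w₀ N) w₀ N with hg
  have hN' : (0 : ℝ) < N := by exact_mod_cast hN
  have hsq : (0 : ℝ) < √n := lt_of_lt_of_le (by positivity) hNl
  have hn : (0 : ℝ) < n := Real.sqrt_pos.1 hsq
  have hNn : 2 * N ^ 2 ≤ n := by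
    have h1 : 2 * (N : ℝ) ≤ √n := by nlinarith
    have h2 : (2 * (N : ℝ)) ^ 2 ≤ n := by
      rw [← Real.sq_sqrt hn.le]; gcongr
    have : (2 : ℝ) * N ^ 2 ≤ n := by nlinarith
    exact_mod_cast this
  have i1 := three_mul_card_comps_le hD hN
  have i2 := card_singles_le (o := o) (w := w₀) (N := N)
  have i3 := two_mul_card_pairs_le hD hN
  have i4 := card_pairs_add_one (o := o) (w := w₀) (N := N)
  rw [← hg] at i3 i4
  have hcoef : ∀ ω ∈ Ω, |permAvg (fun σ => ∏ t ∈ range N, cen σ (wk ω t))| ≤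
      4 * 2 ^ (4 * g + 2 * S) * (1 / n) ^ #(pairs w₀ N) * (2 * N / √n) ^ #(isoTimes w₀ N) := by
    intro ω hω
    have hs := hsame ω hω
    refine (abs_permAvg_prod_cen_le hN hNn).trans ?_
    rw [hs.card_pairs_eq, hs.isoTimes_eq]
    have := card_singles_sdiff_le (o := o) (w := wk ω) (N := N)
    rw [hs.card_pairs_eq, hs.card_labels_eq, hs.isoTimes_eq] at this
    have h2 : (2 : ℝ) ^ #(singles (wk ω) N \ image (wk ω) (isoTimes w₀ N)) ≤ 2 ^ (4 * g + 2 * S) :=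
      pow_le_pow_right₀ (by norm_num) (by omega)
    gcongr
  have hlk : ∀ ω ∈ Ω, 0 ≤ ∏ t ∈ range (N - 1), lk K o (wk ω) t := by
    intro ω _
    refine prod_nonneg fun t _ => ?_
    unfold lk; split_ifs <;> first | exact hK _ _ | exact zero_le_one
  refine (sum_le_sum fun ω hω => mul_le_mul_of_nonneg_right (hcoef ω hω) (hlk ω hω)).trans ?_
  rw [← mul_sum]
  refine (mul_le_mul_of_nonneg_left (sum_prod_lk_le (by linarith) hK hK1 hr hc hHS hN hchg Ω wk hinj hsame)
    (by positivity)).trans ?_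
  set c := #(comps o w₀ N)
  set a := #(isoTimes w₀ N)
  -- The inequalities `i1`, `i2`, `i4` combine to: labels minus classes minus doubled classes is at
  -- most 4g + 2S + a.
  have hL : lam ^ (#(labels o w₀ N) - (c + #{C ∈ comps o w₀ N | DoubledComp o w₀ N C})) ≤
      lam ^ (4 * g + 2 * S) * lam ^ a := by
    rw [← pow_add]
    exact pow_le_pow_right₀ hlam (by omega)
  have hpow : (1 / (n : ℝ)) ^ #(pairs w₀ N) * (n : ℝ) ^ c = n * (1 / n) ^ g := by
    have : (1 / (n : ℝ)) ^ (#(pairs w₀ N) + 1) = (1 / n) ^ c * (1 / n) ^ g := by rw [i4, pow_add]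
    rw [pow_succ] at this
    have h1 : (1 / (n : ℝ)) ^ c * (n : ℝ) ^ c = 1 := by rw [← mul_pow, one_div_mul_cancel hn.ne', one_pow]
    have h2 : (1 / (n : ℝ)) ^ #(pairs w₀ N) = n * ((1 / n) ^ c * (1 / n) ^ g) := by
      rw [← this]; field_simp
    rw [h2]
    linear_combination (n : ℝ) * (1 / n) ^ g * h1
  -- The labels still to be paid for are charged to the isolated times, whose gain exceeds lam.
  have ha : (2 * N / √n) ^ a * lam ^ a ≤ 1 := by
    rw [← mul_pow]
    apply pow_le_one₀ (by positivity)
    rw [div_mul_eq_mul_div]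
    exact (div_le_one hsq).2 hNl
  calc _ ≤ 4 * 2 ^ (4 * g + 2 * S) * (1 / n) ^ #(pairs w₀ N) * (2 * N / √n) ^ a *
        ((n : ℝ) ^ c * (lam ^ (4 * g + 2 * S) * lam ^ a)) := by gcongr
    _ = 4 * (2 ^ (4 * g + 2 * S) * lam ^ (4 * g + 2 * S)) * ((1 / n) ^ #(pairs w₀ N) * (n : ℝ) ^ c) *
        ((2 * N / √n) ^ a * lam ^ a) := by ring
    _ ≤ 4 * (2 ^ (4 * g + 2 * S) * lam ^ (4 * g + 2 * S)) * ((1 / n) ^ #(pairs w₀ N) * (n : ℝ) ^ c) * 1 := by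
        gcongr
    _ = _ := by rw [hpow, mul_pow]; ring

lemma abs_cen_le (hn : 0 < n) (σ : Equiv.Perm (Fin n)) (p : Fin n × Fin n) :
    |cen σ p| ≤ hit σ p + 1 / n ∧ |cen σ p| ≤ 1 := by
  have h1 : (0 : ℝ) ≤ 1 / n := by positivity
  have h2 : 1 / (n : ℝ) ≤ 1 := by
    rw [div_le_one (by exact_mod_cast hn)]; exact_mod_cast hn
  unfold cen
  rcases hit_eq_zero_or_one σ p with h | h <;> rw [h]
  · rw [zero_sub, abs_neg, abs_of_nonneg h1, zero_add]; exact ⟨le_rfl, h2⟩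
  · rw [abs_of_nonneg (by linarith)]; exact ⟨by linarith, by linarith⟩

lemma permAvg_prod_abs_cen_le (hN : 0 < N) (hNn : 2 * N ^ 2 ≤ n) :
    permAvg (fun σ => ∏ t ∈ range N, |cen σ (w t)|) ≤ 2 * 2 ^ N * (1 / n) ^ #(pairs w N) := by
  have hn : 0 < n := by nlinarith
  have hc : #(pairs w N) ≤ N := card_image_le.trans (card_range N).le
  calc _ ≤ permAvg (fun σ => ∏ p ∈ pairs w N, (hit σ p + 1 / n)) := by
        refine permAvg_mono fun σ => ?_
        rw [prod_comp (fun p => |cen σ p|) w]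
        refine prod_le_prod (fun _ _ => by positivity) fun p hp => ?_
        obtain ⟨t, ht, rfl⟩ := mem_image.1 hp
        refine (pow_le_of_le_one (abs_nonneg _) (abs_cen_le hn σ _).2 ?_).trans (abs_cen_le hn σ _).1
        exact (card_pos.2 ⟨t, (mem_filter.2 ⟨ht, rfl⟩ : t ∈ {a ∈ range N | w a = w t})⟩).ne'
    _ ≤ 2 * 2 ^ #(pairs w N) * (1 / n) ^ #(pairs w N) := permAvg_prod_hit_add_le hN hNn _ hc
    _ ≤ _ := by
        have : (2 : ℝ) ^ #(pairs w N) ≤ 2 ^ N := pow_le_pow_right₀ (by norm_num) hc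
        gcongr

/-- The first moment of the walks with given coincidences which visit a set `E` at marked times. -/
lemma sum_permAvg_abs_mul_prod_lk_le {ι : Type*} (hK : ∀ i j, 0 ≤ K i j) (hK1 : ∀ i j, K i j ≤ 1)
    (hr : ∀ i, ∑ j, K i j ≤ 1) (hc : ∀ j, ∑ i, K i j ≤ 1)
    (hN : 0 < N) (hchg : ∀ t, t + 1 < N → o t ≠ o (t + 1) → hd o w₀ t = tl o w₀ (t + 1))
    (hNn : 2 * N ^ 2 ≤ n) (Ω : Finset ι) (wk : ι → ℕ → Fin n × Fin n)
    (hinj : ∀ ω ∈ Ω, ∀ ω' ∈ Ω, (∀ t < N, wk ω t = wk ω' t) → ω = ω')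
    (hsame : ∀ ω ∈ Ω, SameKernel N (wk ω) w₀) (E : Finset (Fin n)) (T₀ : Finset ℕ) (hT₀ : ∀ t ∈ T₀, t < N)
    (hT₀inj : Set.InjOn (fun t => comp o w₀ N (Sum.inl (w₀ t).1)) T₀)
    (hE : ∀ ω ∈ Ω, ∀ t ∈ T₀, (wk ω t).1 ∈ E) :
    ∑ ω ∈ Ω, permAvg (fun σ => ∏ t ∈ range N, |cen σ (wk ω t)|) * ∏ t ∈ range (N - 1), lk K o (wk ω) t ≤
      2 * 2 ^ N * n * (1 / n) ^ genus (vtx o w₀ N) w₀ N * (#E / n) ^ #T₀ := by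
  classical
  set g := genus (vtx o w₀ N) w₀ N with hg
  have hn0 : 0 < n := by nlinarith
  have hn : (0 : ℝ) < n := by exact_mod_cast hn0
  have i4 := card_pairs_add_one (o := o) (w := w₀) (N := N)
  rw [← hg] at i4
  have hlk : ∀ ω ∈ Ω, 0 ≤ ∏ t ∈ range (N - 1), lk K o (wk ω) t := by
    intro ω _
    refine prod_nonneg fun t _ => ?_
    unfold lk; split_ifs <;> first | exact hK _ _ | exact zero_le_one
  have hcoef : ∀ ω ∈ Ω, permAvg (fun σ => ∏ t ∈ range N, |cen σ (wk ω t)|) ≤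
      2 * 2 ^ N * (1 / n) ^ #(pairs w₀ N) := by
    intro ω hω
    rw [← (hsame ω hω).card_pairs_eq]
    exact permAvg_prod_abs_cen_le hN hNn
  refine (sum_le_sum fun ω hω => mul_le_mul_of_nonneg_right (hcoef ω hω) (hlk ω hω)).trans ?_
  rw [← mul_sum]
  refine (mul_le_mul_of_nonneg_left (sum_prod_lk_le_of_marks hK hK1 hr hc hN hchg Ω wk hinj hsame E T₀
    hT₀ hT₀inj hE) (by positivity)).trans (le_of_eq ?_)
  have hTc : #T₀ ≤ #(comps o w₀ N) := by
    rw [← card_image_of_injOn hT₀inj]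
    apply card_le_card
    intro C hC
    obtain ⟨t, ht, rfl⟩ := mem_image.1 hC
    refine comp_mem_comps ?_
    rw [labels_eq_disjSum, inl_mem_disjSum]
    exact mem_image_of_mem _ (mem_image_of_mem _ (mem_range.2 (hT₀ t ht)))
  obtain ⟨r, hr'⟩ := Nat.exists_eq_add_of_le hTc
  rw [hr', Nat.add_sub_cancel_left]
  have hpow : (1 / (n : ℝ)) ^ (#(pairs w₀ N) + 1) = (1 / n) ^ #T₀ * (1 / n) ^ r * (1 / n) ^ g := by
    rw [i4, hr', pow_add, pow_add]
  have h1 : (1 / (n : ℝ)) ^ r * (n : ℝ) ^ r = 1 := by rw [← mul_pow, one_div_mul_cancel hn.ne', one_pow]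
  rw [pow_succ] at hpow
  have h2 : (1 / (n : ℝ)) ^ #(pairs w₀ N) = n * ((1 / n) ^ #T₀ * (1 / n) ^ r * (1 / n) ^ g) := by
    rw [← hpow]; field_simp
  rw [h2, div_eq_mul_one_div (#E : ℝ), mul_pow (#E : ℝ)]
  linear_combination 2 * 2 ^ N * n * (1 / n) ^ #T₀ * (1 / n) ^ g * (#E : ℝ) ^ #T₀ * h1

end fiber

/-! ### Forward walks of cycle rank at most one. -/

section tame
variable {V ℰ : Type*} {N : ℕ} {v : ℕ → V} {E : ℕ → ℰ}

/-- The first `N` terms of a sequence are distinct, except that on a window the sequence is periodic. -/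
def TameSeq (N : ℕ) (E : ℕ → ℰ) : Prop := ∃ lo hi L, 1 ≤ L ∧ hi ≤ N ∧
  (∀ t, lo ≤ t → t + L < hi → E (t + L) = E t) ∧
  ∀ s t, s < t → t < N → E s = E t → lo ≤ s ∧ t < hi ∧ L ∣ t - s

lemma TameSeq.reflect (h : TameSeq N E) : TameSeq N (fun t => E (N - 1 - t)) := by
  obtain ⟨lo, hi, L, h1, h2, h3, h4⟩ := h
  refine ⟨N - hi, N - lo, L, h1, by omega, ?_, ?_⟩
  · intro t ht ht'
    have := h3 (N - 1 - (t + L)) (by omega) (by omega)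
    dsimp only
    rw [← this]; congr 1; omega
  · intro s t hst ht he
    obtain ⟨a, b, c⟩ := h4 (N - 1 - t) (N - 1 - s) (by omega) (by omega) he.symm
    refine ⟨by omega, by omega, ?_⟩
    rwa [show t - s = N - 1 - s - (N - 1 - t) by omega]

lemma TameSeq.congr {E' : ℕ → ℰ} (h : TameSeq N E) (he : ∀ t < N, E t = E' t) : TameSeq N E' := by
  obtain ⟨lo, hi, L, h1, h2, h3, h4⟩ := h
  refine ⟨lo, hi, L, h1, h2, ?_, ?_⟩
  · intro t ht ht'
    rw [← he _ (by omega), ← he _ (by omega)]; exact h3 t ht ht'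
  · intro s t hst ht e
    rw [← he _ (by omega), ← he _ ht] at e
    exact h4 s t hst ht e

lemma IsMultiWalk.eq_of_eq (h : IsMultiWalk N v E (fun _ => true)) {s t : ℕ} (hs : s < N) (ht : t < N)
    (he : E s = E t) : v s = v t := (h.same s t hs ht he rfl).1

open Classical in
/-- As long as the walk avoids closings, it keeps discovering new vertices. -/
lemma IsMultiWalk.isNew_of_not_closing (h : IsMultiWalk N v E (fun _ => true)) {p q : ℕ} (hq : q ≤ N)
    (hp : p < q → firstIdx E p = p) (hc : ∀ t, p ≤ t → t < q → t ∉ closings v E N) :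
    ∀ t, p ≤ t → t < q → firstIdx E t = t ∧ IsNew v t := by
  intro t hpt
  induction t, hpt using Nat.le_induction with
  | base =>
    intro hlt
    refine ⟨hp hlt, ?_⟩
    by_contra hn
    exact hc p le_rfl hlt (mem_filter.2 ⟨mem_range.2 (by omega), hp hlt, hn⟩)
  | succ t hpt ih =>
    intro hlt
    have hnew := (ih (by omega)).2
    have hE : firstIdx E (t + 1) = t + 1 := by
      by_contra hne
      have hlt' := lt_of_le_of_ne (firstIdx_le E (t + 1)) hne
      have := h.eq_of_eq (by omega) (by omega) (apply_firstIdx E (t + 1))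
      have := firstIdx_le_of_eq this
      unfold IsNew at hnew
      omega
    refine ⟨hE, ?_⟩
    by_contra hn
    exact hc (t + 1) (by omega) hlt (mem_filter.2 ⟨mem_range.2 (by omega), hE, hn⟩)

open Classical in
lemma IsMultiWalk.vertices_injOn (h : IsMultiWalk N v E (fun _ => true)) {q : ℕ} (hq : q ≤ N)
    (hc : ∀ t < q, t ∉ closings v E N) : ∀ s ≤ q, ∀ t ≤ q, v s = v t → s = t := by
  have key := h.isNew_of_not_closing (p := 0) hq (fun _ => Nat.le_zero.1 (firstIdx_le E 0))
    (fun t _ ht => hc t ht)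
  have hf : ∀ t ≤ q, firstIdx v t = t := by
    intro t ht
    rcases t with _ | t
    · exact Nat.le_zero.1 (firstIdx_le v 0)
    · exact (key t (by omega) (by omega)).2
  intro s hs t ht he
  rw [← hf s hs, ← hf t ht]; exact firstIdx_congr he

/-- With no closing the walk is a simple path. With one closing j, the walk returns at time j + 1 to
the vertex first met at time i; since all edges are traversed forwards, it can then only wind around
this cycle of length L until it uses a new edge, after which every step finds a new vertex. -/
lemma IsMultiWalk.tameSeq (h : IsMultiWalk N v E (fun _ => true)) (hg : genus v E N ≤ 1) : TameSeq N E := by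
  classical
  rcases Nat.lt_or_ge 0 (genus v E N) with hpos | h0
  · obtain ⟨j, hj⟩ := card_pos.1 hpos
    have huniq : ∀ t ∈ closings v E N, t = j := fun t ht => card_le_one.1 hg t ht j hj
    obtain ⟨hjN, hjE, hjv⟩ := mem_filter.1 hj
    rw [mem_range] at hjN
    have hinj := h.vertices_injOn (q := j) (by omega) fun t ht hc => by have := huniq t hc; omega
    set i := firstIdx v (j + 1) with hi
    have hij : i ≤ j := by
      have := firstIdx_le v (j + 1)
      unfold IsNew at hjv
      omega
    obtain ⟨L, hL⟩ : ∃ L, j + 1 = i + L := ⟨j + 1 - i, by omega⟩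
    have hL0 : 0 < L := by omega
    have hex : ∃ t, j < t ∧ (firstIdx E t = t ∨ t = N) := ⟨N, hjN, Or.inr rfl⟩
    -- The end of the window: the first new edge after the closing, or N.
    set p := Nat.find hex with hp
    obtain ⟨hp1, hp2⟩ := Nat.find_spec hex
    have hpN : p ≤ N := Nat.find_min' hex ⟨hjN, Or.inr rfl⟩
    have hpmin : ∀ t, j < t → t < p → firstIdx E t ≠ t := fun t ht htp he =>
      Nat.find_min hex htp ⟨ht, Or.inl he⟩
    -- An edge used between j and p is old, hence was first used by time j. Vertices up to time j
    -- are distinct, so the starting vertex determines which edge it is.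
    have hred : ∀ t, i ≤ t → t ≤ p → v t = v (i + (t - i) % L) ∧ (t < p → E t = E (i + (t - i) % L)) := by
      intro t hit
      induction t, hit using Nat.le_induction with
      | base => intro _; simp
      | succ t hit ih =>
        intro htp
        obtain ⟨ih1, ih2⟩ := ih (by omega)
        have hr := Nat.mod_lt (t - i) hL0
        have hr' := Nat.mod_lt (t + 1 - i) hL0
        have hv : v (t + 1) = v (i + (t + 1 - i) % L) := by
          rw [(h.same t (i + (t - i) % L) (by omega) (by omega) (ih2 (by omega)) rfl).2]
          rw [show t + 1 - i = t - i + 1 by omega, Nat.add_mod]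
          rcases Nat.lt_or_ge ((t - i) % L + 1) L with hlt | hge
          · have : 1 < L := by omega
            rw [Nat.mod_eq_of_lt this, Nat.mod_eq_of_lt hlt]; rfl
          · have e1 : (t - i) % L + 1 = L := by omega
            have e2 : ((t - i) % L + 1 % L) % L = 0 := by
              rw [Nat.add_mod, Nat.mod_mod, Nat.mod_mod, ← Nat.add_mod, ← Nat.mod_add_mod, e1, Nat.mod_self]
            rw [e2, show i + (t - i) % L + 1 = j + 1 by omega]
            exact (apply_firstIdx v (j + 1)).symm
        refine ⟨hv, fun hlt => ?_⟩
        rcases Nat.lt_or_ge j (t + 1) with hjt | hjt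
        · have hne := hpmin (t + 1) hjt hlt
          set s := firstIdx E (t + 1) with hs
          have hst : s < t + 1 := lt_of_le_of_ne (firstIdx_le _ _) hne
          have hsE : E s = E (t + 1) := apply_firstIdx E (t + 1)
          have hsj : s ≤ j := by
            by_contra hgt
            exact hpmin s (by omega) (by omega) (firstIdx_firstIdx E (t + 1))
          have hvs : v s = v (i + (t + 1 - i) % L) := by
            rw [← hv]; exact h.eq_of_eq (by omega) (by omega) hsE
          rw [← hinj s hsj _ (by omega) hvs, hsE]
        · rw [Nat.mod_eq_of_lt (by omega), show i + (t + 1 - i) = t + 1 by omega]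
    refine ⟨i, p, L, hL0, hpN, ?_, ?_⟩
    · intro t ht ht'
      rw [(hred (t + L) (by omega) (by omega)).2 ht', (hred t ht (by omega)).2 (by omega)]
      rw [show t + L - i = t - i + L by omega, Nat.add_mod_right]
    · intro s t hst ht he
      have htp : t < p := by
        by_contra hge
        have key := h.isNew_of_not_closing (p := p) (q := N) le_rfl
          (fun hlt => hp2.resolve_right (by omega)) (fun u hu _ hc => by have := huniq u hc; omega)
          t (by omega) ht
        have := firstIdx_le_of_eq he
        omega
      have hv : v s = v t := h.eq_of_eq (by omega) ht he
      have hjt : j < t := by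
        by_contra hge
        have := hinj s (by omega) t (by omega) hv
        omega
      have ht' := (hred t (by omega) htp.le).1
      have hmt := Nat.mod_lt (t - i) hL0
      have his : i ≤ s := by
        by_contra hlt
        have := hinj s (by omega) _ (by omega) (hv.trans ht')
        omega
      have hs' := (hred s his (by omega)).1
      have hms := Nat.mod_lt (s - i) hL0
      have := hinj _ (by omega) _ (by omega) ((hs'.symm.trans hv).trans ht')
      refine ⟨his, htp, ?_⟩
      rw [show t - s = (t - i) - (s - i) by omega]
      exact (Nat.modEq_iff_dvd' (by omega)).1 (by unfold Nat.ModEq; omega)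
  · have hcl : closings v E N = ∅ := card_eq_zero.1 (by unfold genus at h0; omega)
    refine ⟨0, 0, 1, le_rfl, Nat.zero_le _, fun t _ ht => by omega, ?_⟩
    intro s t hst ht he
    have := h.vertices_injOn (q := N) le_rfl (fun t _ hc => by simp [hcl] at hc) s (by omega) t (by omega)
      (h.eq_of_eq (by omega) ht he)
    omega

end tame

/-! ### Good walks and the tame pieces they form. -/

section pieces
variable {n : ℕ}

/-- The cycle rank of the first `t` steps of a walk traversed forwards. -/
def fwdGenus (w : ℕ → Fin n × Fin n) (t : ℕ) : ℕ := genus (vtx (fun _ => true) w t) w t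

/-- Walks with a simple structure which rarely visit `E`. -/
def GoodWalk (E : Finset (Fin n)) (J : ℕ) (w : ℕ → Fin n × Fin n) (t : ℕ) : Prop :=
  (fwdGenus w t = 0 ∧ #{s ∈ range t | (w s).1 ∈ E} ≤ J) ∨
    (fwdGenus w t = 1 ∧ ∀ s < t, (w s).1 ∉ E)

variable {E : Finset (Fin n)} {J t k S : ℕ} {w : ℕ → Fin n × Fin n}

lemma GoodWalk.tameSeq (h : GoodWalk E J w t) : TameSeq t w := by
  refine (isMultiWalk_vtx (o := fun _ => true) (w := w) (N := t)).tameSeq ?_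
  change fwdGenus w t ≤ 1
  rcases h with h | h <;> omega

lemma GoodWalk.card_le (h : GoodWalk E J w t) : #{s ∈ range t | (w s).1 ∈ E} ≤ J := by
  rcases h with h | h
  · exact h.2
  · rw [filter_false_of_mem (fun s hs => h.2 s (mem_range.1 hs))]; simp

/-- Tame sequences of equal lengths in alternating directions form a walk with tame pieces. -/
lemma tamePieces_of_blocks (hk : 0 < k) {o : ℕ → Bool} (ho : ∀ t, o t = decide (Even (t / k)))
    (h : ∀ r < S, TameSeq k (fun j => w (r * k + j))) :
    ∃ D, TamePieces (S * k) S w o D := by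
  choose! lo hi L h1 h2 h3 h4 using h
  refine ⟨⟨fun t => t / k, fun r => if r < S then r * k + lo r else 0,
    fun r => if r < S then r * k + hi r else 0, fun r => if r < S then L r else 1⟩, ?_⟩
  have hdiv : ∀ r j, j < k → (r * k + j) / k = r := by
    intro r j hj
    rw [mul_comm, Nat.mul_add_div hk, Nat.div_eq_of_lt hj, add_zero]
  refine ⟨?_, ?_, ?_, ?_, ?_, ?_, ?_⟩
  · intro t _; exact Nat.div_le_div_right (by omega)
  · intro t ht; exact Nat.div_lt_of_lt_mul (by rwa [mul_comm])
  · intro s t _ _ he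
    rw [ho, ho]
    simp only at he
    rw [he]
  · intro r; dsimp only; split_ifs with hr
    · exact h1 r hr
    · exact le_rfl
  · intro r t ha hb
    dsimp only at ha hb ⊢
    split_ifs at ha hb with hr
    · have := h2 r hr
      obtain ⟨j, rfl⟩ : ∃ j, t = r * k + j := ⟨t - r * k, by omega⟩
      refine ⟨?_, hdiv r j (by omega)⟩
      have := Nat.mul_le_mul_right k (show r + 1 ≤ S from hr)
      rw [Nat.add_mul, one_mul] at this
      omega
    · omega
  · intro r t ha hb
    dsimp only at ha hb ⊢
    split_ifs at ha hb with hr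
    · obtain ⟨j, rfl⟩ : ∃ j, t = r * k + j := ⟨t - r * k, by omega⟩
      rw [if_pos hr, add_assoc]
      exact h3 r hr j (by omega) (by omega)
    · omega
  · intro s t hst ht hpc he
    dsimp only at hpc ⊢
    have hr : t / k < S := Nat.div_lt_of_lt_mul (by rwa [mul_comm])
    rw [if_pos hr, if_pos hr, if_pos hr]
    set r := t / k with hrdef
    have hs := Nat.div_add_mod' s k
    have ht' := Nat.div_add_mod' t k
    have hms := Nat.mod_lt s hk
    have hmt := Nat.mod_lt t hk
    rw [hpc] at hs
    rw [← hrdef] at ht'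
    obtain ⟨a, b, c⟩ := h4 r hr (s % k) (t % k) (by omega) hmt (by dsimp only; rw [hs, ht']; exact he)
    refine ⟨by omega, by omega, ?_⟩
    rwa [show t - s = t % k - s % k by omega]

/-- A tame sequence followed by one more step. -/
lemma tamePieces_snoc {m : ℕ} (h : TameSeq m w) :
    ∃ D, TamePieces (m + 1) 2 w (fun _ => true) D := by
  obtain ⟨lo, hi, L, h1, h2, h3, h4⟩ := h
  refine ⟨⟨fun t => if t < m then 0 else 1, fun r => if r = 0 then lo else 0,
    fun r => if r = 0 then hi else 0, fun _ => L⟩, ?_, ?_, ?_, ?_, ?_, ?_, ?_⟩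
  · intro t _; dsimp only; split_ifs <;> omega
  · intro t _; dsimp only; split_ifs <;> omega
  · intro _ _ _ _ _; rfl
  · intro _; exact h1
  · intro r t ha hb
    dsimp only at ha hb ⊢
    split_ifs at ha hb with hr
    · subst hr
      rw [if_pos (by omega)]; exact ⟨by omega, rfl⟩
    · omega
  · intro r t ha hb
    dsimp only at ha hb ⊢
    split_ifs at ha hb with hr
    · exact h3 t ha hb
    · omega
  · intro s t hst ht hpc he
    dsimp only at hpc ⊢
    have htm : t < m := by
      by_contra hge
      split_ifs at hpc; omega
    rw [if_pos htm]
    exact h4 s t hst htm he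

end pieces

/-! ### Matrix products as sums over paths. -/

section chain
variable {ι X : Type*}

/-- A finite sequence, prolonged by its last term. -/
def pathExt {m : ℕ} (γ : Fin (m + 1) → ι) (t : ℕ) : ι := γ ⟨min t m, by omega⟩

lemma pathExt_snoc {m : ℕ} (γ : Fin (m + 1) → ι) (i : ι) {t : ℕ} (ht : t ≤ m) :
    pathExt (Fin.snoc (α := fun _ => ι) γ i : Fin (m + 2) → ι) t = pathExt γ t := by
  unfold pathExt
  have : (⟨min t (m + 1), by omega⟩ : Fin (m + 2)) = Fin.castSucc ⟨min t m, by omega⟩ := by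
    ext; simp; omega
  rw [this, Fin.snoc_castSucc (α := fun _ => ι)]

lemma pathExt_snoc_last {m : ℕ} (γ : Fin (m + 1) → ι) (i : ι) :
    pathExt (Fin.snoc (α := fun _ => ι) γ i : Fin (m + 2) → ι) (m + 1) = i := by
  unfold pathExt
  have : (⟨min (m + 1) (m + 1), by omega⟩ : Fin (m + 2)) = Fin.last (m + 1) := by
    ext; simp
  rw [this, Fin.snoc_last (α := fun _ => ι)]

lemma pathExt_min {m : ℕ} (γ : Fin (m + 1) → ι) (t : ℕ) : pathExt γ (min t m) = pathExt γ t := by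
  unfold pathExt; congr 2; omega

lemma pathExt_val {m : ℕ} (γ : Fin (m + 1) → ι) (r : Fin (m + 1)) : pathExt γ r = γ r := by
  unfold pathExt; congr 1; ext; simp; omega

lemma pathExt_injective {m : ℕ} {γ γ' : Fin (m + 1) → ι} (h : ∀ t < m + 1, pathExt γ t = pathExt γ' t) :
    γ = γ' := by
  ext r
  rw [← pathExt_val γ, ← pathExt_val γ', h r r.2]

variable (src tgt : ℕ → ι → X) (c : ℕ → ι → ℝ) (L : ℕ → Matrix X X ℝ)

/-- The product of the weights of the steps of a path and of the links between consecutive steps. -/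
def pathWeight (m : ℕ) (w : ℕ → ι) : ℝ :=
  (∏ t ∈ range (m + 1), c t (w t)) * ∏ t ∈ range m, L t (tgt t (w t)) (src (t + 1) (w (t + 1)))

variable [Fintype ι] [DecidableEq X]

open Classical in
/-- The matrix whose entries are the sums of the weights of the paths with given ends which satisfy `P`. -/
def pathSum (P : (ℕ → ι) → Prop) (m : ℕ) : Matrix X X ℝ := Matrix.of fun x y =>
  ∑ γ : Fin (m + 1) → ι, if P (pathExt γ) ∧ src 0 (pathExt γ 0) = x ∧ tgt m (pathExt γ m) = y
    then pathWeight src tgt c L m (pathExt γ) else 0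

/-- The matrix of a single step. -/
def stepMat (t : ℕ) : Matrix X X ℝ := Matrix.of fun x y =>
  ∑ i, if src t i = x ∧ tgt t i = y then c t i else 0

lemma mul_stepMat_apply [Fintype X] (A : Matrix X X ℝ) (t : ℕ) (z y : X) :
    (A * stepMat src tgt c t) z y = ∑ i, if tgt t i = y then A z (src t i) * c t i else 0 := by
  simp only [Matrix.mul_apply, stepMat, Matrix.of_apply, mul_sum]
  rw [sum_comm]
  refine sum_congr rfl fun i _ => ?_
  rw [sum_eq_single (src t i)]
  · simp
  · intro u _ hu
    rw [if_neg (fun h => hu h.1.symm), mul_zero]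
  · simp

lemma pathSum_zero {P : (ℕ → ι) → Prop} (hP : ∀ w, P w) :
    pathSum src tgt c L P 0 = stepMat src tgt c 0 := by
  ext x y
  simp only [pathSum, stepMat, Matrix.of_apply, hP, true_and]
  refine Fintype.sum_equiv (Equiv.funUnique (Fin 1) ι) _ _ fun γ => ?_
  simp [pathWeight, pathExt, Equiv.funUnique]

/-- The last step is split off. The hypothesis on `P` makes it ignore this step, so the sum factors.
-/
lemma pathSum_succ [Fintype X] {P : (ℕ → ι) → Prop} {m : ℕ}
    (hP : ∀ w w' : ℕ → ι, (∀ t ≤ m, w t = w' t) → (P w ↔ P w')) :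
    pathSum src tgt c L P (m + 1) = pathSum src tgt c L P m * (L m * stepMat src tgt c (m + 1)) := by
  classical
  ext x y
  rw [Matrix.mul_apply]
  simp_rw [mul_stepMat_apply]
  simp only [pathSum, Matrix.of_apply, sum_mul]
  rw [sum_comm, ← Equiv.sum_comp (Fin.snocEquiv fun _ : Fin (m + 2) => ι), Fintype.sum_prod_type_right]
  refine sum_congr rfl fun γ _ => ?_
  have h1 : ∀ i, ∀ t ≤ m, pathExt (Fin.snocEquiv (fun _ : Fin (m + 2) => ι) (i, γ)) t = pathExt γ t :=
    fun i t ht => pathExt_snoc γ i ht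
  have h2 : ∀ i, pathExt (Fin.snocEquiv (fun _ : Fin (m + 2) => ι) (i, γ)) (m + 1) = i :=
    fun i => pathExt_snoc_last γ i
  have h3 : ∀ i, pathWeight src tgt c L (m + 1) (pathExt (Fin.snocEquiv (fun _ : Fin (m + 2) => ι) (i, γ))) =
      pathWeight src tgt c L m (pathExt γ) *
        (L m (tgt m (pathExt γ m)) (src (m + 1) i) * c (m + 1) i) := by
    intro i
    unfold pathWeight
    have e1 : ∏ t ∈ range (m + 1), c t (pathExt (Fin.snocEquiv (fun _ : Fin (m + 2) => ι) (i, γ)) t) =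
        ∏ t ∈ range (m + 1), c t (pathExt γ t) :=
      prod_congr rfl fun t ht => by rw [h1 i t (by have := mem_range.1 ht; omega)]
    have e2 : ∏ t ∈ range m, L t (tgt t (pathExt (Fin.snocEquiv (fun _ : Fin (m + 2) => ι) (i, γ)) t))
        (src (t + 1) (pathExt (Fin.snocEquiv (fun _ : Fin (m + 2) => ι) (i, γ)) (t + 1))) =
        ∏ t ∈ range m, L t (tgt t (pathExt γ t)) (src (t + 1) (pathExt γ (t + 1))) :=
      prod_congr rfl fun t ht => by
        have := mem_range.1 ht
        rw [h1 i t (by omega), h1 i (t + 1) (by omega)]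
    rw [prod_range_succ _ (m + 1), e1, prod_range_succ (n := m) (f := fun t => L t (tgt t (pathExt
      (Fin.snocEquiv (fun _ : Fin (m + 2) => ι) (i, γ)) t)) (src (t + 1) (pathExt
        (Fin.snocEquiv (fun _ : Fin (m + 2) => ι) (i, γ)) (t + 1)))), e2, h2, h1 i m le_rfl]
    ring
  simp_rw [h3, h2, h1 _ 0 (Nat.zero_le m)]
  simp_rw [hP _ _ (h1 _)]
  by_cases hc : P (pathExt γ) ∧ src 0 (pathExt γ 0) = x
  · rw [sum_eq_single (tgt m (pathExt γ m))]
    · simp only [hc.1, hc.2, true_and, and_true, if_true, mul_sum]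
      refine sum_congr rfl fun i _ => ?_
      split_ifs <;> simp
    · intro z _ hz
      rw [if_neg (fun h => hz h.2.2.symm), zero_mul]
    · simp
  · rw [sum_eq_zero, sum_eq_zero]
    · intro z _
      rw [if_neg (fun h => hc ⟨h.1, h.2.1⟩), zero_mul]
    · intro i _
      rw [if_neg (fun h => hc ⟨h.1, h.2.1⟩)]

end chain

/-! ### Operator norms, the trace bound and centring. -/

section norms
open scoped Matrix Matrix.Norms.L2Operator
variable {n : ℕ}

lemma norm_sq_le_sum_sq (A : Matrix (Fin n) (Fin n) ℝ) : ‖A‖ ^ 2 ≤ ∑ i, ∑ j, A i j ^ 2 := by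
  have h0 : 0 ≤ ∑ i, ∑ j, A i j ^ 2 := sum_nonneg fun _ _ => sum_nonneg fun _ _ => sq_nonneg _
  have : ‖A‖ ≤ √(∑ i, ∑ j, A i j ^ 2) := by
    rw [← Matrix.l2_opNorm_toEuclideanCLM]
    refine ContinuousLinearMap.opNorm_le_bound _ (Real.sqrt_nonneg _) fun x => ?_
    rw [← Real.sqrt_sq (norm_nonneg x), ← Real.sqrt_mul h0]
    apply Real.le_sqrt_of_sq_le
    rw [EuclideanSpace.real_norm_sq_eq, EuclideanSpace.real_norm_sq_eq, sum_mul]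
    refine sum_le_sum fun i _ => ?_
    rw [Matrix.ofLp_toEuclideanCLM, Matrix.mulVec, dotProduct]
    exact sum_mul_sq_le_sq_mul_sq _ _ _
  calc ‖A‖ ^ 2 ≤ √(∑ i, ∑ j, A i j ^ 2) ^ 2 := by gcongr
    _ = _ := Real.sq_sqrt h0

lemma norm_le_sum_abs (A : Matrix (Fin n) (Fin n) ℝ) : ‖A‖ ≤ ∑ i, ∑ j, |A i j| := by
  have h0 : 0 ≤ ∑ i, ∑ j, |A i j| := sum_nonneg fun _ _ => sum_nonneg fun _ _ => abs_nonneg _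
  refine le_of_sq_le_sq ((norm_sq_le_sum_sq A).trans ?_) h0
  rw [← sum_product', ← sum_product' (f := fun i j => |A i j|)]
  calc _ = ∑ p ∈ univ ×ˢ univ, |A p.1 p.2| ^ 2 := by simp
    _ ≤ ∑ p ∈ univ ×ˢ univ, |A p.1 p.2| * ∑ p ∈ univ ×ˢ univ, |A p.1 p.2| := by
        refine sum_le_sum fun p hp => ?_
        rw [pow_two]
        exact mul_le_mul_of_nonneg_left (single_le_sum (f := fun p : Fin n × Fin n => |A p.1 p.2|)
          (fun _ _ => abs_nonneg _) hp) (abs_nonneg _)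
    _ = _ := by rw [← sum_mul, pow_two]

/-- The norm of a self-adjoint matrix is multiplicative under repeated squaring, which is why the
exponent contains a power of two; the last step bounds the norm of `C` by its Hilbert-Schmidt norm.
-/
lemma norm_pow_le_trace (A : Matrix (Fin n) (Fin n) ℝ) (i : ℕ) :
    ‖A‖ ^ (4 * 2 ^ i) ≤ ((A * A.transpose) ^ (2 * 2 ^ i)).trace := by
  have hT : ∀ B : Matrix (Fin n) (Fin n) ℝ, star B = B.transpose := fun B => by
    rw [Matrix.star_eq_conjTranspose, Matrix.conjTranspose_eq_transpose_of_trivial]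
  have hsa : IsSelfAdjoint (A * A.transpose) := by
    rw [← hT]; exact IsSelfAdjoint.mul_star_self A
  set C := (A * A.transpose) ^ 2 ^ i with hC
  have h1 : ‖A‖ ^ (4 * 2 ^ i) = ‖C‖ ^ 2 := by
    rw [hC, hsa.norm_pow_two_pow, ← hT, CStarRing.norm_self_mul_star, ← pow_two, ← pow_mul, ← pow_mul]
    congr 1; ring
  have hCT : C.transpose = C := by rw [← hT]; exact (hsa.pow _).star_eq
  have h2 : (A * A.transpose) ^ (2 * 2 ^ i) = C * C.transpose := by
    rw [hCT, hC, ← pow_add]; congr 1; ring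
  rw [h1, h2]
  refine (norm_sq_le_sum_sq C).trans (le_of_eq ?_)
  simp only [Matrix.trace, Matrix.diag, Matrix.mul_apply, Matrix.transpose_apply, pow_two]

/-- The centred permutation matrix. -/
def cenMat (σ : Equiv.Perm (Fin n)) : Matrix (Fin n) (Fin n) ℝ := Matrix.of fun x y => cen σ (x, y)

/-- The averaging matrix. -/
def avgMat (n : ℕ) : Matrix (Fin n) (Fin n) ℝ := Matrix.of fun _ _ => 1 / (n : ℝ)

lemma cenMat_eq (σ : Equiv.Perm (Fin n)) : cenMat σ = σ.permMatrix ℝ - avgMat n := by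
  ext x y
  simp [cenMat, avgMat, cen, hit, Equiv.Perm.permMatrix, PEquiv.toMatrix_apply, Equiv.toPEquiv_apply, eq_comm]

lemma mul_avgMat {A : Matrix (Fin n) (Fin n) ℝ} (hA : A ∈ doublyStochastic ℝ (Fin n)) :
    A * avgMat n = avgMat n := by
  ext x y
  simp [Matrix.mul_apply, avgMat, ← sum_mul, sum_row_of_mem_doublyStochastic hA]

lemma avgMat_mul {A : Matrix (Fin n) (Fin n) ℝ} (hA : A ∈ doublyStochastic ℝ (Fin n)) :
    avgMat n * A = avgMat n := by
  ext x y
  simp [Matrix.mul_apply, avgMat, ← mul_sum, sum_col_of_mem_doublyStochastic hA]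

lemma avgMat_mem (hn : 0 < n) : avgMat n ∈ doublyStochastic ℝ (Fin n) := by
  have : (n : ℝ) ≠ 0 := by positivity
  rw [mem_doublyStochastic_iff_sum]
  refine ⟨fun _ _ => by simp [avgMat], fun _ => by simp [avgMat, this], fun _ => by simp [avgMat, this]⟩

lemma permMul_mem {Q : Matrix (Fin n) (Fin n) ℝ} (hQ : Q ∈ doublyStochastic ℝ (Fin n))
    (σ : Equiv.Perm (Fin n)) : permMul σ Q ∈ doublyStochastic ℝ (Fin n) :=
  mul_mem permMatrix_mem_doublyStochastic hQ

/-- The averaging matrix absorbs bistochastic matrices on either side, so the cross terms collapse.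
-/
lemma cenMat_mul_pow (hn : 0 < n) {Q : Matrix (Fin n) (Fin n) ℝ} (hQ : Q ∈ doublyStochastic ℝ (Fin n))
    (σ : Equiv.Perm (Fin n)) {ℓ : ℕ} (hℓ : 1 ≤ ℓ) :
    (cenMat σ * Q) ^ ℓ = permMul σ Q ^ ℓ - avgMat n := by
  have hP := permMul_mem hQ σ
  have h1 : cenMat σ * Q = permMul σ Q - avgMat n := by
    rw [cenMat_eq, sub_mul, avgMat_mul hQ, permMul]
  induction ℓ, hℓ using Nat.le_induction with
  | base => rw [pow_one, pow_one, h1]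
  | succ ℓ _ ih =>
    rw [pow_succ, ih, h1, sub_mul, mul_sub, mul_sub, mul_avgMat (pow_mem hP ℓ), avgMat_mul hP,
      avgMat_mul (avgMat_mem hn), pow_succ]
    abel

lemma norm_le_one_of_mem {A : Matrix (Fin n) (Fin n) ℝ} (hA : A ∈ doublyStochastic ℝ (Fin n)) : ‖A‖ ≤ 1 :=
  Matrix.l2_opNorm_le_one_of_mem_doublyStochastic hA

lemma norm_cenMat_le (hn : 0 < n) (σ : Equiv.Perm (Fin n)) : ‖cenMat σ‖ ≤ 2 := by
  rw [cenMat_eq]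
  refine (norm_sub_le _ _).trans ?_
  have := norm_le_one_of_mem (permMatrix_mem_doublyStochastic (σ := σ) (R := ℝ))
  have := norm_le_one_of_mem (avgMat_mem hn)
  linarith

lemma normOnOnesPerp_le_norm_sub (A : Matrix (Fin n) (Fin n) ℝ) :
    normOnOnesPerp A ≤ ‖A - avgMat n‖ ∧ normOnOnesPerp A ≤ ‖A‖ := by
  have hz : ∀ v : onesPerp n, avgMat n *ᵥ (v : EuclideanSpace ℝ (Fin n)).ofLp = 0 := by
    intro v
    have hv := Submodule.mem_orthogonal_singleton_iff_inner_right.1 v.2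
    rw [PiLp.inner_apply] at hv
    have hv' : ∑ i, (v : EuclideanSpace ℝ (Fin n)).ofLp i = 0 := by simpa using hv
    ext i
    simp [Matrix.mulVec, dotProduct, avgMat, ← mul_sum, hv']
  have key : ∀ B : Matrix (Fin n) (Fin n) ℝ, (∀ v : onesPerp n, A *ᵥ (v : EuclideanSpace ℝ (Fin n)).ofLp =
      B *ᵥ (v : EuclideanSpace ℝ (Fin n)).ofLp) → normOnOnesPerp A ≤ ‖B‖ := by
    intro B hB
    refine ContinuousLinearMap.opNorm_le_bound _ (norm_nonneg _) fun v => ?_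
    have h := (Matrix.toEuclideanCLM (n := Fin n) (𝕜 := ℝ) B).le_opNorm (v : EuclideanSpace ℝ (Fin n))
    rw [Matrix.l2_opNorm_toEuclideanCLM] at h
    refine le_trans (le_of_eq ?_) h
    congr 1
    ext i
    rw [ContinuousLinearMap.comp_apply, Submodule.subtypeL_apply, Matrix.ofLp_toEuclideanCLM,
      Matrix.ofLp_toEuclideanCLM, hB]
  refine ⟨key _ fun v => ?_, key _ fun _ => rfl⟩
  rw [Matrix.sub_mulVec, hz, sub_zero]

end norms

/-! ### Good and bad walks; first moment of the bad part. -/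

section slots
variable {n : ℕ} (E : Finset (Fin n)) (J : ℕ) (Q : Matrix (Fin n) (Fin n) ℝ) (σ : Equiv.Perm (Fin n))

/-- The first `j` steps of `w` form a good walk. -/
def GoodAt (w : ℕ → Fin n × Fin n) (j : ℕ) : Prop := GoodWalk E J (fun s => w (min s (j - 1))) j

/-- The first `t` steps of `w` form a good walk, for all `t` up to `j`. -/
def GoodUpTo (w : ℕ → Fin n × Fin n) (j : ℕ) : Prop := ∀ t, 1 ≤ t → t ≤ j → GoodAt E J w t

/-- The part of `(M Q)ᵐ M`, with `M` centred, coming from the walks satisfying `P`. -/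
def walkMat (P : (ℕ → Fin n × Fin n) → Prop) (m : ℕ) : Matrix (Fin n) (Fin n) ℝ :=
  pathSum (fun _ => Prod.fst) (fun _ => Prod.snd) (fun _ => cen σ) (fun _ => Q) P m

/-- The contribution of good walks. -/
def goodMat (m : ℕ) : Matrix (Fin n) (Fin n) ℝ := walkMat Q σ (fun w => GoodUpTo E J w (m + 1)) m

/-- The contribution of walks which are good until the last step. -/
def badMat (m : ℕ) : Matrix (Fin n) (Fin n) ℝ :=
  walkMat Q σ (fun w => GoodUpTo E J w m ∧ ¬ GoodAt E J w (m + 1)) m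

variable {E J}

lemma GoodAt.congr {w w' : ℕ → Fin n × Fin n} {j : ℕ} (hj : 1 ≤ j) (h : ∀ t < j, w t = w' t) :
    GoodAt E J w j ↔ GoodAt E J w' j := by
  unfold GoodAt
  have : (fun s => w (min s (j - 1))) = fun s => w' (min s (j - 1)) := by
    funext s; exact h _ (by omega)
  rw [this]

lemma GoodUpTo.congr {w w' : ℕ → Fin n × Fin n} {j : ℕ} (h : ∀ t < j, w t = w' t) :
    GoodUpTo E J w j ↔ GoodUpTo E J w' j := by
  unfold GoodUpTo
  refine forall_congr' fun t => forall_congr' fun ht => forall_congr' fun htj => ?_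
  exact GoodAt.congr ht fun s hs => h s (by omega)

lemma goodAt_pathExt {m : ℕ} (γ : Fin (m + 1) → Fin n × Fin n) :
    GoodAt E J (pathExt γ) (m + 1) ↔ GoodWalk E J (pathExt γ) (m + 1) := by
  unfold GoodAt
  simp only [Nat.add_sub_cancel, pathExt_min]

lemma GoodUpTo.tameSeq {w : ℕ → Fin n × Fin n} {j : ℕ} (h : GoodUpTo E J w j) : TameSeq j w := by
  rcases Nat.eq_zero_or_pos j with rfl | hj
  · exact ⟨0, 0, 1, le_rfl, le_rfl, fun t _ _ => by omega, fun s t _ _ => by omega⟩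
  · refine (h j hj le_rfl).tameSeq.congr fun t ht => ?_
    rw [min_eq_left (by omega)]

lemma stepMat_cen : stepMat (fun _ => Prod.fst) (fun _ => Prod.snd) (fun _ => cen σ) = fun _ => cenMat σ := by
  funext t
  ext x y
  simp only [stepMat, cenMat, Matrix.of_apply]
  rw [sum_eq_single (x, y)]
  · simp
  · rintro ⟨a, b⟩ _ hne
    exact if_neg fun h => hne (Prod.ext h.1 h.2)
  · simp

variable (E J)

lemma walkMat_split (P R : (ℕ → Fin n × Fin n) → Prop) (m : ℕ) :
    walkMat Q σ P m = walkMat Q σ (fun w => P w ∧ R w) m + walkMat Q σ (fun w => P w ∧ ¬ R w) m := by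
  classical
  ext x y
  simp only [walkMat, pathSum, Matrix.of_apply, Matrix.add_apply, ← sum_add_distrib]
  refine sum_congr rfl fun γ _ => ?_
  by_cases hP : P (pathExt γ) <;> by_cases hR : R (pathExt γ) <;> simp [hP, hR]

lemma goodUpTo_succ (w : ℕ → Fin n × Fin n) (j : ℕ) :
    GoodUpTo E J w (j + 1) ↔ GoodUpTo E J w j ∧ GoodAt E J w (j + 1) := by
  unfold GoodUpTo
  constructor
  · intro h; exact ⟨fun t h1 h2 => h t h1 (by omega), h _ (by omega) le_rfl⟩
  · rintro ⟨h1, h2⟩ t ht htj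
    rcases htj.eq_or_lt with rfl | hlt
    · exact h2
    · exact h1 t ht (by omega)

lemma goodMat_add_badMat (m : ℕ) :
    walkMat Q σ (fun w => GoodUpTo E J w m) m = goodMat E J Q σ m + badMat E J Q σ m := by
  rw [walkMat_split Q σ _ (fun w => GoodAt E J w (m + 1))]
  unfold goodMat badMat
  congr 2
  funext w
  exact propext (goodUpTo_succ E J w m).symm

/-- Walks are sorted by the first step at which they cease to be good. Later steps are unrestricted
and sum to a full product. -/
lemma cenMat_mul_pow_mul (m : ℕ) :
    (cenMat σ * Q) ^ m * cenMat σ = goodMat E J Q σ m +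
      ∑ t ∈ range (m + 1), badMat E J Q σ t * (Q * cenMat σ) ^ (m - t) := by
  induction m with
  | zero =>
    have h : walkMat Q σ (fun w => GoodUpTo E J w 0) 0 = cenMat σ := by
      unfold walkMat
      rw [pathSum_zero _ _ _ _ (P := fun w => GoodUpTo E J w 0) (fun w t h1 h2 => by omega), stepMat_cen]
    simp [← h, goodMat_add_badMat]
  | succ m ih =>
    have h1 : (cenMat σ * Q) ^ (m + 1) * cenMat σ = (cenMat σ * Q) ^ m * cenMat σ * (Q * cenMat σ) := by
      rw [pow_succ]; simp only [mul_assoc]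
    have h2 : goodMat E J Q σ m * (Q * cenMat σ) = goodMat E J Q σ (m + 1) + badMat E J Q σ (m + 1) := by
      rw [← goodMat_add_badMat]
      unfold goodMat walkMat
      rw [pathSum_succ, stepMat_cen]
      intro w w' h
      exact GoodUpTo.congr fun t ht => h t (by omega)
    rw [h1, ih, add_mul, h2, sum_mul, sum_range_succ _ (m + 1), Nat.sub_self, pow_zero, mul_one, add_assoc,
      add_comm (badMat E J Q σ (m + 1))]
    congr 2
    refine sum_congr rfl fun t ht => ?_
    have := mem_range.1 ht
    rw [mul_assoc, ← pow_succ, show m + 1 - t = m - t + 1 by omega]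

section
open scoped Matrix.Norms.L2Operator

/-- The factors following a bad step are bounded crudely by 2 each; the smallness of the bad part
pays for this loss. -/
lemma norm_cenMat_mul_pow_le (hn : 0 < n) {Q : Matrix (Fin n) (Fin n) ℝ} (hQ : Q ∈ doublyStochastic ℝ (Fin n))
    (m : ℕ) : ‖(cenMat σ * Q) ^ (m + 1)‖ ≤ ‖goodMat E J Q σ m‖ +
      2 ^ m * ∑ t ∈ range (m + 1), ∑ x, ∑ y, |badMat E J Q σ t x y| := by
  have hQ1 := norm_le_one_of_mem hQ
  have hM := norm_cenMat_le hn σ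
  have hQM : ‖Q * cenMat σ‖ ≤ 2 := (norm_mul_le _ _).trans (by nlinarith [norm_nonneg Q, norm_nonneg (cenMat σ)])
  have hone : ‖(1 : Matrix (Fin n) (Fin n) ℝ)‖ ≤ 1 := norm_le_one_of_mem (one_mem _)
  have hpow : ∀ j, ‖(Q * cenMat σ) ^ j‖ ≤ 2 ^ j := by
    intro j
    induction j with
    | zero => simpa using hone
    | succ j ih =>
      rw [pow_succ, pow_succ]
      exact (norm_mul_le _ _).trans (mul_le_mul ih hQM (norm_nonneg _) (by positivity))
  have h1 : (cenMat σ * Q) ^ (m + 1) = (cenMat σ * Q) ^ m * cenMat σ * Q := by rw [pow_succ, mul_assoc]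
  rw [h1]
  refine (norm_mul_le _ _).trans ((mul_le_of_le_one_right (norm_nonneg _) hQ1).trans ?_)
  rw [cenMat_mul_pow_mul E J]
  refine (norm_add_le _ _).trans (add_le_add_right ?_ _)
  refine (norm_sum_le _ _).trans ?_
  rw [mul_sum]
  refine sum_le_sum fun t ht => ?_
  have := mem_range.1 ht
  refine (norm_mul_le _ _).trans ?_
  rw [mul_comm]
  refine mul_le_mul ((hpow _).trans (pow_le_pow_right₀ (by norm_num) (by omega))) (norm_le_sum_abs _)
    (norm_nonneg _) (by positivity)

end

lemma sum_abs_walkMat_le {Q : Matrix (Fin n) (Fin n) ℝ} (hQ : ∀ i j, 0 ≤ Q i j)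
    (P : (ℕ → Fin n × Fin n) → Prop) [DecidablePred P] (m : ℕ) :
    ∑ x, ∑ y, |walkMat Q σ P m x y| ≤ ∑ γ : Fin (m + 1) → Fin n × Fin n with P (pathExt γ),
      (∏ t ∈ range (m + 1), |cen σ (pathExt γ t)|) *
        ∏ t ∈ range m, lk Q (fun _ => true) (pathExt γ) t := by
  classical
  rw [sum_filter]
  calc _ ≤ ∑ x, ∑ y, ∑ γ : Fin (m + 1) → Fin n × Fin n,
        if P (pathExt γ) ∧ (pathExt γ 0).1 = x ∧ (pathExt γ m).2 = y then
          |pathWeight (fun _ => Prod.fst) (fun _ => Prod.snd) (fun _ => cen σ) (fun _ => Q) m (pathExt γ)| else 0 := by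
        refine sum_le_sum fun x _ => sum_le_sum fun y _ => ?_
        simp only [walkMat, pathSum, Matrix.of_apply]
        refine (abs_sum_le_sum_abs _ _).trans (sum_le_sum fun γ _ => ?_)
        split_ifs <;> simp
    _ = ∑ γ : Fin (m + 1) → Fin n × Fin n, if P (pathExt γ) then
          |pathWeight (fun _ => Prod.fst) (fun _ => Prod.snd) (fun _ => cen σ) (fun _ => Q) m (pathExt γ)| else 0 := by
        simp_rw [sum_comm (s := univ (α := Fin n)) (t := univ (α := Fin (m + 1) → Fin n × Fin n))]
        refine sum_congr rfl fun γ _ => ?_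
        rw [sum_eq_single (pathExt γ 0).1, sum_eq_single (pathExt γ m).2]
        · simp
        · intro y _ hy; exact if_neg fun h => hy h.2.2.symm
        · simp
        · intro x _ hx
          exact sum_eq_zero fun y _ => if_neg fun h => hx h.2.1.symm
        · simp
    _ = _ := by
        refine sum_congr rfl fun γ _ => ?_
        split_ifs
        · unfold pathWeight
          rw [abs_mul, abs_prod, abs_of_nonneg (prod_nonneg fun _ _ => hQ _ _)]
          simp [lk]
        · rfl

variable {E J}

/-- A walk which ceases to be good has high cycle rank or visits `E` at some marked times. -/
lemma exists_marks {η : ℝ} (hn : 0 < n) (hη : 1 / n ≤ η) (hE : (#E : ℝ) ≤ η * n) (hJ : n * η ^ (J + 1) ≤ η)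
    {w : ℕ → Fin n × Fin n} {N : ℕ} (hw : ¬ GoodWalk E J w N) :
    ∃ T₀ ∈ (range N).powerset, Set.InjOn (fun t => comp (fun _ => true) w N (Sum.inl (w t).1)) T₀ ∧
      (∀ t ∈ T₀, (w t).1 ∈ E) ∧
      n * (1 / (n : ℝ)) ^ fwdGenus w N * (#E / n) ^ #T₀ ≤ η * (1 / n) ^ (fwdGenus w N - 2) := by
  have hn' : (0 : ℝ) < n := by exact_mod_cast hn
  have hEn : (#E : ℝ) / n ≤ η := by rwa [div_le_iff₀ hn']
  unfold GoodWalk at hw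
  push Not at hw
  obtain ⟨h0, h1⟩ := hw
  rcases Nat.lt_or_ge (fwdGenus w N) 2 with hlt | hge
  · have hcase : fwdGenus w N = 0 ∨ fwdGenus w N = 1 := by omega
    rcases hcase with hg | hg
    -- At cycle rank 0 the walk passes through distinct classes, so J + 1 visits to `E` restrict J +
    -- 1 different classes.
    · obtain ⟨T₀, hT, hc⟩ := exists_subset_card_eq (show J + 1 ≤ _ from h0 hg)
      have hTN : ∀ t ∈ T₀, t < N := fun t ht => mem_range.1 (mem_filter.1 (hT ht)).1
      refine ⟨T₀, mem_powerset.2 fun t ht => mem_range.2 (hTN t ht), ?_, fun t ht => (mem_filter.1 (hT ht)).2, ?_⟩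
      · have hcl : closings (vtx (fun _ => true) w N) w N = ∅ := card_eq_zero.1 hg
        intro s hs t ht he
        have e : ∀ u < N, comp (fun _ => true) w N (Sum.inl (w u).1) = vtx (fun _ => true) w N u :=
          fun u hu => (vtx_eq_comp_tl (o := fun _ => true) hu).symm
        dsimp only at he
        rw [e s (hTN s hs), e t (hTN t ht)] at he
        exact isMultiWalk_vtx.vertices_injOn (q := N) le_rfl (fun u _ hu => by simp [hcl] at hu) s
          (hTN s hs).le t (hTN t ht).le he
      · rw [hg, hc]
        simp only [zero_tsub, pow_zero, mul_one]
        refine le_trans ?_ hJ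
        gcongr
    · obtain ⟨t, htN, htE⟩ := h1 hg
      refine ⟨{t}, by simpa using htN, by simp, by simpa using htE, ?_⟩
      rw [hg]
      simp only [card_singleton, pow_one, Nat.reduceSub, pow_zero, mul_one]
      rwa [mul_one_div_cancel hn'.ne', one_mul]
  -- At cycle rank at least 2 no visit is needed: n · n ^ (-2) = 1 / n is already at most η.
  · refine ⟨∅, by simp, by simp, by simp, ?_⟩
    obtain ⟨g, hg⟩ := Nat.exists_eq_add_of_le hge
    rw [hg, Nat.add_sub_cancel_left, card_empty, pow_zero, mul_one, pow_add, pow_two]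
    have : (n : ℝ) * (1 / n * (1 / n) * (1 / n) ^ g) = 1 / n * (1 / n) ^ g := by field_simp
    rw [this]
    gcongr

/-- Each unit of cycle rank beyond 2 brings C ^ 30 more codes and a factor x; ranks up to 2 cost at
most C ^ 90. -/
lemma sum_codes_mul_le {C x A : ℝ} (hC : 1 ≤ C) (hx : 0 ≤ x) (hA : 0 ≤ A) (h : C ^ 30 * x ≤ 1) (M : ℕ) :
    ∑ g ∈ range M, C ^ (15 * 2 * (g + 1)) * (A * x ^ (g - 2)) ≤ M * (C ^ 90 * A) := by
  rw [← nsmul_eq_mul, ← card_range M, ← sum_const, card_range]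
  refine sum_le_sum fun g _ => ?_
  have e2 : C ^ (15 * 2 * (g + 1)) ≤ C ^ 90 * (C ^ 30) ^ (g - 2) := by
    rw [← pow_mul, ← pow_add]
    exact pow_le_pow_right₀ hC (by omega)
  have e3 : (C ^ 30) ^ (g - 2) * x ^ (g - 2) ≤ 1 := by
    rw [← mul_pow]
    exact pow_le_one₀ (by positivity) h
  calc _ ≤ C ^ 90 * (C ^ 30) ^ (g - 2) * (A * x ^ (g - 2)) := by gcongr
    _ = C ^ 90 * A * ((C ^ 30) ^ (g - 2) * x ^ (g - 2)) := by ring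
    _ ≤ C ^ 90 * A * 1 := by gcongr
    _ = _ := mul_one _

/-- The first moment of almost tame walks which visit `E` at given times. -/
lemma sum_permAvg_abs_marked_le {Q : Matrix (Fin n) (Fin n) ℝ} (hQ : Q ∈ doublyStochastic ℝ (Fin n)) {η : ℝ}
    (hη : 0 ≤ η) (m : ℕ) (hn : 0 < n) (hNn : 2 * (m + 1) ^ 2 ≤ n) (hm : (5 * ((m : ℝ) + 2) ^ 3) ^ 30 ≤ n)
    (T₀ : Finset ℕ) (hT₀ : ∀ t ∈ T₀, t < m + 1) (Ω : Finset (Fin (m + 1) → Fin n × Fin n))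
    (htame : ∀ γ ∈ Ω, TameSeq m (pathExt γ))
    (hinj : ∀ γ ∈ Ω, Set.InjOn (fun t => comp (fun _ => true) (pathExt γ) (m + 1) (Sum.inl (pathExt γ t).1)) T₀)
    (hE : ∀ γ ∈ Ω, ∀ t ∈ T₀, (pathExt γ t).1 ∈ E)
    (hb : ∀ γ ∈ Ω, n * (1 / (n : ℝ)) ^ fwdGenus (pathExt γ) (m + 1) * (#E / n) ^ #T₀ ≤
        η * (1 / n) ^ (fwdGenus (pathExt γ) (m + 1) - 2)) :
    ∑ γ ∈ Ω, permAvg (fun σ => ∏ t ∈ range (m + 1), |cen σ (pathExt γ t)|) *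
      ∏ t ∈ range m, lk Q (fun _ => true) (pathExt γ) t ≤
      (m + 2) * ((5 * ((m : ℝ) + 2) ^ 3) ^ 90 * (2 * 2 ^ (m + 1) * η)) := by
  have hn' : (0 : ℝ) < n := by exact_mod_cast hn
  have hfib : ∀ γ₀ ∈ Ω, ∀ Ω' ⊆ Ω, (∀ γ ∈ Ω', SameKernel (m + 1) (pathExt γ) (pathExt γ₀)) →
      ∑ γ ∈ Ω', permAvg (fun σ => ∏ t ∈ range (m + 1), |cen σ (pathExt γ t)|) *
      ∏ t ∈ range m, lk Q (fun _ => true) (pathExt γ) t ≤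
      2 * 2 ^ (m + 1) * η *
        (1 / (n : ℝ)) ^ (genus (vtx (fun _ => true) (pathExt γ₀) (m + 1)) (pathExt γ₀) (m + 1) - 2) := by
    intro γ₀ hγ₀ Ω' hΩ' hsame
    refine (sum_permAvg_abs_mul_prod_lk_le (K := Q) (o := fun _ => true) (w₀ := pathExt γ₀)
        (fun _ _ => nonneg_of_mem_doublyStochastic hQ)
        (fun _ _ => le_one_of_mem_doublyStochastic hQ) (fun i => (sum_row_of_mem_doublyStochastic hQ i).le)
        (fun i => (sum_col_of_mem_doublyStochastic hQ i).le) (Nat.succ_pos m) (fun _ _ h => absurd rfl h)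
        hNn Ω' (fun γ => pathExt γ) (fun γ _ γ' _ h => pathExt_injective h) hsame E T₀ hT₀
        (hinj γ₀ hγ₀) (fun γ hγ => hE γ (hΩ' hγ))).trans ?_
    have := mul_le_mul_of_nonneg_left (hb γ₀ hγ₀) (show (0 : ℝ) ≤ 2 * 2 ^ (m + 1) by positivity)
    unfold fwdGenus at this
    simp only [mul_assoc] at this ⊢
    exact this
  -- The first m steps are tame and the last step, where goodness may fail, forms a second piece.
  have := sum_le_sum_genus (N := m + 1) (S := 2) (o := fun _ => true) Ω (fun γ => pathExt γ) _
    (fun g => 2 * 2 ^ (m + 1) * η * (1 / (n : ℝ)) ^ (g - 2)) (by omega) (by omega) (fun g => by positivity)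
    (fun γ hγ => tamePieces_snoc (htame γ hγ)) hfib
  refine this.trans ?_
  have h1 : (1 : ℝ) ≤ (m : ℝ) + 2 := by linarith [Nat.cast_nonneg (α := ℝ) m]
  have hC1 : (1 : ℝ) ≤ 5 * ((m : ℝ) + 2) ^ 3 := by
    have := one_le_pow₀ h1 (n := 3)
    linarith
  have := sum_codes_mul_le (C := 5 * ((m : ℝ) + 2) ^ 3) (x := 1 / (n : ℝ)) (A := 2 * 2 ^ (m + 1) * η) hC1
    (by positivity) (by positivity) (by rw [mul_one_div]; exact (div_le_one hn').2 hm) (m + 1 + 1)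
  push_cast at this ⊢
  rw [show (m : ℝ) + 1 + 1 = m + 2 by ring] at this ⊢
  exact this

/-- The first moment of the contribution of bad walks. -/
lemma permAvg_sum_abs_badMat_le {Q : Matrix (Fin n) (Fin n) ℝ} (hQ : Q ∈ doublyStochastic ℝ (Fin n)) {η : ℝ}
    (hη : 1 / n ≤ η) (hE : (#E : ℝ) ≤ η * n) (hJ : n * η ^ (J + 1) ≤ η) (m : ℕ)
    (hm : (5 * ((m : ℝ) + 2) ^ 3) ^ 30 ≤ n) :
    permAvg (fun σ => ∑ x, ∑ y, |badMat E J Q σ m x y|) ≤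
      4 ^ (m + 1) * (5 * ((m : ℝ) + 2) ^ 3) ^ 91 * η := by
  classical
  set C : ℝ := 5 * ((m : ℝ) + 2) ^ 3 with hC
  have hC1 : 2 * ((m : ℝ) + 2) ≤ C := by
    have h : (1 : ℝ) ≤ (m : ℝ) + 2 := by linarith [Nat.cast_nonneg (α := ℝ) m]
    have : (m : ℝ) + 2 ≤ (m + 2) ^ 3 := le_self_pow₀ h (by norm_num)
    rw [hC]; nlinarith
  have hm0 := Nat.cast_nonneg (α := ℝ) m
  have hC1' : 1 ≤ C := by linarith
  have hNn : 2 * (m + 1) ^ 2 ≤ n := by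
    have h1 : (2 : ℝ) * (m + 1) ^ 2 ≤ C ^ 2 := by nlinarith
    have h2 : C ^ 2 ≤ C ^ 30 := pow_le_pow_right₀ hC1' (by norm_num)
    exact_mod_cast h1.trans (h2.trans hm)
  have hn : 0 < n := lt_of_lt_of_le (by positivity) hNn
  have hn' : (0 : ℝ) < n := by exact_mod_cast hn
  have hη0 : 0 ≤ η := le_trans (by positivity) hη
  have hQ0 : ∀ i j, 0 ≤ Q i j := fun _ _ => nonneg_of_mem_doublyStochastic hQ
  set P : (ℕ → Fin n × Fin n) → Prop := fun w => GoodUpTo E J w m ∧ ¬ GoodAt E J w (m + 1) with hP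
  set Ω : Finset (Fin (m + 1) → Fin n × Fin n) := {γ | P (pathExt γ)} with hΩ
  set f : (Fin (m + 1) → Fin n × Fin n) → ℝ := fun γ =>
    permAvg (fun σ => ∏ t ∈ range (m + 1), |cen σ (pathExt γ t)|) *
      ∏ t ∈ range m, lk Q (fun _ => true) (pathExt γ) t with hf
  have h1 : permAvg (fun σ => ∑ x, ∑ y, |badMat E J Q σ m x y|) ≤ ∑ γ ∈ Ω, f γ := by
    refine (permAvg_mono fun σ => sum_abs_walkMat_le σ hQ0 P m).trans (le_of_eq ?_)
    rw [permAvg_sum]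
    refine sum_congr rfl fun γ _ => ?_
    simp only [mul_comm (∏ t ∈ range (m + 1), |cen _ (pathExt γ t)|)]
    rw [permAvg_const_mul, hf, mul_comm]
  have hmk : ∀ γ ∈ Ω, ∃ T₀ ∈ (range (m + 1)).powerset,
      Set.InjOn (fun t => comp (fun _ => true) (pathExt γ) (m + 1) (Sum.inl (pathExt γ t).1)) T₀ ∧
      (∀ t ∈ T₀, (pathExt γ t).1 ∈ E) ∧
      n * (1 / (n : ℝ)) ^ fwdGenus (pathExt γ) (m + 1) * (#E / n) ^ #T₀ ≤
        η * (1 / n) ^ (fwdGenus (pathExt γ) (m + 1) - 2) := by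
    intro γ hγ
    refine exists_marks hn hη hE hJ ?_
    rw [← goodAt_pathExt]
    exact (mem_filter.1 hγ).2.2
  choose! T hT hTinj hTE hTb using hmk
  have h2 : ∀ T₀ ∈ (range (m + 1)).powerset, ∑ γ ∈ Ω with T γ = T₀, f γ ≤
      (m + 2) * (C ^ 90 * (2 * 2 ^ (m + 1) * η)) := by
    intro T₀ hT₀
    refine sum_permAvg_abs_marked_le (E := E) hQ hη0 m hn hNn hm T₀
      (fun t ht => mem_range.1 (mem_powerset.1 hT₀ ht)) _ ?_ ?_ ?_ ?_
    · intro γ hγ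
      exact (mem_filter.1 (mem_filter.1 hγ).1).2.1.tameSeq
    all_goals
      intro γ hγ
      obtain ⟨ha, rfl⟩ := mem_filter.1 hγ
    · exact hTinj γ ha
    · exact hTE γ ha
    · exact hTb γ ha
  -- Sorting by the marked times costs 2 ^ (m + 1), one of the two such factors in 4 ^ (m + 1).
  rw [← sum_fiberwise_of_maps_to hT] at h1
  refine h1.trans ((sum_le_sum h2).trans ?_)
  rw [sum_const, card_powerset, card_range, nsmul_eq_mul]
  push_cast
  clear_value C
  calc _ = (2 * 2 : ℝ) ^ (m + 1) * (C ^ 90 * (2 * (m + 2))) * η := by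
        rw [mul_pow]; generalize C ^ 90 = z; ring
    _ ≤ (2 * 2 : ℝ) ^ (m + 1) * (C ^ 90 * C) * η := by gcongr
    _ = _ := by rw [← pow_succ, show (2 * 2 : ℝ) = 4 by norm_num]

end slots

/-! ### The trace of a power as a sum over alternating concatenations of good walks. -/

lemma prod_range_mul_eq {M : Type*} [CommMonoid M] (f : ℕ → M) (S k : ℕ) :
    ∏ t ∈ range (S * k), f t = ∏ r ∈ range S, ∏ j ∈ range k, f (r * k + j) := by
  induction S with
  | zero => simp
  | succ S ih => rw [Nat.add_mul, one_mul, prod_range_add, ih, prod_range_succ]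

section trace
variable {n m : ℕ} (E : Finset (Fin n)) (J : ℕ) (Q : Matrix (Fin n) (Fin n) ℝ)

/-- The left end of a walk for even `r`, its right end for odd `r`. -/
def walkSrc (r : ℕ) (γ : Fin (m + 1) → Fin n × Fin n) : Fin n :=
  if Even r then (pathExt γ 0).1 else (pathExt γ m).2

/-- The right end of a walk for even `r`, its left end for odd `r`. -/
def walkTgt (r : ℕ) (γ : Fin (m + 1) → Fin n × Fin n) : Fin n :=
  if Even r then (pathExt γ m).2 else (pathExt γ 0).1

open Classical in
/-- The weight of a good walk. -/
def goodWeight (σ : Equiv.Perm (Fin n)) (γ : Fin (m + 1) → Fin n × Fin n) : ℝ :=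
  if GoodUpTo E J (pathExt γ) (m + 1) then
    (∏ t ∈ range (m + 1), cen σ (pathExt γ t)) * ∏ t ∈ range m, Q (pathExt γ t).2 (pathExt γ (t + 1)).1
  else 0

/-- The concatenation of walks traversed alternately forwards and backwards. -/
def concat {p : ℕ} (Γ : Fin (p + 1) → Fin (m + 1) → Fin n × Fin n) (t : ℕ) : Fin n × Fin n :=
  pathExt (pathExt Γ (t / (m + 1)))
    (if Even (t / (m + 1)) then t % (m + 1) else m - t % (m + 1))

/-- The directions of the steps of a concatenation. -/
def altSign (m t : ℕ) : Bool := decide (Even (t / (m + 1)))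

lemma stepMat_goodWeight (σ : Equiv.Perm (Fin n)) (r : ℕ) :
    stepMat walkSrc walkTgt (fun _ => goodWeight (m := m) E J Q σ) r =
      if Even r then goodMat E J Q σ m else (goodMat E J Q σ m).transpose := by
  classical
  have key : ∀ x y, goodMat E J Q σ m x y = ∑ γ : Fin (m + 1) → Fin n × Fin n,
      if (pathExt γ 0).1 = x ∧ (pathExt γ m).2 = y then goodWeight E J Q σ γ else 0 := by
    intro x y
    simp only [goodMat, walkMat, pathSum, Matrix.of_apply]
    refine sum_congr rfl fun γ _ => ?_
    unfold goodWeight pathWeight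
    by_cases h1 : GoodUpTo E J (pathExt γ) (m + 1) <;> simp [h1]
  ext x y
  by_cases hr : Even r
  · simp [stepMat, walkSrc, walkTgt, hr, key]
  · simp [stepMat, walkSrc, walkTgt, hr, key, and_comm]

/-- Odd steps are read backwards and produce transposes; the identity as link matrix forces
consecutive ends to agree. -/
lemma pathSum_goodWeight (σ : Equiv.Perm (Fin n)) (p : ℕ) :
    pathSum walkSrc walkTgt (fun _ => goodWeight (m := m) E J Q σ) (fun _ => 1) (fun _ => True) (2 * p + 1) =
      (goodMat E J Q σ m * (goodMat E J Q σ m).transpose) ^ (p + 1) := by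
  induction p with
  | zero =>
    rw [pathSum_succ _ _ _ _ (fun _ _ _ => Iff.rfl), pathSum_zero _ _ _ _ (fun _ => trivial),
      stepMat_goodWeight, stepMat_goodWeight]
    simp
  | succ p ih =>
    rw [show 2 * (p + 1) + 1 = 2 * p + 1 + 1 + 1 by ring, pathSum_succ _ _ _ _ (fun _ _ _ => Iff.rfl),
      pathSum_succ _ _ _ _ (fun _ _ _ => Iff.rfl), ih, stepMat_goodWeight, stepMat_goodWeight]
    have h1 : Even (2 * p + 1 + 1) := ⟨p + 1, by ring⟩
    have h2 : ¬ Even (2 * p + 1 + 1 + 1) := by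
      rw [Nat.not_even_iff_odd]; exact h1.add_one
    rw [if_pos h1, if_neg h2, pow_succ _ (p + 1)]
    simp only [one_mul, mul_assoc]

variable {E J Q}

/-- Sequences of good walks with matching ends. -/
def IsChain (E : Finset (Fin n)) (J : ℕ) {p : ℕ} (Γ : Fin (p + 1) → Fin (m + 1) → Fin n × Fin n) : Prop :=
  (∀ r < p + 1, GoodUpTo E J (pathExt (pathExt Γ r)) (m + 1)) ∧
    ∀ r < p, walkTgt r (pathExt Γ r) = walkSrc (r + 1) (pathExt Γ (r + 1))

lemma div_mod_block {r j : ℕ} (hj : j < m + 1) : (r * (m + 1) + j) / (m + 1) = r ∧ (r * (m + 1) + j) % (m + 1) = j := by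
  constructor
  · rw [mul_comm, Nat.mul_add_div (Nat.succ_pos m), Nat.div_eq_of_lt hj, add_zero]
  · rw [mul_comm, Nat.mul_add_mod, Nat.mod_eq_of_lt hj]

lemma concat_block {p : ℕ} (Γ : Fin (p + 1) → Fin (m + 1) → Fin n × Fin n) {r j : ℕ} (hj : j < m + 1) :
    concat Γ (r * (m + 1) + j) = pathExt (pathExt Γ r) (if Even r then j else m - j) := by
  unfold concat
  rw [(div_mod_block hj).1, (div_mod_block hj).2]

lemma altSign_block {r j : ℕ} (hj : j < m + 1) : altSign m (r * (m + 1) + j) = decide (Even r) := by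
  unfold altSign
  rw [(div_mod_block hj).1]

lemma prod_concat {M : Type*} [CommMonoid M] {p : ℕ} (Γ : Fin (p + 1) → Fin (m + 1) → Fin n × Fin n)
    (f : Fin n × Fin n → M) :
    ∏ t ∈ range ((p + 1) * (m + 1)), f (concat Γ t) =
      ∏ r ∈ range (p + 1), ∏ j ∈ range (m + 1), f (pathExt (pathExt Γ r) j) := by
  rw [prod_range_mul_eq]
  refine prod_congr rfl fun r _ => ?_
  by_cases hr : Even r
  · refine prod_congr rfl fun j hj => ?_
    rw [concat_block Γ (mem_range.1 hj), if_pos hr]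
  · rw [← prod_range_reflect]
    refine prod_congr rfl fun j hj => ?_
    have := mem_range.1 hj
    rw [concat_block Γ (by omega), if_neg hr]
    congr 2
    omega

/-- At the junction of two blocks the direction changes, and `lk` is 1 there. -/
lemma prod_lk_concat (K : Matrix (Fin n) (Fin n) ℝ) {p : ℕ} (Γ : Fin (p + 1) → Fin (m + 1) → Fin n × Fin n) :
    ∏ t ∈ range ((p + 1) * (m + 1) - 1), lk K (altSign m) (concat Γ) t =
      ∏ r ∈ range (p + 1), ∏ j ∈ range m, K (pathExt (pathExt Γ r) j).2 (pathExt (pathExt Γ r) (j + 1)).1 := by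
  have hlast : ∀ r, lk K (altSign m) (concat Γ) (r * (m + 1) + m) = 1 := by
    intro r
    unfold lk
    have e : r * (m + 1) + m + 1 = (r + 1) * (m + 1) + 0 := by ring
    rw [e, altSign_block (by omega), altSign_block (by omega), if_neg]
    simp only [decide_eq_decide, Nat.even_add_one]
    tauto
  have hN : (p + 1) * (m + 1) - 1 + 1 = (p + 1) * (m + 1) :=
    Nat.sub_add_cancel (Nat.mul_pos (Nat.succ_pos p) (Nat.succ_pos m))
  have hN' : (p + 1) * (m + 1) - 1 = p * (m + 1) + m := by rw [Nat.add_mul, one_mul]; omega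
  have h1 : ∏ t ∈ range ((p + 1) * (m + 1) - 1), lk K (altSign m) (concat Γ) t =
      ∏ t ∈ range ((p + 1) * (m + 1)), lk K (altSign m) (concat Γ) t := by
    conv_rhs => rw [← hN]
    rw [prod_range_succ, hN', hlast, mul_one]
  rw [h1, prod_range_mul_eq]
  refine prod_congr rfl fun r _ => ?_
  rw [prod_range_succ, hlast, mul_one]
  have hl : ∀ j ∈ range m, lk K (altSign m) (concat Γ) (r * (m + 1) + j) =
      if Even r then K (pathExt (pathExt Γ r) j).2 (pathExt (pathExt Γ r) (j + 1)).1 else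
        K (pathExt (pathExt Γ r) (m - (j + 1))).2 (pathExt (pathExt Γ r) (m - j)).1 := by
    intro j hj
    have := mem_range.1 hj
    unfold lk
    rw [add_assoc, altSign_block (by omega), altSign_block (by omega), concat_block Γ (by omega),
      concat_block Γ (by omega), if_pos rfl]
    by_cases hr : Even r <;> simp [hr]
  rw [prod_congr rfl hl]
  by_cases hr : Even r
  · simp only [hr, if_true]
  · simp only [hr, if_false]
    rw [← prod_range_reflect]
    refine prod_congr rfl fun j hj => ?_
    have := mem_range.1 hj
    rw [show m - (m - 1 - j + 1) = j by omega, show m - (m - 1 - j) = j + 1 by omega]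

lemma hd_concat {p : ℕ} {Γ : Fin (p + 1) → Fin (m + 1) → Fin n × Fin n} (hΓ : IsChain E J Γ) {t : ℕ}
    (ht : t + 1 < (p + 1) * (m + 1)) (ho : altSign m t ≠ altSign m (t + 1)) :
    hd (altSign m) (concat Γ) t = tl (altSign m) (concat Γ) (t + 1) := by
  obtain ⟨r, j, hj, rfl⟩ : ∃ r j, j < m + 1 ∧ t = r * (m + 1) + j :=
    ⟨t / (m + 1), t % (m + 1), Nat.mod_lt _ (Nat.succ_pos m), (Nat.div_add_mod' _ _).symm⟩
  rcases Nat.lt_or_ge (j + 1) (m + 1) with hlt | hge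
  · rw [add_assoc, altSign_block hj, altSign_block hlt] at ho
    exact absurd rfl ho
  · obtain rfl : j = m := by omega
    have hr : r < p := by
      by_contra hge
      have := Nat.mul_le_mul_right (j + 1) (show p ≤ r by omega)
      rw [Nat.add_mul, one_mul] at ht
      omega
    have e : r * (j + 1) + j + 1 = (r + 1) * (j + 1) + 0 := by ring
    have := hΓ.2 r hr
    unfold walkSrc walkTgt at this
    unfold hd tl
    rw [e, altSign_block hj, altSign_block (by omega), concat_block Γ hj, concat_block Γ (by omega)]
    by_cases hr : Even r
    · have hr' : ¬ Even (r + 1) := by rw [Nat.even_add_one]; tauto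
      simp only [hr, hr', if_true, if_false, decide_true, decide_false, Bool.false_eq_true, Nat.sub_zero] at this ⊢
      rw [this]
    · have hr' : Even (r + 1) := by rw [Nat.even_add_one]; exact hr
      simp only [hr, hr', if_true, if_false, decide_true, decide_false, Bool.false_eq_true, Nat.sub_self] at this ⊢
      rw [this]

lemma tamePieces_concat {p : ℕ} {Γ : Fin (p + 1) → Fin (m + 1) → Fin n × Fin n} (hΓ : IsChain E J Γ) :
    ∃ D, TamePieces ((p + 1) * (m + 1)) (p + 1) (concat Γ) (altSign m) D := by
  refine tamePieces_of_blocks (Nat.succ_pos m) (fun t => rfl) fun r hr => ?_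
  have h := (hΓ.1 r hr).tameSeq
  by_cases he : Even r
  · refine h.congr fun j hj => ?_
    rw [concat_block Γ hj, if_pos he]
  · refine h.reflect.congr fun j hj => ?_
    rw [concat_block Γ hj, if_neg he, Nat.add_sub_cancel]

lemma concat_injective {p : ℕ} {Γ Γ' : Fin (p + 1) → Fin (m + 1) → Fin n × Fin n}
    (h : ∀ t < (p + 1) * (m + 1), concat Γ t = concat Γ' t) : Γ = Γ' := by
  refine pathExt_injective fun r hr => pathExt_injective fun j hj => ?_
  have hlt : ∀ i < m + 1, r * (m + 1) + i < (p + 1) * (m + 1) := by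
    intro i hi
    have := Nat.mul_le_mul_right (m + 1) (show r + 1 ≤ p + 1 from hr)
    rw [Nat.add_mul, one_mul] at this
    omega
  by_cases he : Even r
  · have := h _ (hlt j hj)
    rwa [concat_block Γ hj, concat_block Γ' hj, if_pos he] at this
  · have := h _ (hlt (m - j) (by omega))
    rwa [concat_block Γ (by omega), concat_block Γ' (by omega), if_neg he, show m - (m - j) = j by omega] at this

/-- The kernel `Q` scaled by `lam` outside the columns in `E`. -/
def scaledKer (E : Finset (Fin n)) (Q : Matrix (Fin n) (Fin n) ℝ) (lam : ℝ) : Matrix (Fin n) (Fin n) ℝ :=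
  Matrix.of fun y x => if x ∈ E then Q y x else lam * Q y x

/-- Every link outside `E` has been multiplied by lam; a good walk has at most J links into `E`,
whence the correction lam ^ J. -/
lemma prod_le_prod_scaledKer {lam : ℝ} (hlam : 1 ≤ lam) (hQ : ∀ i j, 0 ≤ Q i j)
    {γ : Fin (m + 1) → Fin n × Fin n} (hγ : GoodUpTo E J (pathExt γ) (m + 1)) :
    ∏ t ∈ range m, Q (pathExt γ t).2 (pathExt γ (t + 1)).1 ≤ (1 / lam) ^ m * lam ^ J *
      ∏ t ∈ range m, scaledKer E Q lam (pathExt γ t).2 (pathExt γ (t + 1)).1 := by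
  have hl : 0 < lam := by linarith
  have hc := ((goodAt_pathExt γ).1 (hγ (m + 1) (by omega) le_rfl)).card_le
  have hcard : #{t ∈ range m | (pathExt γ (t + 1)).1 ∈ E} ≤ J := by
    refine le_trans ?_ hc
    apply card_le_card_of_injOn (· + 1)
    · intro t ht
      obtain ⟨a, b⟩ := mem_filter.1 (mem_coe.1 ht)
      have := mem_range.1 a
      exact mem_filter.2 ⟨mem_range.2 (Nat.succ_lt_succ this), b⟩
    · intro s _ t _ h; simpa using h
  have hnn : 0 ≤ ∏ t ∈ range m, scaledKer E Q lam (pathExt γ t).2 (pathExt γ (t + 1)).1 := by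
    refine prod_nonneg fun t _ => ?_
    simp only [scaledKer, Matrix.of_apply]
    have := hQ (pathExt γ t).2 (pathExt γ (t + 1)).1
    split_ifs <;> positivity
  have heq : ∏ t ∈ range m, Q (pathExt γ t).2 (pathExt γ (t + 1)).1 =
      (1 / lam) ^ m * lam ^ #{t ∈ range m | (pathExt γ (t + 1)).1 ∈ E} *
      ∏ t ∈ range m, scaledKer E Q lam (pathExt γ t).2 (pathExt γ (t + 1)).1 := by
    have h1 : lam ^ #{t ∈ range m | (pathExt γ (t + 1)).1 ∈ E} =
        ∏ t ∈ range m, if (pathExt γ (t + 1)).1 ∈ E then lam else 1 := by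
      rw [← prod_filter, prod_const]
    have h2 : (1 / lam) ^ m = ∏ _t ∈ range m, 1 / lam := by simp
    rw [h1, h2, ← prod_mul_distrib, ← prod_mul_distrib]
    refine prod_congr rfl fun t _ => ?_
    simp only [scaledKer, Matrix.of_apply]
    split_ifs <;> field_simp
  rw [heq]
  refine mul_le_mul_of_nonneg_right ?_ hnn
  exact mul_le_mul_of_nonneg_left (pow_le_pow_right₀ hlam hcard) (by positivity)

lemma pathWeight_of_isChain {p : ℕ} {Γ : Fin (p + 1) → Fin (m + 1) → Fin n × Fin n} (hΓ : IsChain E J Γ)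
    (σ : Equiv.Perm (Fin n)) :
    pathWeight walkSrc walkTgt (fun _ => goodWeight E J Q σ) (fun _ => 1) p (pathExt Γ) =
      (∏ r ∈ range (p + 1), ∏ t ∈ range m, Q (pathExt (pathExt Γ r) t).2 (pathExt (pathExt Γ r) (t + 1)).1) *
        ∏ t ∈ range ((p + 1) * (m + 1)), cen σ (concat Γ t) := by
  have h1 : ∀ r ∈ range (p + 1), goodWeight E J Q σ (pathExt Γ r) =
      (∏ t ∈ range m, Q (pathExt (pathExt Γ r) t).2 (pathExt (pathExt Γ r) (t + 1)).1) *
        ∏ t ∈ range (m + 1), cen σ (pathExt (pathExt Γ r) t) := by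
    intro r hr
    rw [goodWeight, if_pos (hΓ.1 r (mem_range.1 hr)), mul_comm]
  have h2 : ∀ r ∈ range p, (1 : Matrix (Fin n) (Fin n) ℝ) (walkTgt r (pathExt Γ r))
      (walkSrc (r + 1) (pathExt Γ (r + 1))) = 1 := by
    intro r hr
    rw [hΓ.2 r (mem_range.1 hr), Matrix.one_apply_eq]
  unfold pathWeight
  rw [prod_congr rfl h1, prod_congr rfl h2, prod_const_one, mul_one, prod_mul_distrib, prod_concat Γ (cen σ)]

lemma pathWeight_of_not_isChain {p : ℕ} {Γ : Fin (p + 1) → Fin (m + 1) → Fin n × Fin n} (hΓ : ¬ IsChain E J Γ)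
    (σ : Equiv.Perm (Fin n)) :
    pathWeight walkSrc walkTgt (fun _ => goodWeight E J Q σ) (fun _ => 1) p (pathExt Γ) = 0 := by
  unfold IsChain at hΓ
  unfold pathWeight
  rw [not_and_or] at hΓ
  rcases hΓ with h | h
  · push Not at h
    obtain ⟨r, hr, hb⟩ := h
    have : goodWeight E J Q σ (pathExt Γ r) = 0 := by rw [goodWeight, if_neg hb]
    rw [prod_eq_zero (mem_range.2 hr) this, zero_mul]
  · push Not at h
    obtain ⟨r, hr, hb⟩ := h
    have : (1 : Matrix (Fin n) (Fin n) ℝ) (walkTgt r (pathExt Γ r)) (walkSrc (r + 1) (pathExt Γ (r + 1))) = 0 :=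
      Matrix.one_apply_ne hb
    rw [prod_eq_zero (s := range p) (mem_range.2 hr) this, mul_zero]

open Classical in
lemma permAvg_trace_le {lam : ℝ} (hlam : 1 ≤ lam) (hQ : ∀ i j, 0 ≤ Q i j) (i : ℕ) :
    permAvg (fun σ => ((goodMat E J Q σ m * (goodMat E J Q σ m).transpose) ^ (2 * 2 ^ i)).trace) ≤
      ((1 / lam) ^ m * lam ^ J) ^ (4 * 2 ^ i) *
      ∑ Γ : Fin (4 * 2 ^ i - 1 + 1) → Fin (m + 1) → Fin n × Fin n with IsChain E J Γ,
        |permAvg (fun σ => ∏ t ∈ range (4 * 2 ^ i * (m + 1)), cen σ (concat Γ t))| *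
          ∏ t ∈ range (4 * 2 ^ i * (m + 1) - 1), lk (scaledKer E Q lam) (altSign m) (concat Γ) t := by
  obtain ⟨p, hp⟩ : ∃ p, 2 * 2 ^ i = p + 1 := ⟨2 * 2 ^ i - 1, by have := Nat.one_le_two_pow (n := i); omega⟩
  have hS : 4 * 2 ^ i = 2 * p + 1 + 1 := by omega
  rw [hS, hp, Nat.add_sub_cancel]
  simp_rw [← pathSum_goodWeight]
  set S := 2 * p + 1 with hSdef
  have h1 : ∀ σ : Equiv.Perm (Fin n), (pathSum walkSrc walkTgt (fun _ => goodWeight (m := m) E J Q σ) (fun _ => 1)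
      (fun _ => True) S).trace = ∑ x, ∑ Γ : Fin (S + 1) → Fin (m + 1) → Fin n × Fin n,
        if walkSrc 0 (pathExt Γ 0) = x ∧ walkTgt S (pathExt Γ S) = x then
          pathWeight walkSrc walkTgt (fun _ => goodWeight E J Q σ) (fun _ => 1) S (pathExt Γ) else 0 := by
    intro σ
    simp [Matrix.trace, pathSum]
  have h2 : ∀ Γ : Fin (S + 1) → Fin (m + 1) → Fin n × Fin n,
      |permAvg (fun σ => pathWeight walkSrc walkTgt (fun _ => goodWeight E J Q σ) (fun _ => 1) S (pathExt Γ))| ≤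
      if IsChain E J Γ then ((1 / lam) ^ m * lam ^ J) ^ (S + 1) *
        (|permAvg (fun σ => ∏ t ∈ range ((S + 1) * (m + 1)), cen σ (concat Γ t))| *
          ∏ t ∈ range ((S + 1) * (m + 1) - 1), lk (scaledKer E Q lam) (altSign m) (concat Γ) t) else 0 := by
    intro Γ
    split_ifs with hΓ
    · simp_rw [pathWeight_of_isChain hΓ]
      rw [permAvg_const_mul, abs_mul, mul_comm, mul_left_comm]
      refine mul_le_mul_of_nonneg_left ?_ (abs_nonneg _)
      have hnn : ∀ r ∈ range (S + 1), 0 ≤ ∏ t ∈ range m,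
          Q (pathExt (pathExt Γ r) t).2 (pathExt (pathExt Γ r) (t + 1)).1 :=
        fun r _ => prod_nonneg fun _ _ => hQ _ _
      rw [abs_of_nonneg (prod_nonneg hnn), prod_lk_concat]
      refine (prod_le_prod hnn fun r hr => prod_le_prod_scaledKer hlam hQ (hΓ.1 r (mem_range.1 hr))).trans
        (le_of_eq ?_)
      rw [prod_mul_distrib, prod_const, card_range]
    · simp_rw [pathWeight_of_not_isChain hΓ]
      simp [permAvg]
  simp_rw [h1]
  rw [permAvg_sum]
  simp_rw [permAvg_sum]
  rw [sum_comm, mul_sum, sum_filter]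
  refine sum_le_sum fun Γ _ => le_trans ?_ (h2 Γ)
  set v := permAvg (fun σ => pathWeight walkSrc walkTgt (fun _ => goodWeight E J Q σ) (fun _ => 1) S (pathExt Γ))
  -- The closing condition of the trace is dropped; only the starting point is kept.
  have h3 : ∀ x, permAvg (fun σ => if walkSrc 0 (pathExt Γ 0) = x ∧ walkTgt S (pathExt Γ S) = x then
          pathWeight walkSrc walkTgt (fun _ => goodWeight E J Q σ) (fun _ => 1) S (pathExt Γ) else 0) ≤
      if walkSrc 0 (pathExt Γ 0) = x then |v| else 0 := by
    intro x
    by_cases hx : walkSrc 0 (pathExt Γ 0) = x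
    · by_cases hy : walkTgt S (pathExt Γ S) = x
      · simp only [hx, hy, and_self, if_true]; exact le_abs_self v
      · simp [hx, hy, permAvg]
    · simp [hx, permAvg]
  refine (sum_le_sum fun x _ => h3 x).trans ?_
  rw [sum_ite_eq]
  simp

end trace

/-! ### High moments of the norm of the good part. -/

section moment
open scoped Matrix.Norms.L2Operator
variable {n m : ℕ} {E : Finset (Fin n)} {J : ℕ} {Q : Matrix (Fin n) (Fin n) ℝ}

/-- A unit of cycle rank costs c ^ p codes and a factor B ^ 4 and gains y; by assumption it gains at
least as much as it costs. -/
lemma sum_codes_mul_pow_le {c y A B : ℝ} (hA : 0 ≤ A) (hB : 0 ≤ B) (hy : 0 ≤ y) (hc : 1 ≤ c) (p : ℕ)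
    (h : c ^ p * (B ^ 4 * y) ≤ 1) (s M : ℕ) :
    ∑ g ∈ range M, c ^ (p * (g + 1)) * (A * B ^ (4 * g + s) * y ^ g) ≤ M * (c ^ p * (A * B ^ s)) := by
  rw [← nsmul_eq_mul, ← card_range M, ← sum_const, card_range]
  refine sum_le_sum fun g _ => ?_
  have h1 : (c ^ p * (B ^ 4 * y)) ^ g ≤ 1 := pow_le_one₀ (by positivity) h
  calc _ = c ^ p * (A * B ^ s) * (c ^ p * (B ^ 4 * y)) ^ g := by
        rw [pow_add B, pow_mul B, mul_pow, mul_pow, ← pow_mul c, mul_add, mul_one, pow_add c]; ring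
    _ ≤ c ^ p * (A * B ^ s) * 1 := by gcongr
    _ = _ := mul_one _

/-- The moments of the norm of the contribution of good walks. -/
lemma permAvg_norm_goodMat_pow_le (hQ : Q ∈ doublyStochastic ℝ (Fin n)) {lam : ℝ} (hlam : 1 ≤ lam)
    (hE : ∀ y, ∀ x ∉ E, lam * Q y x ≤ 1) (hHS : lam ^ 2 * ∑ y, ∑ x, Q y x ^ 2 ≤ n) (i : ℕ) {S N : ℕ}
    (hS : S = 4 * 2 ^ i) (hN : N = S * (m + 1)) (hNl : 2 * N * lam ≤ √n)
    (hC : (5 * ((N : ℝ) + 1) ^ 3) ^ (15 * S) * (2 * lam) ^ 4 ≤ n) :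
    permAvg (fun σ => ‖goodMat E J Q σ m‖ ^ S) ≤ ((1 / lam) ^ m * lam ^ J) ^ S *
      ((N + 1) * ((5 * ((N : ℝ) + 1) ^ 3) ^ (15 * S) * (4 * n * (2 * lam) ^ (2 * S)))) := by
  classical
  have hQ0 : ∀ i j, 0 ≤ Q i j := fun _ _ => nonneg_of_mem_doublyStochastic hQ
  have hQ1 : ∀ i j, Q i j ≤ 1 := fun _ _ => le_one_of_mem_doublyStochastic hQ
  have hl0 : 0 ≤ lam := by linarith
  have hS0 : 0 < S := by rw [hS]; positivity
  have hN0 : 0 < N := by rw [hN]; positivity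
  have hn' : (0 : ℝ) < n := by
    have : (0 : ℝ) < √n := lt_of_lt_of_le (by positivity) hNl
    exact Real.sqrt_pos.1 this
  have hK0 : ∀ y x, 0 ≤ scaledKer E Q lam y x := by
    intro y x
    simp only [scaledKer, Matrix.of_apply]
    have := hQ0 y x
    split_ifs <;> positivity
  have hKl : ∀ y x, scaledKer E Q lam y x ≤ lam * Q y x := by
    intro y x
    simp only [scaledKer, Matrix.of_apply]
    split_ifs
    · nlinarith [hQ0 y x]
    · exact le_rfl
  have hK1 : ∀ y x, scaledKer E Q lam y x ≤ 1 := by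
    intro y x
    simp only [scaledKer, Matrix.of_apply]
    split_ifs with hx
    · exact hQ1 y x
    · exact hE y x hx
  have hr : ∀ y, ∑ x, scaledKer E Q lam y x ≤ lam := by
    intro y
    refine (sum_le_sum fun x _ => hKl y x).trans ?_
    rw [← mul_sum, sum_row_of_mem_doublyStochastic hQ, mul_one]
  have hc : ∀ x, ∑ y, scaledKer E Q lam y x ≤ lam := by
    intro x
    refine (sum_le_sum fun y _ => hKl y x).trans ?_
    rw [← mul_sum, sum_col_of_mem_doublyStochastic hQ, mul_one]
  have hHS' : ∑ y, ∑ x, scaledKer E Q lam y x ^ 2 ≤ n := by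
    refine le_trans ?_ hHS
    rw [mul_sum]
    refine sum_le_sum fun y _ => ?_
    rw [mul_sum]
    refine sum_le_sum fun x _ => ?_
    rw [← mul_pow]
    exact pow_le_pow_left₀ (hK0 y x) (hKl y x) 2
  refine (permAvg_mono fun σ => hS ▸ norm_pow_le_trace (goodMat E J Q σ m) i).trans ?_
  refine (permAvg_trace_le hlam hQ0 i).trans ?_
  rw [← hS]
  refine mul_le_mul_of_nonneg_left ?_ (by positivity)
  rw [← hN]
  have hp : S = S - 1 + 1 := by omega
  generalize S - 1 = p at hp ⊢
  set Ω : Finset (Fin (p + 1) → Fin (m + 1) → Fin n × Fin n) := {Γ | IsChain E J Γ} with hΩ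
  have hNp : N = (p + 1) * (m + 1) := by rw [hN, hp]
  have hfib : ∀ Γ₀ ∈ Ω, ∀ Ω' ⊆ Ω, (∀ Γ ∈ Ω', SameKernel N (concat Γ) (concat Γ₀)) →
      ∑ Γ ∈ Ω', |permAvg (fun σ => ∏ t ∈ range N, cen σ (concat Γ t))| *
          ∏ t ∈ range (N - 1), lk (scaledKer E Q lam) (altSign m) (concat Γ) t ≤
      4 * n * (2 * lam) ^ (4 * genus (vtx (altSign m) (concat Γ₀) N) (concat Γ₀) N + 2 * S) *
        (1 / n) ^ genus (vtx (altSign m) (concat Γ₀) N) (concat Γ₀) N := by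
    intro Γ₀ hΓ₀ Ω' hΩ' hsame
    have hch := (mem_filter.1 hΓ₀).2
    obtain ⟨D, hD⟩ := tamePieces_concat hch
    rw [← hNp, ← hp] at hD
    exact sum_abs_permAvg_mul_prod_lk_le hlam hK0 hK1 hr hc hHS' hN0
      (fun t ht ho => hd_concat hch (hNp ▸ ht) ho) hD hNl Ω' concat
      (fun Γ _ Γ' _ h => concat_injective fun t ht => h t (hNp ▸ ht)) hsame
  have key := sum_le_sum_genus (N := N) (S := S) (o := altSign m) Ω concat _
    (fun g => 4 * n * (2 * lam) ^ (4 * g + 2 * S) * (1 / (n : ℝ)) ^ g) hN0 hS0 (fun g => by positivity)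
    (fun Γ hΓ => by
      have := tamePieces_concat (mem_filter.1 hΓ).2
      rwa [← hNp, ← hp] at this) hfib
  refine key.trans ?_
  have h1 : (1 : ℝ) ≤ (N : ℝ) + 1 := by linarith [Nat.cast_nonneg (α := ℝ) N]
  have hC1 : (1 : ℝ) ≤ 5 * ((N : ℝ) + 1) ^ 3 := by
    have := one_le_pow₀ h1 (n := 3)
    linarith
  have := sum_codes_mul_pow_le (c := 5 * ((N : ℝ) + 1) ^ 3) (y := 1 / (n : ℝ)) (A := 4 * n)
    (B := 2 * lam) (by positivity) (by positivity) (by positivity) hC1 (15 * S)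
    (by rw [← mul_assoc, mul_one_div]; exact (div_le_one hn').2 hC) (2 * S) (N + 1)
  push_cast at this
  exact this

end moment

/-! ### Elementary properties of ρ and d. -/

section parameters
variable {n : ℕ} {Q : Matrix (Fin n) (Fin n) ℝ} {δ : ℝ}

lemma hsNorm_sq (hn : 0 < n) : n * hsNorm Q ^ 2 = ∑ y, ∑ x, Q y x ^ 2 := by
  have hn' : (n : ℝ) ≠ 0 := by positivity
  have h : (Q * Q.transpose).trace = ∑ y, ∑ x, Q y x ^ 2 := by
    simp only [Matrix.trace, Matrix.diag, Matrix.mul_apply, Matrix.transpose_apply, pow_two]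
  rw [hsNorm, h, Real.sq_sqrt]
  · field_simp
  · exact mul_nonneg (by positivity) (sum_nonneg fun _ _ => sum_nonneg fun _ _ => sq_nonneg _)

lemma sum_sq_le_mul_rho_sq (hn : 0 < n) : ∑ y, ∑ x, Q y x ^ 2 ≤ n * rho δ Q ^ 2 := by
  rw [← hsNorm_sq hn]
  have h0 : 0 ≤ hsNorm Q := Real.sqrt_nonneg _
  have : hsNorm Q ≤ rho δ Q := le_max_left _ _
  gcongr

lemma empty_card_lt (hn : 0 < n) : ((∅ : Finset (Fin n)).card : ℝ) < (n : ℝ) ^ (1 - δ) := by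
  have : (0 : ℝ) < n := by exact_mod_cast hn
  rw [card_empty, Nat.cast_zero]
  exact Real.rpow_pos_of_pos this _

/-- The infimum in the definition of the relaxed norm is attained. -/
lemma exists_exceptional_set (hn : 0 < n) (Q : Matrix (Fin n) (Fin n) ℝ) (δ : ℝ) :
    ∃ E : Finset (Fin n), (#E : ℝ) < (n : ℝ) ^ (1 - δ) ∧ ∀ y, ∀ x ∉ E, Q y x ≤ rho δ Q := by
  have : Nonempty {E : Finset (Fin n) // (E.card : ℝ) < (n : ℝ) ^ (1 - δ)} := ⟨⟨∅, empty_card_lt hn⟩⟩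
  obtain ⟨E, hE⟩ := exists_eq_ciInf_of_finite
    (f := fun E : {E : Finset (Fin n) // (E.card : ℝ) < (n : ℝ) ^ (1 - δ)} =>
      ⨆ p : {p : Fin n × Fin n // p.2 ∉ E.1}, |Q p.1.1 p.1.2|)
  refine ⟨E.1, E.2, fun y x hx => ?_⟩
  have h1 : |Q y x| ≤ ⨆ p : {p : Fin n × Fin n // p.2 ∉ E.1}, |Q p.1.1 p.1.2| :=
    le_ciSup (f := fun p : {p : Fin n × Fin n // p.2 ∉ E.1} => |Q p.1.1 p.1.2|)
      (Set.finite_range _).bddAbove ⟨(y, x), hx⟩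
  exact (le_abs_self _).trans ((h1.trans hE.le).trans (le_max_right _ _))

lemma rho_le_one (hn : 0 < n) (hQ : Q ∈ doublyStochastic ℝ (Fin n)) : rho δ Q ≤ 1 := by
  have hn' : (0 : ℝ) < n := by exact_mod_cast hn
  have h0 : ∀ i j, 0 ≤ Q i j := fun _ _ => nonneg_of_mem_doublyStochastic hQ
  have h1 : ∀ i j, Q i j ≤ 1 := fun _ _ => le_one_of_mem_doublyStochastic hQ
  refine max_le ?_ ?_
  · have hs : n * hsNorm Q ^ 2 ≤ n * 1 := by
      rw [hsNorm_sq hn]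
      calc _ ≤ ∑ y, ∑ x, Q y x := by
            refine sum_le_sum fun y _ => sum_le_sum fun x _ => ?_
            nlinarith [h0 y x, h1 y x]
        _ = _ := by simp [sum_row_of_mem_doublyStochastic hQ]
    have := le_of_mul_le_mul_left hs hn'
    nlinarith [Real.sqrt_nonneg ((1 / (n : ℝ)) * (Q * Q.transpose).trace)]
  · refine (ciInf_le ⟨0, ?_⟩ (⟨∅, empty_card_lt hn⟩ : {E : Finset (Fin n) // (E.card : ℝ) < (n : ℝ) ^ (1 - δ)})).trans ?_
    · rintro _ ⟨E, rfl⟩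
      exact Real.iSup_nonneg fun _ => abs_nonneg _
    · refine Real.iSup_le (fun p => ?_) zero_le_one
      rw [abs_of_nonneg (h0 _ _)]
      exact h1 _ _

/-- Nonnegative entries cannot cancel: if `Q x z ≠ 0`, row z of `Qᵀ Q` is nonzero wherever row x of
`Q` is. -/
lemma card_row_support_le (hQ : Q ∈ doublyStochastic ℝ (Fin n)) (x : Fin n) :
    #{y | Q x y ≠ 0} ≤ sparsity Q := by
  classical
  have h0 : ∀ i j, 0 ≤ Q i j := fun _ _ => nonneg_of_mem_doublyStochastic hQ
  obtain ⟨z, hz⟩ : ∃ z, Q x z ≠ 0 := by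
    by_contra! h
    have := sum_row_of_mem_doublyStochastic hQ x
    simp [h] at this
  refine le_trans ?_ (le_sup (f := fun x : Fin n => {y : Fin n | (Q.transpose * Q) x y ≠ 0}.ncard) (mem_univ z))
  rw [← Set.ncard_coe_finset]
  refine Set.ncard_le_ncard (fun y hy => ?_) (Set.toFinite _)
  have hy' : Q x y ≠ 0 := by simpa using hy
  have : 0 < (Q.transpose * Q) z y := by
    rw [Matrix.mul_apply]
    refine sum_pos' (fun i _ => mul_nonneg (h0 _ _) (h0 _ _)) ⟨x, mem_univ x, ?_⟩
    exact mul_pos ((h0 x z).lt_of_ne' hz) ((h0 x y).lt_of_ne' hy')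
  exact this.ne'

/-- Cauchy-Schwarz on a row of sum 1 with at most d nonzero entries, averaged over rows. It yields
lam ≤ √d. -/
lemma one_le_sparsity_mul_rho_sq (hn : 0 < n) (hQ : Q ∈ doublyStochastic ℝ (Fin n)) :
    1 ≤ sparsity Q * rho δ Q ^ 2 := by
  classical
  have hn' : (0 : ℝ) < n := by exact_mod_cast hn
  have hrow : ∀ x, 1 ≤ sparsity Q * ∑ y, Q x y ^ 2 := by
    intro x
    have h1 : ∑ y ∈ {y | Q x y ≠ 0}, Q x y = 1 := by
      rw [sum_filter_ne_zero, sum_row_of_mem_doublyStochastic hQ]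
    have h2 := sq_sum_le_card_mul_sum_sq (s := {y | Q x y ≠ 0}) (f := fun y => Q x y)
    rw [h1, one_pow] at h2
    have h3 : ∑ y ∈ {y | Q x y ≠ 0}, Q x y ^ 2 ≤ ∑ y, Q x y ^ 2 :=
      sum_le_sum_of_subset_of_nonneg (subset_univ _) fun _ _ _ => sq_nonneg _
    have h4 : (#{y | Q x y ≠ 0} : ℝ) ≤ sparsity Q := by exact_mod_cast card_row_support_le hQ x
    exact h2.trans (mul_le_mul h4 h3 (sum_nonneg fun _ _ => sq_nonneg _) (by positivity))
  have hsum : (n : ℝ) ≤ sparsity Q * (n * rho δ Q ^ 2) := by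
    calc (n : ℝ) = ∑ _x : Fin n, (1 : ℝ) := by simp
      _ ≤ ∑ x, sparsity Q * ∑ y, Q x y ^ 2 := sum_le_sum fun x _ => hrow x
      _ = sparsity Q * ∑ x, ∑ y, Q x y ^ 2 := by rw [mul_sum]
      _ ≤ _ := mul_le_mul_of_nonneg_left (sum_sq_le_mul_rho_sq hn) (by positivity)
  have : (n : ℝ) * 1 ≤ n * (sparsity Q * rho δ Q ^ 2) := by linarith
  exact le_of_mul_le_mul_left this hn'

end parameters

/-! ### Deviation bounds for one block. -/

section block
open scoped Matrix.Norms.L2Operator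
variable {n : ℕ} {E : Finset (Fin n)} {J : ℕ} {Q : Matrix (Fin n) (Fin n) ℝ} {s δ ε lam : ℝ} {m : ℕ}

lemma exp_natCast_pow_le {x a b : ℝ} {k : ℕ} (hx : 0 ≤ x) (h : x ≤ Real.exp a) (hab : k * a ≤ b) :
    x ^ k ≤ Real.exp b := by
  calc x ^ k ≤ Real.exp a ^ k := pow_le_pow_left₀ hx h k
    _ = Real.exp (k * a) := (Real.exp_nat_mul a k).symm
    _ ≤ _ := Real.exp_le_exp.2 hab

lemma exists_two_pow_between (hs : 1 ≤ s) : ∃ i : ℕ, s ≤ 2 ^ i ∧ (2 : ℝ) ^ i ≤ 2 * s := by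
  obtain ⟨i, h1, h2⟩ := exists_nat_pow_near hs (one_lt_two (α := ℝ))
  exact ⟨i + 1, h2.le, by rw [pow_succ]; linarith⟩

/-- The constant 240 makes the codes cost at most √n per unit of cycle rank: 15 · 8s · s / 240 = s²
/ 2. In the last exponent, 8J comes from lam ^ (J S), 32 from (2 lam) ^ (2S), and 4 from the
remaining factors. -/
lemma moment_numerics {S N J : ℕ} (hs : 16 ≤ s) (hl0 : 0 < lam) (hlam' : lam ≤ Real.exp s)
    (hS2 : (S : ℝ) ≤ 8 * s) (hC0 : 5 * ((N : ℝ) + 1) ^ 3 ≤ Real.exp (s / 240)) :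
    2 * N * lam ≤ Real.exp (s ^ 2 / 2) ∧
    (5 * ((N : ℝ) + 1) ^ 3) ^ (15 * S) * (2 * lam) ^ 4 ≤ Real.exp (s ^ 2) ∧
    lam ^ (J * S) * ((N + 1) * ((5 * ((N : ℝ) + 1) ^ 3) ^ (15 * S) * (4 * Real.exp (s ^ 2) * (2 * lam) ^ (2 * S)))) ≤
      Real.exp ((8 * J + 36) * s ^ 2) := by
  have hNe : (N : ℝ) + 1 ≤ Real.exp (s / 240) := by
    refine le_trans ?_ hC0
    have : (N : ℝ) + 1 ≤ (N + 1) ^ 3 := le_self_pow₀ (by linarith [Nat.cast_nonneg (α := ℝ) N]) (by norm_num)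
    linarith [Nat.cast_nonneg (α := ℝ) N]
  have h2e : (2 : ℝ) ≤ Real.exp s := by linarith [Real.add_one_le_exp s]
  have h2l : 2 * lam ≤ Real.exp (2 * s) := by
    rw [two_mul s, Real.exp_add]
    exact mul_le_mul h2e hlam' hl0.le (by positivity)
  have hCp : (5 * ((N : ℝ) + 1) ^ 3) ^ (15 * S) ≤ Real.exp (s ^ 2 / 2) := by
    refine exp_natCast_pow_le (by positivity) hC0 ?_
    push_cast; nlinarith
  have hA1 : 2 * N * lam ≤ Real.exp (s ^ 2 / 2) := by
    calc 2 * N * lam = N * (2 * lam) := by ring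
      _ ≤ Real.exp (s / 240) * Real.exp (2 * s) :=
        mul_le_mul (by linarith) h2l (by linarith) (by positivity)
      _ ≤ _ := by
        rw [← Real.exp_add]; apply Real.exp_le_exp.2; nlinarith
  have hA2 : (5 * ((N : ℝ) + 1) ^ 3) ^ (15 * S) * (2 * lam) ^ 4 ≤ Real.exp (s ^ 2) := by
    have h4 : (2 * lam) ^ 4 ≤ Real.exp (s ^ 2 / 2) :=
      exp_natCast_pow_le (by positivity) h2l (by push_cast; nlinarith)
    calc _ ≤ Real.exp (s ^ 2 / 2) * Real.exp (s ^ 2 / 2) := mul_le_mul hCp h4 (by positivity) (by positivity)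
      _ = Real.exp (s ^ 2) := by rw [← Real.exp_add]; congr 1; ring
  refine ⟨hA1, hA2, ?_⟩
  have b1 : lam ^ (J * S) ≤ Real.exp (8 * J * s ^ 2) := by
    refine exp_natCast_pow_le hl0.le hlam' ?_
    push_cast
    have := mul_le_mul_of_nonneg_left hS2 (mul_nonneg (Nat.cast_nonneg (α := ℝ) J) (show 0 ≤ s by linarith))
    nlinarith
  have b2 : (N : ℝ) + 1 ≤ Real.exp (s ^ 2) := hNe.trans (Real.exp_le_exp.2 (by nlinarith))
  have b3 : (5 * ((N : ℝ) + 1) ^ 3) ^ (15 * S) ≤ Real.exp (s ^ 2) := hCp.trans (Real.exp_le_exp.2 (by nlinarith))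
  have b4 : (4 : ℝ) ≤ Real.exp (s ^ 2) := by nlinarith [Real.add_one_le_exp (s ^ 2)]
  have b5 : (2 * lam) ^ (2 * S) ≤ Real.exp (32 * s ^ 2) := by
    refine exp_natCast_pow_le (by positivity) h2l ?_
    push_cast; nlinarith
  calc _ ≤ Real.exp (8 * J * s ^ 2) * (Real.exp (s ^ 2) * (Real.exp (s ^ 2) * (Real.exp (s ^ 2) *
        Real.exp (s ^ 2) * Real.exp (32 * s ^ 2)))) := by gcongr
    _ = _ := by
      simp only [← Real.exp_add]; congr 1; ring

/-- With overwhelming probability the contribution of good walks is small. -/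
lemma uniformProb_norm_goodMat_le (hQ : Q ∈ doublyStochastic ℝ (Fin n)) (hn : (n : ℝ) = Real.exp (s ^ 2))
    (hs : 16 ≤ s) (hpoly : 5 * (16 * s ^ 3 + 1) ^ 3 ≤ Real.exp (s / 240)) (hlam : 1 ≤ lam)
    (hlam' : lam ≤ Real.exp s) (hm : (m : ℝ) + 1 ≤ 2 * s ^ 2) (hE : ∀ y, ∀ x ∉ E, lam * Q y x ≤ 1)
    (hHS : lam ^ 2 * ∑ y, ∑ x, Q y x ^ 2 ≤ n) :
    uniformProb {σ | Real.exp ((2 * J + 10) * s) * (1 / lam) ^ m ≤ ‖goodMat E J Q σ m‖} ≤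
      Real.exp (-4 * s ^ 2) := by
  obtain ⟨i, hi1, hi2⟩ := exists_two_pow_between (show 1 ≤ s by linarith)
  set S := 4 * 2 ^ i with hS
  set N := S * (m + 1) with hN
  have hS1 : 4 * s ≤ S := by rw [hS]; push_cast; linarith
  have hS2 : (S : ℝ) ≤ 8 * s := by rw [hS]; push_cast; linarith
  have hN1 : (N : ℝ) ≤ 16 * s ^ 3 := by
    rw [hN]; push_cast
    calc (S : ℝ) * (m + 1) ≤ 8 * s * (2 * s ^ 2) := mul_le_mul hS2 hm (by positivity) (by linarith)
      _ = _ := by ring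
  clear_value N
  clear_value S
  have hl0 : 0 < lam := by linarith
  have hC0 : 5 * ((N : ℝ) + 1) ^ 3 ≤ Real.exp (s / 240) := by
    refine le_trans ?_ hpoly
    gcongr
  obtain ⟨hA1, hA2, hbound⟩ := moment_numerics (J := J) hs hl0 hlam' hS2 hC0
  rw [← hn] at hA2 hbound
  rw [Real.exp_half, ← hn] at hA1
  have hmom := permAvg_norm_goodMat_pow_le (J := J) hQ hlam hE hHS i hS hN hA1 hA2
  have hpos : 0 < Real.exp ((2 * J + 10) * s) * (1 / lam) ^ m := by positivity
  refine (uniformProb_le_permAvg (f := fun σ => ‖goodMat E J Q σ m‖ ^ S) (fun σ => by positivity)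
    (pow_pos hpos S) (fun σ hσ => pow_le_pow_left₀ hpos.le hσ S)).trans ?_
  rw [div_le_iff₀ (pow_pos hpos S)]
  refine hmom.trans ?_
  rw [mul_pow ((1 / lam) ^ m), ← pow_mul lam, mul_pow (Real.exp _), ← Real.exp_nat_mul]
  calc _ = ((1 / lam) ^ m) ^ S * (lam ^ (J * S) * ((N + 1) * ((5 * ((N : ℝ) + 1) ^ 3) ^ (15 * S) *
        (4 * n * (2 * lam) ^ (2 * S))))) := by ring
    _ ≤ ((1 / lam) ^ m) ^ S * Real.exp ((8 * J + 36) * s ^ 2) := by gcongr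
    -- Since S ≥ 4s, the threshold raised to the power S contributes at least (8J + 40) s², which
    -- exceeds the moment bound by 4 s².
    _ ≤ ((1 / lam) ^ m) ^ S * Real.exp (-4 * s ^ 2 + S * ((2 * J + 10) * s)) := by
        gcongr
        have := mul_le_mul_of_nonneg_right hS1 (show 0 ≤ (2 * (J : ℝ) + 10) * s by positivity)
        nlinarith
    _ = _ := by rw [Real.exp_add]; ring

/-- With high probability the contributions of bad walks are small. -/
lemma uniformProb_sum_badMat_le (hQ : Q ∈ doublyStochastic ℝ (Fin n)) (hn : (n : ℝ) = Real.exp (s ^ 2))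
    (hs : 16 ≤ s) (hpoly : 5 * (16 * s ^ 3 + 1) ^ 3 ≤ Real.exp (s / 240)) (hlam : 1 ≤ lam)
    (hm : (m : ℝ) + 1 ≤ 2 * s ^ 2) (hδ1 : δ ≤ 1) (hJ : 1 ≤ δ * J)
    (hE : (#E : ℝ) ≤ Real.exp ((1 - δ) * s ^ 2)) (hε : 1 ≤ ε * s)
    (h2m : (2 : ℝ) ^ (m + 1) ≤ Real.exp (ε * s ^ 2)) (hlm : lam ^ (m + 1) ≤ Real.exp (ε * s ^ 2 / 2)) :
    uniformProb {σ | (1 / lam) ^ m ≤ 2 ^ m * ∑ t ∈ range (m + 1), ∑ x, ∑ y, |badMat E J Q σ t x y|} ≤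
      Real.exp ((9 / 2 * ε - δ) * s ^ 2) := by
  have hs0 : 0 < s := by linarith
  have hl0 : 0 < lam := by linarith
  -- η = n ^ (-δ) bounds both 1 / n and the density of `E`; the choice J ≥ 1 / δ gives n η ^ J ≤ 1.
  set η := Real.exp (-δ * s ^ 2) with hη
  have h1 : 1 / (n : ℝ) ≤ η := by
    rw [hn, one_div, ← Real.exp_neg, hη]; apply Real.exp_le_exp.2; nlinarith [sq_nonneg s]
  have h2 : (#E : ℝ) ≤ η * n := by
    refine hE.trans (le_of_eq ?_)
    rw [hn, hη, ← Real.exp_add]; congr 1; ring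
  have h3 : n * η ^ (J + 1) ≤ η := by
    rw [pow_succ, ← mul_assoc]
    refine mul_le_of_le_one_left (by positivity) ?_
    rw [hn, hη, ← Real.exp_nat_mul, ← Real.exp_add, Real.exp_le_one_iff]
    nlinarith [mul_le_mul_of_nonneg_right hJ (sq_nonneg s)]
  have h4 : ∀ t ∈ range (m + 1), permAvg (fun σ => ∑ x, ∑ y, |badMat E J Q σ t x y|) ≤
      Real.exp (2 * ε * s ^ 2) * Real.exp (91 * (s / 240)) * η := by
    intro t ht
    have htm : (t : ℝ) ≤ m := by exact_mod_cast Nat.lt_succ_iff.1 (mem_range.1 ht)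
    have hC : 5 * ((t : ℝ) + 2) ^ 3 ≤ Real.exp (s / 240) := by
      refine le_trans ?_ hpoly
      have : (t : ℝ) + 2 ≤ 16 * s ^ 3 + 1 := by nlinarith [pow_pos hs0 2]
      gcongr
    have hC30 : (5 * ((t : ℝ) + 2) ^ 3) ^ 30 ≤ n := by
      rw [hn]
      exact exp_natCast_pow_le (by positivity) hC (by push_cast; nlinarith)
    refine (permAvg_sum_abs_badMat_le hQ h1 h2 h3 t hC30).trans ?_
    have e1 : (4 : ℝ) ^ (t + 1) ≤ Real.exp (2 * ε * s ^ 2) := by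
      calc (4 : ℝ) ^ (t + 1) ≤ 4 ^ (m + 1) :=
            pow_le_pow_right₀ (by norm_num) (Nat.succ_le_of_lt (mem_range.1 ht))
        _ = (2 ^ (m + 1)) ^ 2 := by rw [← pow_mul, mul_comm, pow_mul]; norm_num
        _ ≤ Real.exp (ε * s ^ 2) ^ 2 := by gcongr
        _ = _ := by rw [← Real.exp_nat_mul]; congr 1; push_cast; ring
    have e2 : (5 * ((t : ℝ) + 2) ^ 3) ^ 91 ≤ Real.exp (91 * (s / 240)) :=
      exp_natCast_pow_le (by positivity) hC (by push_cast; exact le_rfl)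
    gcongr
  have hm' : ((m + 1 : ℕ) : ℝ) ≤ Real.exp (s / 240) := by
    refine le_trans ?_ hpoly
    push_cast
    have hb : (m : ℝ) + 1 ≤ 16 * s ^ 3 + 1 := by nlinarith [pow_pos hs0 2]
    have hb1 : (1 : ℝ) ≤ 16 * s ^ 3 + 1 := by nlinarith [pow_pos hs0 3]
    have := le_self_pow₀ hb1 (show 3 ≠ 0 by norm_num)
    linarith
  have h5 : permAvg (fun σ => 2 ^ m * ∑ t ∈ range (m + 1), ∑ x, ∑ y, |badMat E J Q σ t x y|) ≤
      2 ^ m * (Real.exp (s / 240) * (Real.exp (2 * ε * s ^ 2) * Real.exp (91 * (s / 240)) * η)) := by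
    rw [permAvg_const_mul, permAvg_sum]
    refine mul_le_mul_of_nonneg_left ((sum_le_sum h4).trans ?_) (by positivity)
    rw [sum_const, card_range, nsmul_eq_mul]
    gcongr
  refine (uniformProb_le_permAvg (f := fun σ => 2 ^ m * ∑ t ∈ range (m + 1), ∑ x, ∑ y, |badMat E J Q σ t x y|)
    (fun σ => mul_nonneg (by positivity) (sum_nonneg fun _ _ => sum_nonneg fun _ _ => sum_nonneg fun _ _ =>
      abs_nonneg _)) (show 0 < (1 / lam) ^ m by positivity) (fun σ hσ => hσ)).trans ?_
  rw [one_div, inv_pow, div_inv_eq_mul]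
  have h2m' : (2 : ℝ) ^ m ≤ Real.exp (ε * s ^ 2) :=
    (pow_le_pow_right₀ (by norm_num) (Nat.le_succ m)).trans h2m
  have hlm' : lam ^ m ≤ Real.exp (ε * s ^ 2 / 2) := (pow_le_pow_right₀ hlam (Nat.le_succ m)).trans hlm
  calc _ ≤ 2 ^ m * (Real.exp (s / 240) * (Real.exp (2 * ε * s ^ 2) * Real.exp (91 * (s / 240)) * η)) * lam ^ m := by
        gcongr
    _ ≤ Real.exp (ε * s ^ 2) * (Real.exp (s / 240) * (Real.exp (2 * ε * s ^ 2) * Real.exp (91 * (s / 240)) * η)) *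
        Real.exp (ε * s ^ 2 / 2) := by gcongr
    _ = Real.exp (7 / 2 * ε * s ^ 2 + 92 / 240 * s - δ * s ^ 2) := by
        rw [hη]; simp only [← Real.exp_add]; congr 1; ring
    -- The polynomial factors, e ^ (92 s / 240), are absorbed by one more ε s², as 1 ≤ ε s.
    _ ≤ _ := by
        apply Real.exp_le_exp.2
        nlinarith [mul_le_mul_of_nonneg_right hε hs0.le]

/-- A bound for the norm of a block. -/
lemma uniformProb_norm_block_le (hQ : Q ∈ doublyStochastic ℝ (Fin n)) (hn : (n : ℝ) = Real.exp (s ^ 2))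
    (hs : 16 ≤ s) (hpoly : 5 * (16 * s ^ 3 + 1) ^ 3 ≤ Real.exp (s / 240)) (hlam : 1 ≤ lam)
    (hlam' : lam ≤ Real.exp s) (hm : (m : ℝ) + 1 ≤ 2 * s ^ 2) (hE : ∀ y, ∀ x ∉ E, lam * Q y x ≤ 1)
    (hHS : lam ^ 2 * ∑ y, ∑ x, Q y x ^ 2 ≤ n) (hδ1 : δ ≤ 1) (hJ : 1 ≤ δ * J)
    (hEc : (#E : ℝ) ≤ Real.exp ((1 - δ) * s ^ 2)) (hε : 1 ≤ ε * s)
    (h2m : (2 : ℝ) ^ (m + 1) ≤ Real.exp (ε * s ^ 2)) (hlm : lam ^ (m + 1) ≤ Real.exp (ε * s ^ 2 / 2)) :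
    uniformProb {σ | Real.exp ((2 * J + 12) * s) * (1 / lam) ^ (m + 1) ≤ ‖(cenMat σ * Q) ^ (m + 1)‖} ≤
      Real.exp (-4 * s ^ 2) + Real.exp ((9 / 2 * ε - δ) * s ^ 2) := by
  have hn0 : 0 < n := by
    have : (0 : ℝ) < n := by rw [hn]; positivity
    exact_mod_cast this
  have hl0 : 0 < lam := by linarith
  refine (uniformProb_mono (F := {σ | Real.exp ((2 * J + 10) * s) * (1 / lam) ^ m ≤ ‖goodMat E J Q σ m‖} ∪
    {σ | (1 / lam) ^ m ≤ 2 ^ m * ∑ t ∈ range (m + 1), ∑ x, ∑ y, |badMat E J Q σ t x y|}) ?_).trans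
    ((uniformProb_union_le _ _).trans (add_le_add
      (uniformProb_norm_goodMat_le hQ hn hs hpoly hlam hlam' hm hE hHS)
      (uniformProb_sum_badMat_le hQ hn hs hpoly hlam hm hδ1 hJ hEc hε h2m hlm)))
  intro σ hσ
  rw [Set.mem_union]
  by_contra hno
  rw [not_or] at hno
  rw [Set.mem_ofPred_eq, Set.mem_ofPred_eq, not_le, not_le] at hno
  obtain ⟨h1, h2⟩ := hno
  have h3 := norm_cenMat_mul_pow_le E J σ hn0 hQ m
  have h4 : Real.exp ((2 * J + 12) * s) * (1 / lam) ^ (m + 1) ≤ ‖(cenMat σ * Q) ^ (m + 1)‖ := hσ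
  have h5 : Real.exp ((2 * J + 10) * s) * (1 / lam) ^ m + (1 / lam) ^ m ≤
      Real.exp ((2 * J + 12) * s) * (1 / lam) ^ (m + 1) := by
    have e1 : Real.exp ((2 * J + 10) * s) + 1 ≤ Real.exp ((2 * J + 11) * s) := by
      have a1 : Real.exp ((2 * J + 11) * s) = Real.exp ((2 * J + 10) * s) * Real.exp s := by
        rw [← Real.exp_add]; congr 1; ring
      have a2 : 1 ≤ Real.exp ((2 * J + 10) * s) := Real.one_le_exp (by positivity)
      have a3 := Real.add_one_le_exp s
      rw [a1]; nlinarith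
    have e2 : Real.exp ((2 * J + 12) * s) = Real.exp ((2 * J + 11) * s) * Real.exp s := by
      rw [← Real.exp_add]; congr 1; ring
    -- A block has m + 1 factors but only m inner links; the missing factor 1 / lam is paid by e ^
    -- s.
    have e3 : 1 ≤ Real.exp s * (1 / lam) := by
      rw [mul_one_div, le_div_iff₀ hl0]; linarith
    calc _ = (Real.exp ((2 * J + 10) * s) + 1) * (1 / lam) ^ m := by ring
      _ ≤ Real.exp ((2 * J + 11) * s) * (1 / lam) ^ m * 1 := by rw [mul_one]; gcongr
      _ ≤ Real.exp ((2 * J + 11) * s) * (1 / lam) ^ m * (Real.exp s * (1 / lam)) := by gcongr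
      _ = _ := by rw [e2, pow_succ]; ring
  linarith

end block

/-! ### From one block to all exponents ℓ. -/

section assembly

open scoped Matrix.Norms.L2Operator

variable {n : ℕ} {Q : Matrix (Fin n) (Fin n) ℝ}

lemma uniformProb_eq_zero {F : Set (Equiv.Perm (Fin n))} (h : ∀ σ, σ ∉ F) : uniformProb F = 0 := by
  rw [Set.eq_empty_iff_forall_notMem.2 h, uniformProb, Set.ncard_empty, Nat.cast_zero, zero_div]

lemma normOnOnesPerp_permMul_pow_le_one (hQ : Q ∈ doublyStochastic ℝ (Fin n)) (σ : Equiv.Perm (Fin n)) (ℓ : ℕ) :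
    normOnOnesPerp (permMul σ Q ^ ℓ) ≤ 1 :=
  (normOnOnesPerp_le_norm_sub _).2.trans (norm_le_one_of_mem (pow_mem (permMul_mem hQ σ) ℓ))

/-- The norm of a long product in terms of the norm of a block. -/
lemma normOnOnesPerp_permMul_pow_lt (hn : 0 < n) (hQ : Q ∈ doublyStochastic ℝ (Fin n))
    (σ : Equiv.Perm (Fin n)) {K l : ℕ} (r : ℕ) (hK : 1 ≤ K) (hl : 1 ≤ l) {b : ℝ}
    (h : ‖(cenMat σ * Q) ^ l‖ < b) : normOnOnesPerp (permMul σ Q ^ (K * l + r)) < b ^ K * 2 ^ r := by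
  have h1 : 1 ≤ K * l + r := le_add_right (Nat.mul_pos hK hl)
  refine (normOnOnesPerp_le_norm_sub _).1.trans_lt ?_
  rw [← cenMat_mul_pow hn hQ σ h1, pow_add, mul_comm K, pow_mul]
  have h2 : ‖cenMat σ * Q‖ ≤ 2 := by
    refine (norm_mul_le _ _).trans ?_
    have := norm_cenMat_le hn σ
    have := norm_le_one_of_mem hQ
    nlinarith [norm_nonneg (cenMat σ), norm_nonneg Q]
  have h3 : ‖(cenMat σ * Q) ^ r‖ ≤ 2 ^ r := by
    rcases Nat.eq_zero_or_pos r with rfl | hr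
    · rw [pow_zero, pow_zero]
      exact norm_le_one_of_mem (one_mem _)
    · exact (norm_pow_le' _ hr).trans (pow_le_pow_left₀ (norm_nonneg _) h2 r)
  calc _ ≤ ‖((cenMat σ * Q) ^ l) ^ K‖ * ‖(cenMat σ * Q) ^ r‖ := norm_mul_le _ _
    _ ≤ ‖(cenMat σ * Q) ^ l‖ ^ K * 2 ^ r := by
        gcongr
        exact norm_pow_le' _ hK
    _ < b ^ K * 2 ^ r := by
        have := pow_lt_pow_left₀ h (norm_nonneg _) (show K ≠ 0 by omega)
        gcongr

/-- Both exponents leave a margin ε s² ≥ 1, and e ^ (ε s²) ≥ 2 absorbs the sum of two terms. -/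
lemma exp_add_exp_le {c₀ δ ε s : ℝ} (hs : 16 ≤ s) (hε : 1 ≤ ε * s) (hc₀ : c₀ + ε ≤ 4)
    (hεc : 9 / 2 * ε - δ ≤ -c₀ - ε) :
    Real.exp (-4 * s ^ 2) + Real.exp ((9 / 2 * ε - δ) * s ^ 2) ≤ Real.exp (-c₀ * s ^ 2) := by
  have hεs : 1 ≤ ε * s ^ 2 := by
    rw [pow_two, ← mul_assoc]
    exact one_le_mul_of_one_le_of_one_le hε (by linarith)
  have e1 : Real.exp (-4 * s ^ 2) ≤ Real.exp (-c₀ * s ^ 2 - ε * s ^ 2) := by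
    apply Real.exp_le_exp.2
    linarith [mul_le_mul_of_nonneg_right hc₀ (sq_nonneg s)]
  have e2 : Real.exp ((9 / 2 * ε - δ) * s ^ 2) ≤ Real.exp (-c₀ * s ^ 2 - ε * s ^ 2) := by
    apply Real.exp_le_exp.2
    linarith [mul_le_mul_of_nonneg_right hεc (sq_nonneg s)]
  have e3 : 2 * Real.exp (-c₀ * s ^ 2 - ε * s ^ 2) ≤ Real.exp (-c₀ * s ^ 2) := by
    have a := Real.add_one_le_exp (ε * s ^ 2)
    calc _ ≤ Real.exp (ε * s ^ 2) * Real.exp (-c₀ * s ^ 2 - ε * s ^ 2) := by gcongr; linarith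
      _ = _ := by rw [← Real.exp_add]; congr 1; ring
  linarith

/-- The deviation bound for the exponents `ℓ` that are long enough to be cut into `K` blocks. -/
lemma uniformProb_normOnOnesPerp_le {c₀ c₁ δ ε s D : ℝ} {J K ℓ : ℕ}
    (hQ : Q ∈ doublyStochastic ℝ (Fin n)) (hn : (n : ℝ) = Real.exp (s ^ 2))
    (hs : 16 ≤ s) (hpoly : 5 * (16 * s ^ 3 + 1) ^ 3 ≤ Real.exp (s / 240)) (hε : 1 ≤ ε * s)
    (hδ1 : δ ≤ 1) (hJ : 1 ≤ δ * J) (hK : 1 ≤ ε * K) (hc₀ : c₀ ≤ 1) (hεc : 9 / 2 * ε - δ ≤ -c₀ - ε)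
    (hd : (sparsity Q : ℝ) = Real.exp D) (hd2 : 2 ≤ Real.exp D) (hDs : D ≤ s)
    (hℓD : ℓ * D ≤ c₀ * s ^ 2) (hKℓ : K ≤ ℓ) (hc₁ : (2 * J + 14) * K ≤ c₁) :
    uniformProb {σ : Equiv.Perm (Fin n) |
      Real.exp (c₁ * s) * rho δ Q ^ ℓ ≤ normOnOnesPerp (permMul σ Q ^ ℓ)} ≤ Real.exp (-c₀ * s ^ 2) := by
  have hs0 : 0 < s := by linarith
  have hε0 : 0 < ε := pos_of_mul_pos_left (by linarith) hs0.le
  have hε1 : ε ≤ 2 / 11 * (1 - c₀) := by linarith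
  have hKpos : 0 < K := by
    rcases Nat.eq_zero_or_pos K with rfl | h
    · norm_num at hK
    · exact h
  have hKr : (0 : ℝ) < K := by exact_mod_cast hKpos
  have hn0 : 0 < n := by
    have : (0 : ℝ) < n := by rw [hn]; positivity
    exact_mod_cast this
  have hD0 : Real.log 2 ≤ D := (Real.log_le_iff_le_exp (by norm_num)).2 hd2
  have hlog2 := Real.log_two_gt_d9
  have hρ0 : 0 ≤ rho δ Q := le_max_of_le_left (Real.sqrt_nonneg _)
  have hρ1 := rho_le_one (δ := δ) hn0 hQ
  have hρd := one_le_sparsity_mul_rho_sq (δ := δ) hn0 hQ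
  rw [hd] at hρd
  have hρpos : 0 < rho δ Q := by
    refine lt_of_le_of_ne hρ0 fun h => ?_
    rw [← h] at hρd
    norm_num at hρd
  obtain ⟨E, hE1, hE2⟩ := exists_exceptional_set hn0 Q δ
  have hHS := sum_sq_le_mul_rho_sq (δ := δ) (Q := Q) hn0
  set ρ := rho δ Q with hρ
  clear_value ρ
  set lam := 1 / ρ with hlamdef
  have hρlam : 1 / lam = ρ := by rw [hlamdef, one_div_one_div]
  have hlr : lam * ρ = 1 := by rw [hlamdef]; field_simp
  have hlam0 : 0 < lam := by positivity
  have hlam1 : 1 ≤ lam := by rw [hlamdef, le_div_iff₀ hρpos]; linarith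
  have hlamD : lam ≤ Real.exp (D / 2) := by
    refine (sq_le_sq₀ hlam0.le (Real.exp_pos _).le).1 ?_
    rw [← Real.exp_nat_mul, hlamdef, div_pow, div_le_iff₀ (by positivity), one_pow]
    rwa [show ((2 : ℕ) : ℝ) * (D / 2) = D by push_cast; ring]
  have hlams : lam ≤ Real.exp s := hlamD.trans (Real.exp_le_exp.2 (by linarith))
  set l := ℓ / K with hl
  set r := ℓ % K with hr
  have hlr' : K * l + r = ℓ := Nat.div_add_mod ℓ K
  have hl1 : 1 ≤ l := (Nat.one_le_div_iff hKpos).2 hKℓ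
  have hrK : r ≤ K := (Nat.mod_lt ℓ hKpos).le
  clear_value l r
  have hKl : (K : ℝ) * l ≤ ℓ := by exact_mod_cast (show K * l ≤ ℓ by omega)
  have hlℓ : (l : ℝ) ≤ ℓ := by exact_mod_cast (show l ≤ ℓ by nlinarith)
  have hℓs : ℓ * D ≤ s ^ 2 := by nlinarith [sq_nonneg s]
  -- This is d ^ l ≤ n ^ ε, the reason for cutting into K ≥ 1 / ε blocks: it makes 2 ^ l and lam ^ l
  -- negligible.
  have hlD : l * D ≤ ε * s ^ 2 := by
    refine le_of_mul_le_mul_left ?_ hKr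
    calc (K : ℝ) * (l * D) = (K * l) * D := by ring
      _ ≤ ℓ * D := by gcongr; linarith
      _ ≤ 1 * s ^ 2 := by linarith
      _ ≤ (ε * K) * s ^ 2 := by gcongr
      _ = _ := by ring
  obtain ⟨m, rfl⟩ : ∃ m, l = m + 1 := ⟨l - 1, by omega⟩
  have hm : (m : ℝ) + 1 ≤ 2 * s ^ 2 := by
    push_cast at hlℓ
    have : (ℓ : ℝ) * (1 / 2) ≤ ℓ * D := by gcongr; linarith
    linarith
  have hblock := uniformProb_norm_block_le (δ := δ) (E := E) (J := J) (m := m) (ε := ε) hQ hn hs hpoly hlam1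
    hlams hm
    (fun y x hx => (mul_le_mul_of_nonneg_left (hE2 y x hx) hlam0.le).trans hlr.le)
    (by
      calc lam ^ 2 * ∑ y, ∑ x, Q y x ^ 2 ≤ lam ^ 2 * (n * ρ ^ 2) := by gcongr
        _ = n * (lam * ρ) ^ 2 := by ring
        _ ≤ n := by rw [hlr]; linarith)
    hδ1 hJ
    (by
      refine hE1.le.trans (le_of_eq ?_)
      rw [hn, ← Real.exp_mul]; congr 1; ring)
    hε (exp_natCast_pow_le (by norm_num) hd2 hlD)
    (exp_natCast_pow_le hlam0.le hlamD (by linarith))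
  refine (uniformProb_mono ?_).trans (hblock.trans ?_)
  · intro σ hσ
    rw [Set.mem_ofPred_eq]
    by_contra hlt
    have h1 := normOnOnesPerp_permMul_pow_lt hn0 hQ σ r hKpos hl1 (not_le.1 hlt)
    rw [hlr', hρlam] at h1
    have h2 : Real.exp (c₁ * s) * ρ ^ ℓ ≤ normOnOnesPerp (permMul σ Q ^ ℓ) := hσ
    have h3 : (2 : ℝ) ^ r ≤ Real.exp (K * s) :=
      (pow_le_pow_right₀ (by norm_num) hrK).trans
        (exp_natCast_pow_le (by norm_num) (by have := Real.add_one_le_exp s; linarith) le_rfl)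
    have h4 : lam ^ r ≤ Real.exp (K * s) :=
      (pow_le_pow_right₀ hlam1 hrK).trans (exp_natCast_pow_le hlam0.le hlams le_rfl)
    generalize m + 1 = q at h1 hlr'
    -- The r leftover steps cost 2 ^ r, and lam ^ r to restore the missing ρ ^ r; both are at most e
    -- ^ (K s).
    have h5 : (Real.exp ((2 * J + 12) * s) * ρ ^ q) ^ K * 2 ^ r ≤ Real.exp (c₁ * s) * ρ ^ ℓ := by
      calc (Real.exp ((2 * J + 12) * s) * ρ ^ q) ^ K * 2 ^ r
          = Real.exp ((2 * J + 12) * s) ^ K * ρ ^ (K * q) * 2 ^ r * (lam * ρ) ^ r := by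
            rw [hlr, one_pow, mul_one, mul_pow, ← pow_mul, mul_comm K]
        _ = Real.exp ((2 * J + 12) * s) ^ K * 2 ^ r * lam ^ r * ρ ^ ℓ := by
            rw [← hlr', mul_pow, pow_add]; ring
        _ ≤ Real.exp ((2 * J + 12) * s) ^ K * Real.exp (K * s) * Real.exp (K * s) * ρ ^ ℓ := by gcongr
        _ = Real.exp ((2 * J + 14) * K * s) * ρ ^ ℓ := by
            rw [← Real.exp_nat_mul, ← Real.exp_add, ← Real.exp_add]; congr 2; ring
        _ ≤ _ := by gcongr
    linarith
  · exact exp_add_exp_le hs hε (by linarith) hεc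

/-- The deviation event is empty when `c₁` dominates `log d`. -/
lemma uniformProb_normOnOnesPerp_eq_zero {c₁ δ s D : ℝ} {ℓ : ℕ} (hn : 0 < n)
    (hQ : Q ∈ doublyStochastic ℝ (Fin n)) (hd : (sparsity Q : ℝ) = Real.exp D)
    (hD : ℓ * D < 2 * (c₁ * s)) :
    uniformProb {σ : Equiv.Perm (Fin n) |
      Real.exp (c₁ * s) * rho δ Q ^ ℓ ≤ normOnOnesPerp (permMul σ Q ^ ℓ)} = 0 := by
  refine uniformProb_eq_zero fun σ hσ => ?_
  have h := le_trans (show Real.exp (c₁ * s) * rho δ Q ^ ℓ ≤ normOnOnesPerp (permMul σ Q ^ ℓ) from hσ)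
    (normOnOnesPerp_permMul_pow_le_one hQ σ ℓ)
  have hρ0 : 0 ≤ rho δ Q := le_max_of_le_left (Real.sqrt_nonneg _)
  have hρd := one_le_sparsity_mul_rho_sq (δ := δ) hn hQ
  rw [hd] at hρd
  have h2 : 1 ≤ Real.exp (ℓ * D) * (rho δ Q ^ ℓ) ^ 2 := by
    calc (1 : ℝ) ≤ (Real.exp D * rho δ Q ^ 2) ^ ℓ := one_le_pow₀ hρd
      _ = _ := by rw [mul_pow, ← Real.exp_nat_mul]; ring
  have h3 : Real.exp (ℓ * D) < Real.exp (c₁ * s) ^ 2 := by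
    rw [← Real.exp_nat_mul]
    exact Real.exp_lt_exp.2 (by push_cast; exact hD)
  have h4 : (Real.exp (c₁ * s) * rho δ Q ^ ℓ) ^ 2 ≤ 1 := pow_le_one₀ (by positivity) h
  have h5 : 0 < (rho δ Q ^ ℓ) ^ 2 := by
    by_contra h0
    have : (rho δ Q ^ ℓ) ^ 2 = 0 := le_antisymm (not_lt.1 h0) (sq_nonneg _)
    rw [this] at h2; norm_num at h2
  have h6 := mul_lt_mul_of_pos_right h3 h5
  rw [mul_pow] at h4
  linarith

lemma eventually_poly_le_exp : ∀ᶠ s : ℝ in Filter.atTop, 5 * (16 * s ^ 3 + 1) ^ 3 ≤ Real.exp (s / 240) := by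
  have h := (isLittleO_pow_exp_pos_mul_atTop 9 (show (0 : ℝ) < 1 / 240 by norm_num)).bound
    (show (0 : ℝ) < 1 / (5 * 17 ^ 3) by norm_num)
  filter_upwards [h, Filter.eventually_ge_atTop 1] with s hs h1
  rw [Real.norm_of_nonneg (by positivity), Real.norm_of_nonneg (by positivity)] at hs
  have : 16 * s ^ 3 + 1 ≤ 17 * s ^ 3 := by nlinarith [one_le_pow₀ (n := 3) h1]
  calc 5 * (16 * s ^ 3 + 1) ^ 3 ≤ 5 * (17 * s ^ 3) ^ 3 := by gcongr
    _ = 5 * 17 ^ 3 * s ^ 9 := by ring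
    _ ≤ 5 * 17 ^ 3 * (1 / (5 * 17 ^ 3) * Real.exp (1 / 240 * s)) := by gcongr
    _ = Real.exp (s / 240) := by rw [← mul_assoc, mul_one_div_cancel (by norm_num), one_mul]; congr 1; ring

end assembly

end RandomBistochastic

end


/-! ### Choice of constants and the degenerate regimes. -/

theorem theorem2 (c₀ δ : ℝ) (hc₀ : 0 < c₀) (hc₀δ : c₀ < δ) (hδ : δ ≤ 1) :
    ∃ c₁ : ℝ, 0 < c₁ ∧
      ∀ (n : ℕ) (Q : Matrix (Fin n) (Fin n) ℝ), 1 ≤ n →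
        Q ∈ doublyStochastic ℝ (Fin n) → 2 ≤ RandomBistochastic.sparsity Q →
        ∀ ℓ : ℕ, 1 ≤ ℓ →
          RandomBistochastic.uniformProb
              {σ : Equiv.Perm (Fin n) |
                Real.exp (c₁ * √(Real.log n)) * RandomBistochastic.rho δ Q ^ ℓ
                  ≤ RandomBistochastic.normOnOnesPerp (RandomBistochastic.permMul σ Q ^ ℓ)}
            ≤ (RandomBistochastic.sparsity Q : ℝ) ^ ((ℓ : ℝ) + 50 * √(Real.log n))
                * (n : ℝ) ^ (-c₀) := by
  have hδ0 : 0 < δ := hc₀.trans hc₀δ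
  -- A block fails with exponent 9ε/2 - δ, and the union bound needs a further ε: 11ε/2 ≤ δ - c₀ is
  -- required.
  set ε := (δ - c₀) / 6 with hεdef
  have hε0 : 0 < ε := by rw [hεdef]; linarith
  obtain ⟨K, hK⟩ := exists_nat_ge (1 / ε)
  obtain ⟨J, hJ⟩ := exists_nat_ge (1 / δ)
  rw [div_le_iff₀' hε0] at hK
  rw [div_le_iff₀' hδ0] at hJ
  have hK1 : (1 : ℝ) ≤ K := by
    have : 0 < K := by
      rcases Nat.eq_zero_or_pos K with rfl | h
      · norm_num at hK
      · exact h
    exact_mod_cast this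
  obtain ⟨S, hS⟩ := Filter.eventually_atTop.1
    ((RandomBistochastic.eventually_poly_le_exp.and (Filter.eventually_ge_atTop 16)).and (Filter.eventually_ge_atTop (1 / ε)))
  have hS16 : 16 ≤ S := (hS S le_rfl).1.2
  refine ⟨S + (2 * J + 14) * K, by positivity, fun n Q hn hQ hd ℓ hℓ => ?_⟩
  set s := √(Real.log n) with hs
  have hn1 : (1 : ℝ) ≤ n := by exact_mod_cast hn
  have hsq : s ^ 2 = Real.log n := Real.sq_sqrt (Real.log_nonneg hn1)
  have hs0 : 0 ≤ s := Real.sqrt_nonneg _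
  have hns : (n : ℝ) = Real.exp (s ^ 2) := by rw [hsq, Real.exp_log (by linarith)]
  clear_value s
  have hd2 : (2 : ℝ) ≤ RandomBistochastic.sparsity Q := by exact_mod_cast hd
  obtain ⟨D, hD⟩ : ∃ D, (RandomBistochastic.sparsity Q : ℝ) = Real.exp D := ⟨_, (Real.exp_log (by linarith)).symm⟩
  have hD2 : 2 ≤ Real.exp D := hD ▸ hd2
  have hlog2 := Real.log_two_gt_d9
  have hD0 : 1 / 2 < D := by
    have : Real.log 2 ≤ D := (Real.log_le_iff_le_exp (by norm_num)).2 hD2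
    linarith
  have hR : (RandomBistochastic.sparsity Q : ℝ) ^ ((ℓ : ℝ) + 50 * s) * (n : ℝ) ^ (-c₀) =
      Real.exp (D * (ℓ + 50 * s) + s ^ 2 * -c₀) := by
    rw [hD, hns, ← Real.exp_mul, ← Real.exp_mul, ← Real.exp_add]
  rw [hR]
  -- If the exponent on the right is nonnegative, the bound is at least 1.
  rcases le_or_gt (c₀ * s ^ 2) (D * (ℓ + 50 * s)) with hcase | hcase
  · exact (RandomBistochastic.uniformProb_le_one _).trans (Real.one_le_exp (by linarith))
  have hDs50 : 0 ≤ D * (50 * s) := by positivity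
  have hDℓ : 0 < D * ℓ := by positivity
  have hspos : 0 < s := by
    refine hs0.lt_of_ne fun h => ?_
    rw [← h] at hcase
    norm_num at hcase
    linarith
  -- The term 50 s in the exponent ensures log d ≤ s, hence lam ≤ e ^ s in the block bounds.
  have hDs : D ≤ s := by
    have : D * 50 ≤ c₀ * s := by
      refine le_of_mul_le_mul_right ?_ hspos
      nlinarith
    nlinarith
  have hℓD : ℓ * D ≤ c₀ * s ^ 2 := by nlinarith
  rcases lt_or_ge s S with hsS | hsS
  -- For s below the threshold `S`, ℓ D ≤ s² < 2 S s, so the summand `S` of the constant already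
  -- empties the event.
  · rw [RandomBistochastic.uniformProb_normOnOnesPerp_eq_zero hn hQ hD]
    · positivity
    · have : 0 ≤ (2 * (J : ℝ) + 14) * K * s := by positivity
      nlinarith
  rcases lt_or_ge ℓ K with hℓK | hℓK
  · rw [RandomBistochastic.uniformProb_normOnOnesPerp_eq_zero hn hQ hD]
    · positivity
    · have h1 : (ℓ : ℝ) < K := by exact_mod_cast hℓK
      have h2 : ℓ * D ≤ K * s := mul_le_mul h1.le hDs (by linarith) (by linarith)
      have h3 : 0 ≤ (J : ℝ) * K * s := by positivity
      have h4 : 0 < K * s := by positivity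
      nlinarith
  · obtain ⟨⟨hpoly, h16⟩, hεs⟩ := hS s hsS
    rw [div_le_iff₀' hε0] at hεs
    refine (RandomBistochastic.uniformProb_normOnOnesPerp_le hQ hns h16 hpoly hεs hδ hJ hK (by linarith) (by linarith) hD hD2
      hDs hℓD hℓK (by linarith)).trans (Real.exp_le_exp.2 ?_)
    linarith
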